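/- **Preparation Theorem.** Let $\sigma\in\{-1,+1\}$, let $r,b\ge 1$ be integers, and put \[ P(X)=X^3+3\sigma rb\,X-b,\qquad \partial=4\sigma r^3b+1 . \] Let $L=\mathbb{Q}(\theta)$ be a number field generated by a zero $\theta$ of $P$, with maximal order $\mathcal{O}_L$ and discriminant $d_L$, and let $i(\theta)=(\mathcal{O}_L:\mathbb{Z}[\theta])$. 1. $L$ is a cubic field, the discriminant of $P$ is $d_P=-27b^2\partial$, and $d_L=d_P/i(\theta)^2$. If $\sigma=+1$, then $L$ is complex (one real and one complex place); if $\sigma=-1$, then $L$ is totally real. 2. Suppose that $P$ is monogenic, i.e. $\mathcal{O}_L=\mathbb{Z}[\theta]$, and that $b$ is squarefree. Then $i(\theta)=1$ and $d_L=d_P=-27b^2\partial$. Let $N$ be the Galois closure of $L$. Then $d_L$ has a square root in $N$, and $N=L(\sqrt{d_L})$. Put $K=\mathbb{Q}(\sqrt{d_L})\subseteq N$ and let $d_K$ be the discriminant of $K$. The field $K$ is the unique quadratic subfield of $N$, except if $(\sigma,r,b)=(-1,1,1)$, where $L=N$ is cyclic cubic, $K=\mathbb{Q}$ and $d_K=1$.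 The extension $N/K$ is cyclic cubic. Its conductor is the ideal generated by a positive integer $f$, and \[ d_L=f^2\cdot d_K,\qquad f=3^m f_0, \] with $f_0$ squarefree and coprime to $3$, where * $f=3b$, $b=3f_0$, $m=2$, $3\nmid\partial$, $d_K=-3\partial$, if $3\parallel b$; * $f=9b$, $b=f_0$, $m=2$, $3\parallel\partial$, $d_K=-\partial/3$, if $3\nmid b$ and $3\mid(\sigma rb+1)$; * $f=3b$, $b=f_0$, $m=1$, $3\nmid\partial$, $d_K=-3\partial$, if $3\nmid b$ and $3\nmid(\sigma rb+1)$. In each case the dual field $\mathbb{Q}(\sqrt{-3d_K})$ of $K$ is the quadratic field $\mathbb{Q}(\sqrt{\partial})$, and its discriminant is $\partial$. Here the conductor of the cyclic cubic extension $N/K$ is the ideal of $\mathcal{O}_K$ in which the exponent of each prime $\mathfrak{p}$ is the least $n\ge 0$ such that every unit of $K_{\mathfrak p}$ in $U^{(n)}_{\mathfrak p}$ is a norm from the completion of $N$ at a prime above $\mathfrak{p}$, where $U^{(0)}_{\mathfrak p}$ is the group of all units and $U^{(n)}_{\mathfrak p}=1+\mathfrak{p}^n$ for $n\ge 1$. 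-/

import Mathlib

open Polynomial (X C aeval)
open NumberField IsDedekindDomain IntermediateField
open scoped TensorProduct Polynomial

/-- The trinomial `X ^ 3 + σ * 3 * r * b * X - b`. -/
noncomputable def cubicTrinomial (σ : ℤ) (r b : ℕ) : ℤ[X] :=
  X ^ 3 + C (σ * 3 * r * b) * X - C (b : ℤ)

/-- The number `∂ = σ * 4 * r ^ 3 * b + 1`. -/
def dualDisc (σ : ℤ) (r b : ℕ) : ℤ := σ * 4 * r ^ 3 * b + 1

/-- The index `(𝓞_L : ℤ[θ])` of the equation order in the maximal order, for an algebraic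
integer `θ` of `L`. -/
noncomputable def equationIndex {L : Type*} [Field L] (θ : L) : ℕ :=
  (Algebra.adjoin ℤ {θ}).toSubmodule.toAddSubgroup.relIndex
    (integralClosure ℤ L).toSubmodule.toAddSubgroup

/-- The minimal polynomial of `θ` over `ℤ` is monogenic: the maximal order of `L = ℚ(θ)` is the
equation order `ℤ[θ]`. -/
def IsMonogenicGenerator {L : Type*} [Field L] (θ : L) : Prop :=
  integralClosure ℤ L = Algebra.adjoin ℤ {θ}

section Conductor

variable (K : Type*) [Field K] [NumberField K] (N : Type*) [Field N] [NumberField N] [Algebra K N]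

/-- `u ∈ K_v` is a local norm from `N`. Since `K_v ⊗[K] N` is the product of the completions `N_w`
at the places `w` above `v`, its norm is the product of the local norms; for `N / K` abelian all
`N_w` have the same norm group, so this says that `u` is a norm from `N_w`, for any `w`. -/
def IsLocalNorm (v : HeightOneSpectrum (𝓞 K)) (u : v.adicCompletion K) : Prop :=
  ∃ x : v.adicCompletion K ⊗[K] N, Algebra.norm (v.adicCompletion K) x = u

/-- The group `U_v^(n)`: all units of the valuation ring of `K_v` if `n = 0`, and the units that
are `1` modulo the `n`-th power of the maximal ideal if `n ≥ 1`. -/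
def unitFiltration (v : HeightOneSpectrum (𝓞 K)) (n : ℕ) : Set (v.adicCompletion K) :=
  {u | Valued.v u = 1 ∧ Valued.v (u - 1) ≤ WithZero.exp (-(n : ℤ))}

/-- The ideal `𝔣` is the (finite part of the) conductor of the abelian extension `N / K`: for every
prime `v` of `K`, the exponent of `v` in `𝔣` is the least `n` such that every element of `U_v^(n)`
is a local norm. In odd degree no infinite place ramifies, and this is the whole conductor. -/
def IsConductor (𝔣 : Ideal (𝓞 K)) : Prop :=
  𝔣 ≠ ⊥ ∧ ∀ (v : HeightOneSpectrum (𝓞 K)) (n : ℕ),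
    emultiplicity v.asIdeal 𝔣 ≤ n ↔ ∀ u ∈ unitFiltration K v n, IsLocalNorm K N v u

end Conductor

/-! The global invariants come from discriminants. The power basis 1, θ, θ² has discriminant
−N(P'(θ)), which is also index² · d_L; the sign of d_L gives the signature. Monogenicity is used
through two elements that would be integral outside ℤ[θ]: (rθ+σ)(2rθ−σ)/n if n² ∣ ∂ for a non-unit n
(`squarefree_dualDisc`), and (θ−b)²/3 if 9 ∣ P(b) (`not_nine_dvd_of_isMonogenicGenerator`). Hence ∂
is squarefree. As ∂ ≡ 1 mod 4 and √d_L is a rational multiple of √(−3∂), or of √(−∂/3) if 3 ∣ ∂, the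
discriminants of K and of its dual field follow.

The conductor is computed prime by prime without class field theory. Since N = K(θ), an element of
K_v is a local norm exactly when the explicit norm form in the basis 1, t, t² takes it as a value
(`isLocalNorm_iff_exists_cubicNorm`); here t may be replaced by t − β or t²/ϖ. Units are shown to be
norms by Hensel's lemma. To show that some unit is not a norm, one takes a generator whose
polynomial is Eisenstein at v. Then an integral value of the form is attained at integral
coordinates (`exists_integral_of_cubicNorm_eq`), and expanding in powers of ϖ turns the norm
equation into a polynomial equation over the finite residue field. The polynomial map there is not
injective, hence not surjective.

If v ∤ 3b, every unit is a norm. If v ∣ b and v ∤ 3, the form is A³ modulo ϖ, and cubing is not onto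
because √(−3∂) ∈ K and ∂ ≡ 1 mod b give a primitive cube root of unity in the residue field; the
exponent is 1. Above 3 the map is B ↦ a₁B + a₃B³ if 3 ∤ b (exponent 2) and a ↦ a³ − a if 3 ∣ b
(exponent 4). For 3 ∤ b the condition 9 ∤ P(b) makes the polynomial of θ − b have a constant term
exactly divisible by 3 and supplies the kernel of that map. The relation d_L = f²·d_K is read off
from the explicit values. -/

/-! ### Norm form of a cubic algebra. -/

/-- The norm form of the cubic algebra generated by an element `t` with
`t ^ 3 = e₁ * t ^ 2 - e₂ * t + e₃`, evaluated at `A + B * t + C * t ^ 2`. -/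
def cubicNorm {R : Type*} [CommRing R] (e₁ e₂ e₃ A B C : R) : R :=
  A ^ 3 + A ^ 2 * B * e₁ + A ^ 2 * C * (e₁ ^ 2 - 2 * e₂) + A * B ^ 2 * e₂
    + A * B * C * (e₁ * e₂ - 3 * e₃) + A * C ^ 2 * (e₂ ^ 2 - 2 * e₁ * e₃) + B ^ 3 * e₃
    + B ^ 2 * C * (e₁ * e₃) + B * C ^ 2 * (e₂ * e₃) + C ^ 3 * e₃ ^ 2

theorem map_cubicNorm {R S : Type*} [CommRing R] [CommRing S] (f : R →+* S) (e₁ e₂ e₃ A B C : R) :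
    f (cubicNorm e₁ e₂ e₃ A B C) = cubicNorm (f e₁) (f e₂) (f e₃) (f A) (f B) (f C) := by
  simp only [cubicNorm, map_add, map_sub, map_mul, map_pow, map_ofNat f 2, map_ofNat f 3]

/-- The norm form computes the norm of a cubic algebra with basis `1, t, t ^ 2`. -/
theorem norm_eq_cubicNorm {F A : Type*} [CommRing F] [CommRing A] [Algebra F A]
    (bs : Module.Basis (Fin 3) F A) {t : A} (hbs : ∀ i, bs i = t ^ (i : ℕ)) {e₁ e₂ e₃ : F}
    (ht : t ^ 3 = e₁ • t ^ 2 - e₂ • t + algebraMap F A e₃) (a b c : F) :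
    Algebra.norm F (algebraMap F A a + b • t + c • t ^ 2) = cubicNorm e₁ e₂ e₃ a b c := by
  classical
  set x : A := algebraMap F A a + b • t + c • t ^ 2 with hx
  have h0 : bs 0 = 1 := by simp [hbs]
  have h1 : bs 1 = t := by simp [hbs]
  have h2 : bs 2 = t ^ 2 := by simp [hbs]
  have ht4 : t ^ 4 = (e₁ ^ 2 - e₂) • t ^ 2 + (e₃ - e₁ * e₂) • t + algebraMap F A (e₁ * e₃) := by
    have : t ^ 4 = t ^ 3 * t := by ring
    rw [this, ht]
    simp only [Algebra.smul_def, map_sub, map_mul, map_pow] at ht ⊢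
    linear_combination (algebraMap F A e₁) * ht
  have e0 : x * bs 0 = a • bs 0 + b • bs 1 + c • bs 2 := by
    rw [h0, h1, h2, hx, Algebra.algebraMap_eq_smul_one, mul_one]
  have e1 : x * bs 1 = (c * e₃) • bs 0 + (a - c * e₂) • bs 1 + (b + c * e₁) • bs 2 := by
    rw [h0, h1, h2, hx]
    simp only [Algebra.smul_def, map_sub, map_mul, map_add, mul_one] at ht ⊢
    linear_combination (algebraMap F A c) * ht
  have e2 : x * bs 2 = (b * e₃ + c * (e₁ * e₃)) • bs 0 + (-b * e₂ + c * (e₃ - e₁ * e₂)) • bs 1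
      + (a + b * e₁ + c * (e₁ ^ 2 - e₂)) • bs 2 := by
    rw [h0, h1, h2, hx]
    simp only [Algebra.smul_def, map_sub, map_mul, map_add, map_pow, map_neg, mul_one] at ht ht4 ⊢
    linear_combination (algebraMap F A b) * ht + (algebraMap F A c) * ht4
  have hM : Algebra.leftMulMatrix bs x =
      !![a, c * e₃, b * e₃ + c * (e₁ * e₃);
         b, a - c * e₂, -b * e₂ + c * (e₃ - e₁ * e₂);
         c, b + c * e₁, a + b * e₁ + c * (e₁ ^ 2 - e₂)] := by
    ext i j
    rw [Algebra.leftMulMatrix_eq_repr_mul]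
    fin_cases j
    · simp only [Fin.zero_eta]
      rw [e0]
      fin_cases i <;> simp
    · simp only [Fin.mk_one]
      rw [e1]
      fin_cases i <;> simp
    · simp only [Fin.reduceFinMk]
      rw [e2]
      fin_cases i <;> simp
  rw [Algebra.norm_eq_matrix_det bs, hM, Matrix.det_fin_three]
  simp [cubicNorm]
  ring

/-- The values of the norm form are the norms from the cubic algebra. -/
theorem exists_norm_eq_iff_exists_cubicNorm {F A : Type*} [CommRing F] [CommRing A] [Algebra F A]
    (bs : Module.Basis (Fin 3) F A) {t : A} (hbs : ∀ i, bs i = t ^ (i : ℕ)) {e₁ e₂ e₃ : F}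
    (ht : t ^ 3 = e₁ • t ^ 2 - e₂ • t + algebraMap F A e₃) (u : F) :
    (∃ x : A, Algebra.norm F x = u) ↔ ∃ a b c, cubicNorm e₁ e₂ e₃ a b c = u := by
  constructor
  · rintro ⟨x, rfl⟩
    refine ⟨bs.repr x 0, bs.repr x 1, bs.repr x 2, ?_⟩
    rw [← norm_eq_cubicNorm bs hbs ht]
    congr 1
    conv_rhs => rw [← bs.sum_repr x]
    simp [Fin.sum_univ_three, hbs, Algebra.algebraMap_eq_smul_one]
  · rintro ⟨a, b, c, rfl⟩
    exact ⟨_, norm_eq_cubicNorm bs hbs ht a b c⟩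

/-- A cubic field extension has a basis `1, t, t ^ 2` for every generator `t`. -/
theorem exists_basis_of_finrank_eq_three {F A : Type*} [Field F] [Field A] [Algebra F A]
    (h3 : Module.finrank F A = 3) {t : A} (ht : F⟮t⟯ = ⊤) :
    ∃ bs : Module.Basis (Fin 3) F A, ∀ i, bs i = t ^ (i : ℕ) := by
  have : FiniteDimensional F A := Module.finite_of_finrank_pos (by omega)
  have hint : IsIntegral F t := Algebra.IsIntegral.isIntegral t
  let pb := PowerBasis.ofAdjoinEqTop hint
    (by rw [← IntermediateField.adjoin_simple_toSubalgebra_of_isAlgebraic hint.isAlgebraic, ht,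
      IntermediateField.top_toSubalgebra])
  have hd : pb.dim = 3 := by rw [← pb.finrank, h3]
  refine ⟨pb.basis.reindex (finCongr hd), fun i => ?_⟩
  have hg : pb.gen = t := PowerBasis.ofAdjoinEqTop_gen _ _
  rw [Module.Basis.reindex_apply, PowerBasis.basis_eq_pow, hg]
  simp

/-- The conductor's local norms, expressed by the norm form. -/
theorem isLocalNorm_iff_exists_cubicNorm {K N : Type*} [Field K] [NumberField K] [Field N]
    [NumberField N] [Algebra K N] (h3 : Module.finrank K N = 3) {t : N} (htop : K⟮t⟯ = ⊤)
    {e₁ e₂ e₃ : K} (ht : t ^ 3 = e₁ • t ^ 2 - e₂ • t + algebraMap K N e₃)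
    (v : HeightOneSpectrum (𝓞 K)) (u : v.adicCompletion K) :
    IsLocalNorm K N v u ↔ ∃ a b c, cubicNorm (algebraMap K (v.adicCompletion K) e₁)
      (algebraMap K _ e₂) (algebraMap K _ e₃) a b c = u := by
  obtain ⟨bs, hbs⟩ := exists_basis_of_finrank_eq_three h3 htop
  refine exists_norm_eq_iff_exists_cubicNorm (A := v.adicCompletion K ⊗[K] N)
    (bs.baseChange (v.adicCompletion K)) (t := 1 ⊗ₜ t) ?_ ?_ u
  · intro i
    simp [hbs]
  · simp only [Algebra.TensorProduct.tmul_pow, one_pow, ht, TensorProduct.tmul_add,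
      TensorProduct.tmul_sub, TensorProduct.tmul_smul, algebraMap_smul]
    congr 1
    rw [Algebra.algebraMap_eq_smul_one, TensorProduct.tmul_smul, ← Algebra.TensorProduct.one_def,
      Algebra.algebraMap_eq_smul_one, algebraMap_smul]

/-! ### Discriminant and index of an equation order. -/

/-- A number field generated by `t` has a power basis with generator `t`. -/
theorem exists_powerBasis_gen_eq {F A : Type*} [Field F] [Field A] [Algebra F A]
    [FiniteDimensional F A] {t : A} (ht : F⟮t⟯ = ⊤) : ∃ pb : PowerBasis F A, pb.gen = t := by
  have hint : IsIntegral F t := Algebra.IsIntegral.isIntegral t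
  exact ⟨PowerBasis.ofAdjoinEqTop hint
    (by rw [← IntermediateField.adjoin_simple_toSubalgebra_of_isAlgebraic hint.isAlgebraic, ht,
      IntermediateField.top_toSubalgebra]), PowerBasis.ofAdjoinEqTop_gen _ _⟩

/-- The additive group of an order `ℤ[t]` is generated by the powers of `t` in a power basis. -/
theorem adjoin_int_eq_closure_range_basis {K : Type*} [Field K] [NumberField K]
    (pb : PowerBasis ℚ K) {f : ℤ[X]} (hf : f.Monic) (hdeg : f.natDegree = pb.dim)
    (h0 : aeval pb.gen f = 0) :
    (Algebra.adjoin ℤ {pb.gen}).toSubmodule.toAddSubgroup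
      = AddSubgroup.closure (Set.range pb.basis) := by
  apply le_antisymm
  · intro x hx
    rw [Submodule.mem_toAddSubgroup, Subalgebra.mem_toSubmodule,
      Algebra.adjoin_singleton_eq_range_aeval] at hx
    obtain ⟨g, rfl⟩ := hx
    change aeval pb.gen g ∈ _
    have hpos : 0 < f.natDegree := hdeg ▸ pb.dim_pos
    have hmod : aeval pb.gen g = aeval pb.gen (g %ₘ f) := by
      conv_lhs => rw [← Polynomial.modByMonic_add_div g f]
      simp [h0]
    rw [hmod, Polynomial.aeval_eq_sum_range' (n := pb.dim)]
    · refine sum_mem fun i hi => ?_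
      refine AddSubgroup.zsmul_mem _ (AddSubgroup.subset_closure ?_) _
      exact ⟨⟨i, Finset.mem_range.1 hi⟩, by simp⟩
    · rw [← hdeg]
      refine Polynomial.natDegree_modByMonic_lt _ hf ?_
      rintro rfl
      simp at hpos
  · rw [AddSubgroup.closure_le]
    rintro _ ⟨i, rfl⟩
    rw [PowerBasis.basis_eq_pow]
    exact pow_mem (Algebra.self_mem_adjoin_singleton ℤ pb.gen) _

/-- The ring of integers is generated, as an additive group, by an integral basis. -/
theorem integralClosure_eq_closure_range_integralBasis (K : Type*) [Field K] [NumberField K] :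
    (integralClosure ℤ K).toSubmodule.toAddSubgroup
      = AddSubgroup.closure (Set.range (integralBasis K)) := by
  have h := @mem_span_integralBasis K _ _
  ext x
  rw [← Submodule.span_int_eq_addSubgroupClosure]
  rw [Submodule.mem_toAddSubgroup, Submodule.mem_toAddSubgroup, h]
  rw [Subalgebra.mem_toSubmodule]
  constructor
  · intro hx
    exact ⟨⟨x, hx⟩, rfl⟩
  · rintro ⟨y, rfl⟩
    exact y.2

/-- The discriminant of an equation order is the square of its index times the discriminant of the
number field. -/
theorem discr_powerBasis_eq_equationIndex_sq_mul {K : Type*} [Field K] [NumberField K]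
    (pb : PowerBasis ℚ K) {f : ℤ[X]} (hf : f.Monic) (hdeg : f.natDegree = pb.dim)
    (h0 : aeval pb.gen f = 0) :
    Algebra.discr ℚ pb.basis = (equationIndex pb.gen : ℚ) ^ 2 * discr K ∧
      equationIndex pb.gen ≠ 0 := by
  classical
  have hle : (Algebra.adjoin ℤ {pb.gen}).toSubmodule.toAddSubgroup ≤
      (integralClosure ℤ K).toSubmodule.toAddSubgroup := by
    have : Algebra.adjoin ℤ {pb.gen} ≤ integralClosure ℤ K := by
      rw [Algebra.adjoin_le_iff, Set.singleton_subset_iff]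
      exact ⟨f, hf, by simpa [Polynomial.aeval_def] using h0⟩
    exact this
  let e : Module.Free.ChooseBasisIndex ℤ (𝓞 K) ≃ Fin pb.dim :=
    (integralBasis K).indexEquiv pb.basis
  set b₂ := (integralBasis K).reindex e with hb₂
  have hidx := AddSubgroup.relIndex_eq_abs_det _ _ hle pb.basis b₂
    (adjoin_int_eq_closure_range_basis pb hf hdeg h0)
    (by rw [integralClosure_eq_closure_range_integralBasis, Module.Basis.range_reindex])
  change (equationIndex pb.gen : ℚ) = _ at hidx
  have hd : Algebra.discr ℚ b₂ = discr K := by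
    rw [coe_discr, hb₂]
    have := Algebra.discr_reindex (A := ℚ) (integralBasis K) e
    rw [← this]
    congr 1
    ext i
    simp
  have hdisc : Algebra.discr ℚ pb.basis = (equationIndex pb.gen : ℚ) ^ 2 * discr K := by
    rw [hidx, sq_abs, ← hd, Module.Basis.det_apply, ← Algebra.discr_of_matrix_vecMul]
    congr 1
    exact (b₂.toMatrix_map_vecMul pb.basis).symm
  refine ⟨hdisc, fun h => ?_⟩
  have := Algebra.discr_not_zero_of_basis ℚ pb.basis
  rw [hdisc, h] at this
  simp at this

/-! ### The trinomial: discriminant and irreducibility. -/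

theorem cubicTrinomial_eq (σ : ℤ) (r b : ℕ) :
    cubicTrinomial σ r b
      = C (1 : ℤ) * X ^ 3 + C 0 * X ^ 2 + C (σ * 3 * r * b) * X + C (-(b : ℤ)) := by
  simp only [cubicTrinomial, map_neg, map_zero, map_one]
  ring

theorem monic_cubicTrinomial (σ : ℤ) (r b : ℕ) : (cubicTrinomial σ r b).Monic := by
  rw [cubicTrinomial_eq, Polynomial.Monic, Polynomial.leadingCoeff_cubic one_ne_zero]

theorem natDegree_cubicTrinomial (σ : ℤ) (r b : ℕ) : (cubicTrinomial σ r b).natDegree = 3 := by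
  rw [cubicTrinomial_eq, Polynomial.natDegree_cubic one_ne_zero]

theorem discr_cubicTrinomial {σ : ℤ} (hσ : σ = 1 ∨ σ = -1) (r b : ℕ) :
    (cubicTrinomial σ r b).discr = -27 * (b : ℤ) ^ 2 * dualDisc σ r b := by
  have h : (cubicTrinomial σ r b).degree = 3 := by
    rw [cubicTrinomial_eq, Polynomial.degree_cubic one_ne_zero]
  have hσ3 : σ ^ 3 = σ := by rcases hσ with rfl | rfl <;> norm_num
  rw [Polynomial.discr_of_degree_eq_three h, cubicTrinomial_eq]
  simp only [Polynomial.coeff_add, Polynomial.coeff_C_mul, Polynomial.coeff_X_pow,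
    Polynomial.coeff_X,
    Polynomial.coeff_C, dualDisc]
  norm_num
  linear_combination -108 * (r : ℤ) ^ 3 * b ^ 3 * hσ3

theorem aeval_cubicTrinomial {A : Type*} [CommRing A] (σ : ℤ) (r b : ℕ) (x : A) :
    aeval x (cubicTrinomial σ r b) = x ^ 3 + ((σ * 3 * r * b : ℤ) : A) * x - (b : A) := by
  simp [cubicTrinomial, map_ofNat (aeval (R := ℤ) x) 3]

/-- An integral root n satisfies n³ = b(1 − 3σrn). The second factor is coprime to n, hence equals
±1, which forces n = 0 and then b = 0. -/
theorem irreducible_cubicTrinomial {σ : ℤ} (hσ : σ = 1 ∨ σ = -1) {r b : ℕ} (hr : 0 < r)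
    (hb : 0 < b) : Irreducible (cubicTrinomial σ r b) := by
  have hm := monic_cubicTrinomial σ r b
  rw [hm.irreducible_iff_roots_eq_zero_of_degree_le_three
      (by rw [natDegree_cubicTrinomial]; norm_num)
    (by rw [natDegree_cubicTrinomial]), Multiset.eq_zero_iff_forall_notMem]
  intro n hn
  rw [Polynomial.mem_roots hm.ne_zero, Polynomial.IsRoot.def] at hn
  have hn' : n ^ 3 + σ * 3 * r * b * n - b = 0 := by
    have := aeval_cubicTrinomial σ r b n
    rw [Polynomial.coe_aeval_eq_eval, hn] at this
    push_cast at this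
    exact this.symm
  have hcop : IsCoprime (1 - 3 * σ * r * n) (n ^ 3) :=
    IsCoprime.pow_right ⟨1, 3 * σ * r, by ring⟩
  have hunit : IsUnit (1 - 3 * σ * r * n) :=
    hcop.isUnit_of_dvd' dvd_rfl ⟨b, by linear_combination hn'⟩
  have hσ0 : σ ≠ 0 := by rcases hσ with rfl | rfl <;> norm_num
  have key : σ * r * n = 0 := by
    rcases Int.isUnit_iff.1 hunit with h | h
    · linarith
    · have : 3 * (σ * r * n) = 2 := by linarith
      omega
  have hn0 : n = 0 := by
    rcases mul_eq_zero.1 key with h | h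
    · rcases mul_eq_zero.1 h with h | h
      · exact absurd h hσ0
      · omega
    · exact h
  subst hn0
  simp at hn'
  omega

/-! ### The cubic field: degree, discriminant, signature. -/

section Generator

variable {σ : ℤ} {r b : ℕ} {L : Type*} [Field L] [NumberField L] {θ : L}

theorem minpoly_eq_map_cubicTrinomial (hσ : σ = 1 ∨ σ = -1) (hr : 0 < r) (hb : 0 < b)
    (hθ : aeval θ (cubicTrinomial σ r b) = 0) :
    minpoly ℚ θ = (cubicTrinomial σ r b).map (Int.castRingHom ℚ) := by
  have hm := monic_cubicTrinomial σ r b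
  symm
  refine minpoly.eq_of_irreducible_of_monic ?_ ?_ (hm.map _)
  · exact (Polynomial.IsPrimitive.Int.irreducible_iff_irreducible_map_cast hm.isPrimitive).1
      (irreducible_cubicTrinomial hσ hr hb)
  · rw [← algebraMap_int_eq, Polynomial.aeval_map_algebraMap]
    exact hθ

theorem finrank_eq_three (hσ : σ = 1 ∨ σ = -1) (hr : 0 < r) (hb : 0 < b)
    (hθ : aeval θ (cubicTrinomial σ r b) = 0) (hL : ℚ⟮θ⟯ = ⊤) : Module.finrank ℚ L = 3 := by
  rw [← IntermediateField.finrank_top', ← hL,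
    IntermediateField.adjoin.finrank (Algebra.IsIntegral.isIntegral θ),
    minpoly_eq_map_cubicTrinomial hσ hr hb hθ, (monic_cubicTrinomial σ r b).natDegree_map,
    natDegree_cubicTrinomial]

theorem generator_pow_three (hθ : aeval θ (cubicTrinomial σ r b) = 0) :
    θ ^ 3 = (0 : ℚ) • θ ^ 2 - (σ * 3 * r * b : ℚ) • θ + algebraMap ℚ L b := by
  rw [aeval_cubicTrinomial] at hθ
  simp only [Algebra.smul_def, map_mul, map_zero]
  push_cast at hθ ⊢
  simp only [map_intCast, map_ofNat] at hθ ⊢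
  linear_combination hθ

/-- The discriminant of `L` is the polynomial discriminant divided by the squared index. -/
theorem discr_polynomial_eq (hσ : σ = 1 ∨ σ = -1) (hr : 0 < r) (hb : 0 < b)
    (hθ : aeval θ (cubicTrinomial σ r b) = 0) (hL : ℚ⟮θ⟯ = ⊤) :
    equationIndex θ ≠ 0 ∧
      ((cubicTrinomial σ r b).discr : ℚ) = (equationIndex θ : ℚ) ^ 2 * discr L := by
  have h3 := finrank_eq_three hσ hr hb hθ hL
  obtain ⟨pb, rfl⟩ := exists_powerBasis_gen_eq hL
  have hdim : pb.dim = 3 := by rw [← pb.finrank, h3]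
  obtain ⟨h1, h2⟩ := discr_powerBasis_eq_equationIndex_sq_mul pb (monic_cubicTrinomial σ r b)
    (by rw [natDegree_cubicTrinomial, hdim]) hθ
  refine ⟨h2, ?_⟩
  -- The discriminant of the power basis is −N(P'(θ)), and the norm form evaluates this norm.
  rw [← h1, Algebra.discr_powerBasis_eq_norm, h3, minpoly_eq_map_cubicTrinomial hσ hr hb hθ,
    Polynomial.derivative_map, ← algebraMap_int_eq, Polynomial.aeval_map_algebraMap]
  have hder : aeval pb.gen (cubicTrinomial σ r b).derivative
      = algebraMap ℚ L (σ * 3 * r * b) + (0 : ℚ) • pb.gen + (3 : ℚ) • pb.gen ^ 2 := by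
    simp only [cubicTrinomial, Polynomial.derivative_sub, Polynomial.derivative_add,
      Polynomial.derivative_X_pow, Polynomial.derivative_C_mul, Polynomial.derivative_X,
      Polynomial.derivative_C]
    simp [Algebra.smul_def, map_ofNat (aeval (R := ℤ) pb.gen) 3]
    ring
  obtain ⟨bs, hbs⟩ := exists_basis_of_finrank_eq_three h3 hL
  rw [hder, norm_eq_cubicNorm bs hbs (generator_pow_three hθ), discr_cubicTrinomial hσ]
  have hσ3 : (σ : ℚ) ^ 3 = σ := by rcases hσ with rfl | rfl <;> norm_num
  simp only [cubicNorm, dualDisc]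
  push_cast
  norm_num
  linear_combination 108 * (r : ℚ) ^ 3 * b ^ 3 * hσ3

theorem dualDisc_sign (hσ : σ = 1 ∨ σ = -1) (hr : 0 < r) (hb : 0 < b) :
    (σ = 1 → 0 < dualDisc σ r b) ∧ (σ = -1 → dualDisc σ r b < 0) := by
  have : 0 < (r : ℤ) ^ 3 * b := by positivity
  refine ⟨?_, ?_⟩ <;> rintro rfl <;> simp only [dualDisc] <;> nlinarith

theorem dualDisc_ne_zero (hσ : σ = 1 ∨ σ = -1) (hr : 0 < r) (hb : 0 < b) :
    dualDisc σ r b ≠ 0 := by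
  rcases hσ with h | h
  · exact ((dualDisc_sign (Or.inl h) hr hb).1 h).ne'
  · exact ((dualDisc_sign (Or.inr h) hr hb).2 h).ne

/-- The sign of d_L is (−1) to the number of complex places, which is 0 or 1 in degree 3, and d_L
has the sign of −∂. -/
theorem signature_of_sign (hσ : σ = 1 ∨ σ = -1) (hr : 0 < r) (hb : 0 < b)
    (hθ : aeval θ (cubicTrinomial σ r b) = 0) (hL : ℚ⟮θ⟯ = ⊤) :
    (σ = 1 → InfinitePlace.nrRealPlaces L = 1 ∧ InfinitePlace.nrComplexPlaces L = 1) ∧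
      (σ = -1 → IsTotallyReal L) := by
  obtain ⟨hi, hd⟩ := discr_polynomial_eq hσ hr hb hθ hL
  have hsum := InfinitePlace.card_add_two_mul_card_eq_rank L
  rw [finrank_eq_three hσ hr hb hθ hL] at hsum
  have hsgn := sign_discr L
  have hb' : (0 : ℚ) < (b : ℚ) ^ 2 := by positivity
  have hi' : (0 : ℚ) < (equationIndex θ : ℚ) ^ 2 := by positivity
  rw [discr_cubicTrinomial hσ] at hd
  push_cast at hd
  have hpos := dualDisc_sign hσ hr hb
  refine ⟨fun h => ?_, fun h => ?_⟩
  · have h1 : (0 : ℚ) < dualDisc σ r b := by exact_mod_cast hpos.1 h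
    have h2 : discr L < 0 := by
      by_contra hcon
      have h3 : (0 : ℚ) ≤ discr L := by exact_mod_cast not_lt.1 hcon
      have := mul_pos hb' h1
      have := mul_nonneg hi'.le h3
      linarith
    rw [Int.sign_eq_neg_one_of_neg h2] at hsgn
    have h4 : InfinitePlace.nrComplexPlaces L ≠ 0 := by
      intro h0
      rw [h0] at hsgn
      norm_num at hsgn
    omega
  · have h1 : (dualDisc σ r b : ℚ) < 0 := by exact_mod_cast hpos.2 h
    have h2 : 0 < discr L := by
      by_contra hcon
      have h3 : (discr L : ℚ) ≤ 0 := by exact_mod_cast not_lt.1 hcon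
      have := mul_neg_of_pos_of_neg hb' h1
      have := mul_nonpos_of_nonneg_of_nonpos hi'.le h3
      linarith
    rw [Int.sign_eq_one_of_pos h2] at hsgn
    have h4 : InfinitePlace.nrComplexPlaces L ≠ 1 := by
      intro h0
      rw [h0] at hsgn
      norm_num at hsgn
    exact nrComplexPlaces_eq_zero_iff.1 (by omega)

end Generator

/-! ### Consequences of monogenicity. -/

section Monogenic

theorem equationIndex_eq_one {L : Type*} [Field L] {θ : L} (h : IsMonogenicGenerator θ) :
    equationIndex θ = 1 := by
  rw [equationIndex, h]
  exact AddSubgroup.relIndex_self _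

variable {σ : ℤ} {r b : ℕ} {L : Type*} [Field L] [NumberField L] {θ : L}

/-- In the monogenic case, the numerators of an algebraic integer are divisible by its
denominator. -/
theorem dvd_coeff_of_isIntegral (hmon : IsMonogenicGenerator θ)
    (h3 : Module.finrank ℚ L = 3) (hL : ℚ⟮θ⟯ = ⊤) {n : ℤ} {f : ℤ[X]} (hf : f.Monic)
    (hdeg : f.natDegree = 3) (h0 : aeval θ f = 0) {a₀ a₁ a₂ : ℤ} {x : L} (hx : IsIntegral ℤ x)
    (hnx : (n : L) * x = a₀ + a₁ * θ + a₂ * θ ^ 2) : n ∣ a₀ ∧ n ∣ a₂ := by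
  obtain ⟨bs, hbs⟩ := exists_basis_of_finrank_eq_three h3 hL
  have hx' : x ∈ Algebra.adjoin ℤ {θ} := hmon ▸ hx
  rw [Algebra.adjoin_singleton_eq_range_aeval] at hx'
  obtain ⟨g, rfl⟩ := hx'
  have hmod : aeval θ g = aeval θ (g %ₘ f) := by
    conv_lhs => rw [← Polynomial.modByMonic_add_div g f]
    simp [h0]
  have hlt : (g %ₘ f).natDegree < 3 := by
    rw [← hdeg]
    refine Polynomial.natDegree_modByMonic_lt _ hf ?_
    rintro rfl
    simp at hdeg
  change (n : L) * aeval θ g = _ at hnx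
  rw [hmod, Polynomial.aeval_eq_sum_range' hlt] at hnx
  set c := (g %ₘ f).coeff
  have hlin := Fintype.linearIndependent_iff.1 bs.linearIndependent
    ![(n * c 0 - a₀ : ℚ), n * c 1 - a₁, n * c 2 - a₂] (by
      simp only [Fin.sum_univ_three, hbs]
      simp [Finset.sum_range_succ, Algebra.smul_def] at hnx ⊢
      linear_combination hnx)
  have e0 := hlin 0
  have e2 := hlin 2
  simp only [Matrix.cons_val] at e0 e2
  refine ⟨⟨c 0, ?_⟩, ⟨c 2, ?_⟩⟩
  · have : (n * c 0 - a₀ : ℚ) = 0 := e0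
    exact_mod_cast (sub_eq_zero.1 this).symm
  · have : (n * c 2 - a₂ : ℚ) = 0 := e2
    exact_mod_cast (sub_eq_zero.1 this).symm

/-- In the monogenic case, the dual discriminant is squarefree. -/
theorem squarefree_dualDisc (hσ : σ = 1 ∨ σ = -1) (hr : 0 < r) (hb : 0 < b)
    (hθ : aeval θ (cubicTrinomial σ r b) = 0) (hL : ℚ⟮θ⟯ = ⊤) (hmon : IsMonogenicGenerator θ) :
    Squarefree (dualDisc σ r b) := by
  rintro n ⟨k, hk⟩
  have hθ' := hθ
  rw [aeval_cubicTrinomial] at hθ'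
  have hθint : IsIntegral ℤ θ := ⟨_, monic_cubicTrinomial σ r b, hθ⟩
  have hint (m : ℤ) : IsIntegral ℤ (m : L) := isIntegral_algebraMap (R := ℤ) (A := L) (x := m)
  have hn : n ≠ 0 := by
    rintro rfl
    exact dualDisc_ne_zero hσ hr hb (by simp [hk])
  have hnL : (n : L) ≠ 0 := by exact_mod_cast hn
  have hσ2 : (σ : L) ^ 2 = 1 := by rcases hσ with rfl | rfl <;> norm_num
  -- Modulo ∂ the trinomial has the roots −σ/r and, twice, σ/(2r); exactly, (rθ+σ)(2rθ−σ)² =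
  -- ∂·(σ−3rθ). So n² divides w² in ℤ[θ], whereas the constant coefficient of w is −1.
  set w : L := (r * θ + σ) * (2 * r * θ - σ) with hw
  have hw2 : w ^ 2 = n ^ 2 * (k * ((σ - 3 * r * θ) * (r * θ + σ))) := by
    have hkL : (σ : L) * 4 * r ^ 3 * b + 1 = n * n * k := by
      have := congrArg (Int.cast (R := L)) hk
      simpa [dualDisc] using this
    push_cast at hθ'
    rw [hw]
    linear_combination (r * θ + σ) * (4 * r ^ 3) * hθ' + ((σ - 3 * r * θ) * (r * θ + σ)) * hkL
      + (r * θ + σ) * (-3 * r * θ + σ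
        - 4 * r ^ 3 * b + 12 * r ^ 4 * b * θ * σ - 12 * r ^ 4 * b * θ * σ) * hσ2
  have hx : IsIntegral ℤ (w / n) := by
    refine IsIntegral.of_pow (n := 2) (by norm_num) ?_
    have : (w / n) ^ 2 = k * ((σ - 3 * r * θ) * (r * θ + σ)) := by
      rw [div_pow, hw2]
      field_simp
    rw [this]
    have h3 := hint 3
    have hr' := hint r
    push_cast at h3 hr'
    exact (hint k).mul ((((hint σ).sub ((h3.mul hr').mul hθint))).mul
      ((hr'.mul hθint).add (hint σ)))
  have := dvd_coeff_of_isIntegral hmon (finrank_eq_three hσ hr hb hθ hL) hL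
    (monic_cubicTrinomial σ r b) (natDegree_cubicTrinomial σ r b) hθ (n := n) (a₀ := -1)
    (a₁ := σ * r) (a₂ := 2 * r ^ 2) hx (by
      rw [mul_div_cancel₀ _ hnL, hw]
      push_cast
      linear_combination -hσ2)
  exact isUnit_of_dvd_unit this.1 (by norm_num)

/-- In the monogenic case with `b` prime to `3`, the value `P(b)` is not divisible by `9`. -/
theorem not_nine_dvd_of_isMonogenicGenerator (hσ : σ = 1 ∨ σ = -1) (hr : 0 < r) (hb : 0 < b)
    (hθ : aeval θ (cubicTrinomial σ r b) = 0) (hL : ℚ⟮θ⟯ = ⊤) (hmon : IsMonogenicGenerator θ) :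
    ¬ 9 ∣ (b : ℤ) ^ 3 + σ * 3 * r * b * b - b := by
  rintro ⟨k, hk⟩
  have hθ' := hθ
  rw [aeval_cubicTrinomial] at hθ'
  -- The characteristic polynomial of (θ−b)²/3, where P(b) = 9k is needed for integral coefficients.
  -- The numerator (θ−b)² has θ²-coefficient 1, which 3 does not divide.
  set f : ℤ[X] := X ^ 3 - C ((b : ℤ) ^ 2 - 2 * σ * r * b) * X ^ 2
    + C (((b : ℤ) ^ 2 + σ * r * b) ^ 2 - 6 * b * k) * X - C (3 * k ^ 2) with hf
  have hfm : f.Monic := by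
    rw [hf]
    monicity!
  have hx : IsIntegral ℤ ((θ - b) ^ 2 / 3) := by
    refine ⟨f, hfm, ?_⟩
    change aeval _ f = 0
    have hkL : (b : L) ^ 3 + σ * 3 * r * b * b - b = 9 * k := by
      have := congrArg (Int.cast (R := L)) hk
      simpa using this
    have hφ :
        (θ - b) ^ 3 + 3 * b * (θ - b) ^ 2 + 3 * (b ^ 2 + σ * r * b) * (θ - b) + 9 * k = 0 := by
      push_cast at hθ'
      linear_combination hθ' - hkL
    simp only [hf, map_sub, map_add, map_mul, map_pow, Polynomial.aeval_X,
      eq_intCast, map_natCast, map_intCast, map_ofNat]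
    set φ := θ - b
    have hex : ∀ p : L, p = (b : L) ^ 2 + σ * r * b →
        φ ^ 3 + 3 * b * φ ^ 2 + 3 * p * φ + 9 * k = 0 →
        (φ ^ 2 / 3) ^ 3 - (b ^ 2 - 2 * (p - b ^ 2)) * (φ ^ 2 / 3) ^ 2
          + (p ^ 2 - 6 * b * k) * (φ ^ 2 / 3) - 3 * k ^ 2 = 0 := by
      intro p _ hp
      -- The cubic g of φ satisfies g(φ)·(−g(−φ)) = 27·f(φ²/3).
      linear_combination (φ ^ 3 - 3 * b * φ ^ 2 + 3 * p * φ - 9 * k) / 27 * hp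
    have := hex _ rfl hφ
    linear_combination this
  have := dvd_coeff_of_isIntegral hmon (finrank_eq_three hσ hr hb hθ hL) hL
    (monic_cubicTrinomial σ r b) (natDegree_cubicTrinomial σ r b) hθ (n := 3) (a₀ := b ^ 2)
    (a₁ := -2 * b) (a₂ := 1) hx (by push_cast; ring)
  omega

end Monogenic

/-! ### Quadratic fields of discriminant D ≡ 1 mod 4. -/

/-- The discriminant of the quadratic field generated by a square root of a squarefree integer that
is `1` modulo `4`. -/
theorem discr_of_sq_eq {K : Type*} [Field K] [NumberField K] {s : K} {D : ℤ}
    (hs : s ^ 2 = D) (htop : ℚ⟮s⟯ = ⊤) (hD : Squarefree D) (hD1 : D ≠ 1) (h4 : D % 4 = 1) :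
    Module.finrank ℚ K = 2 ∧ discr K = D := by
  have hirr : Irreducible (X ^ 2 - C (D : ℚ)) := by
    refine X_pow_sub_C_irreducible_of_prime Nat.prime_two fun q hq => ?_
    have hint : IsIntegral ℤ q := IsIntegral.of_pow (n := 2) (by norm_num)
      (by rw [hq]; exact isIntegral_algebraMap (R := ℤ) (A := ℚ) (x := D))
    obtain ⟨m, rfl⟩ := IsIntegrallyClosed.isIntegral_iff.1 hint
    have hm : m ^ 2 = D := by
      rw [eq_intCast] at hq
      exact_mod_cast hq
    rcases Int.isUnit_iff.1 (hD m ⟨1, by linear_combination -hm⟩) with h | h <;>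
    · subst h
      exact hD1 (by linarith)
  have hmin : minpoly ℚ s = X ^ 2 - C (D : ℚ) := by
    symm
    refine minpoly.eq_of_irreducible_of_monic hirr (by simp [hs]) (by monicity!)
  have h2 : Module.finrank ℚ K = 2 := by
    rw [← IntermediateField.finrank_top', ← htop,
      IntermediateField.adjoin.finrank (Algebra.IsIntegral.isIntegral s), hmin]
    compute_degree!
  refine ⟨h2, ?_⟩
  have hnorm : Algebra.norm ℚ s = -D := by
    obtain ⟨pb, rfl⟩ := exists_powerBasis_gen_eq htop
    rw [Algebra.PowerBasis.norm_gen_eq_coeff_zero_minpoly, hmin, ← pb.finrank, h2]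
    simp
  -- The order ℤ[(1+s)/2] has discriminant −N(s) = D. This is index² times the field discriminant,
  -- so the index is 1 because D is squarefree.
  have htop' : ℚ⟮(1 + s) / 2⟯ = ⊤ := by
    rw [eq_top_iff, ← htop, IntermediateField.adjoin_simple_le_iff]
    have h1 := IntermediateField.mem_adjoin_simple_self ℚ ((1 + s) / 2)
    have : (1 + s) / 2 + (1 + s) / 2 - 1 = s := by ring
    have h2 := sub_mem (add_mem h1 h1) (one_mem _)
    rwa [this] at h2
  obtain ⟨pb, hpb⟩ := exists_powerBasis_gen_eq htop'
  have hdim : pb.dim = 2 := by rw [← pb.finrank, h2]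
  obtain ⟨k, hk⟩ : (4 : ℤ) ∣ 1 - D := by omega
  set f : ℤ[X] := X ^ 2 - X + C k with hf
  have hfm : f.Monic := by rw [hf]; monicity!
  have hfd : f.natDegree = 2 := by rw [hf]; compute_degree!
  have hkK : (1 : K) - D = 4 * k := by exact_mod_cast congrArg (Int.cast (R := K)) hk
  have hf0 : aeval pb.gen f = 0 := by
    rw [hpb, hf]
    simp only [map_add, map_sub, map_pow, Polynomial.aeval_X, eq_intCast,
      map_intCast (aeval (R := ℤ) ((1 + s) / 2)) k]
    linear_combination hs / 4 - hkK / 4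
  have hfmin : minpoly ℚ pb.gen = f.map (algebraMap ℤ ℚ) := by
    have hm := hfm.map (algebraMap ℤ ℚ)
    symm
    refine Polynomial.eq_of_monic_of_dvd_of_natDegree_le (minpoly.monic pb.isIntegral_gen) hm
      (minpoly.dvd _ _ (by rw [Polynomial.aeval_map_algebraMap, hf0])) ?_
    rw [hfm.natDegree_map, hfd, pb.natDegree_minpoly, hdim]
  obtain ⟨h1, -⟩ := discr_powerBasis_eq_equationIndex_sq_mul pb hfm (by rw [hfd, hdim]) hf0
  rw [Algebra.discr_powerBasis_eq_norm, h2, hfmin, Polynomial.derivative_map,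
    Polynomial.aeval_map_algebraMap] at h1
  have hder : aeval pb.gen f.derivative = s := by
    rw [hpb, hf]
    simp [map_ofNat (aeval (R := ℤ) ((1 + s) / 2)) 2]
    ring
  rw [hder, hnorm] at h1
  norm_num at h1
  have h1' : D = (equationIndex pb.gen : ℤ) ^ 2 * discr K := by exact_mod_cast h1
  rcases Int.isUnit_iff.1 (hD (equationIndex pb.gen) ⟨discr K, by rw [h1']; ring⟩) with h | h
  · rw [h1', h]; ring
  · rw [h1', h]; ring

/-! ### The Galois closure and its quadratic subfield. -/

section NormalClosure

variable {σ : ℤ} {r b : ℕ} {L : Type*} [Field L] [NumberField L] {θ : L}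

/-- The three roots of the trinomial in the normal closure, and their symmetric functions. -/
theorem exists_roots_normalClosure (hσ : σ = 1 ∨ σ = -1) (hr : 0 < r) (hb : 0 < b)
    (hθ : aeval θ (cubicTrinomial σ r b) = 0)
    (N : Type*) [Field N] [NumberField N] [Algebra L N] [IsNormalClosure ℚ L N] :
    ∃ y z : N, ∀ t : N, t ^ 3 + ((σ * 3 * r * b : ℤ) : N) * t - (b : N)
      = (t - algebraMap L N θ) * (t - y) * (t - z) := by
  have hspl := IsNormalClosure.splits (F := ℚ) (K := L) (L := N) θ
  rw [minpoly_eq_map_cubicTrinomial hσ hr hb hθ, Polynomial.map_map] at hspl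
  have hc : (algebraMap ℚ N).comp (Int.castRingHom ℚ) = algebraMap ℤ N := RingHom.ext_int _ _
  rw [hc] at hspl
  have hm := (monic_cubicTrinomial σ r b).map (algebraMap ℤ N)
  set f := (cubicTrinomial σ r b).map (algebraMap ℤ N) with hf
  have hcard : f.roots.card = 3 := by
    rw [← hspl.natDegree_eq_card_roots, (monic_cubicTrinomial σ r b).natDegree_map,
      natDegree_cubicTrinomial]
  have hmem : algebraMap L N θ ∈ f.roots := by
    rw [Polynomial.mem_roots hm.ne_zero, Polynomial.IsRoot.def, hf, Polynomial.eval_map_algebraMap,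
      Polynomial.aeval_algebraMap_apply, hθ, map_zero]
  obtain ⟨s, hs⟩ := Multiset.exists_cons_of_mem hmem
  rw [hs, Multiset.card_cons] at hcard
  obtain ⟨y, z, hyz⟩ := Multiset.card_eq_two.1 (by omega : s.card = 2)
  refine ⟨y, z, fun t => ?_⟩
  have h := hspl.eval_eq_prod_roots_of_monic hm t
  rw [hs, hyz, hf, Polynomial.eval_map_algebraMap, aeval_cubicTrinomial] at h
  rw [h]
  simp [mul_assoc]

/-- The product (x−y)(x−z) = P'(x) lies in L and is nonzero, so L(√d) contains y − z; since y + z =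
−x, it contains all three roots. -/
theorem exists_sq_eq_and_adjoin_eq_top (hσ : σ = 1 ∨ σ = -1) (hr : 0 < r) (hb : 0 < b)
    (hθ : aeval θ (cubicTrinomial σ r b) = 0) (hL : ℚ⟮θ⟯ = ⊤)
    (N : Type*) [Field N] [NumberField N] [Algebra L N] [IsNormalClosure ℚ L N] :
    (∃ δ : N, δ ^ 2 = ((cubicTrinomial σ r b).discr : N)) ∧
      ∀ δ : N, δ ^ 2 = ((cubicTrinomial σ r b).discr : N) →
        IntermediateField.adjoin L {δ} = ⊤ := by
  obtain ⟨y, z, hyz⟩ := exists_roots_normalClosure hσ hr hb hθ N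
  set x := algebraMap L N θ with hx
  set p : N := ((σ * 3 * r * b : ℤ) : N) with hp
  have h0 := hyz 0
  have h1 := hyz 1
  have hm1 := hyz (-1)
  have e1 : x + y + z = 0 := by linear_combination (h1 + hm1 - 2 * h0) / 2
  have e2 : x * y + x * z + y * z = p := by linear_combination (hm1 - h1) / 2
  have e3 : x * y * z = b := by linear_combination h0
  have hdisc : ((cubicTrinomial σ r b).discr : N) = -4 * p ^ 3 - 27 * b ^ 2 := by
    rw [discr_cubicTrinomial hσ, hp, dualDisc]
    have hσ3 : (σ : N) ^ 3 = σ := by rcases hσ with rfl | rfl <;> norm_num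
    push_cast
    linear_combination (4 * 27 * (r : N) ^ 3 * b ^ 3) * hσ3
  have hz : z = -x - y := by linear_combination e1
  have hΔ : ((x - y) * (x - z) * (y - z)) ^ 2 = ((cubicTrinomial σ r b).discr : N) := by
    rw [hdisc, ← e2, ← e3, hz]
    ring
  refine ⟨⟨_, hΔ⟩, fun δ hδ => ?_⟩
  have hne : ((cubicTrinomial σ r b).discr : N) ≠ 0 := by
    rw [Int.cast_ne_zero, discr_cubicTrinomial hσ]
    have := dualDisc_ne_zero hσ hr hb
    have : (b : ℤ) ≠ 0 := by omega
    positivity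
  rw [← hΔ] at hne
  have hne' : (x - y) * (x - z) ≠ 0 := fun h => hne (by rw [h]; ring)
  set E := IntermediateField.adjoin L {δ} with hE
  have hxE : x ∈ E := E.algebraMap_mem θ
  have hδE : δ ∈ E := IntermediateField.mem_adjoin_simple_self L δ
  have hΔE : (x - y) * (x - z) * (y - z) ∈ E := by
    rcases sq_eq_sq_iff_eq_or_eq_neg.1 (hδ.trans hΔ.symm) with h | h
    · exact h ▸ hδE
    · have := neg_mem hδE
      rwa [h, neg_neg] at this
  have hpE : p ∈ E := by rw [hp]; exact intCast_mem E _
  have hder : (x - y) * (x - z) = 3 * x ^ 2 + p := by rw [← e2, hz]; ring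
  have h3E : (3 : N) ∈ E := by exact_mod_cast IntermediateField.natCast_mem E 3
  have h2E : (2 : N) ∈ E := by exact_mod_cast IntermediateField.natCast_mem E 2
  have hdE : (x - y) * (x - z) ∈ E := by
    rw [hder]
    exact add_mem (mul_mem h3E (pow_mem hxE 2)) hpE
  have hsub : y - z ∈ E := by
    have := div_mem hΔE hdE
    rwa [mul_div_cancel_left₀ _ hne'] at this
  have hyE : y ∈ E := by
    have h : y = (-x + (y - z)) / 2 := by rw [hz]; ring
    rw [h]
    exact div_mem (add_mem (neg_mem hxE) hsub) h2E
  have hzE : z ∈ E := by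
    rw [hz]
    exact sub_mem (neg_mem hxE) hyE
  have hle : normalClosure ℚ L N ≤ E.restrictScalars ℚ := by
    rw [normalClosure_le_iff]
    intro f
    rw [AlgHom.fieldRange_eq_map, ← hL, IntermediateField.adjoin_map, Set.image_singleton,
      IntermediateField.adjoin_simple_le_iff]
    have hf : (f θ) ^ 3 + p * (f θ) - b = 0 := by
      have := congrArg f hθ
      rw [aeval_cubicTrinomial] at this
      simpa [hp, map_ofNat f 3] using this
    rw [hyz] at hf
    have : f θ = x ∨ f θ = y ∨ f θ = z := by
      rcases mul_eq_zero.1 hf with h | h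
      · rcases mul_eq_zero.1 h with h | h
        · exact Or.inl (sub_eq_zero.1 h)
        · exact Or.inr (Or.inl (sub_eq_zero.1 h))
      · exact Or.inr (Or.inr (sub_eq_zero.1 h))
    rcases this with h | h | h <;> rw [h] <;> assumption
  have htop : normalClosure ℚ L N = ⊤ :=
    (Algebra.IsAlgebraic.isNormalClosure_iff.1 inferInstance).2
  rw [htop, top_le_iff] at hle
  rwa [IntermediateField.restrictScalars_eq_top_iff] at hle

/-- The degree of the normal closure divides `6`, and the square root of the discriminant generates
the only quadratic subfield. -/
theorem finrank_adjoin_of_sq_eq (h3 : Module.finrank ℚ L = 3)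
    {N : Type*} [Field N] [NumberField N] [Algebra L N] {δ : N} {d : ℤ} (hd : δ ^ 2 = (d : N))
    (htop : IntermediateField.adjoin L {δ} = ⊤) :
    (Module.finrank ℚ ℚ⟮δ⟯ = 2 → Module.finrank ℚ⟮δ⟯ N = 3 ∧
      ∀ K' : IntermediateField ℚ N, Module.finrank ℚ K' = 2 → K' = ℚ⟮δ⟯) ∧
    (ℚ⟮δ⟯ = ⊥ → Module.finrank ℚ⟮δ⟯ N = 3) := by
  have hLN : Module.finrank L N ≤ 2 := by
    rw [← IntermediateField.finrank_top', ← htop,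
      IntermediateField.adjoin.finrank (Algebra.IsIntegral.isIntegral δ)]
    have hm : (X ^ 2 - C (d : L)).Monic := by monicity!
    refine (Polynomial.natDegree_le_of_dvd (minpoly.dvd L δ ?_) hm.ne_zero).trans ?_
    · simp [hd]
    · compute_degree!
  have hpos : 0 < Module.finrank L N := Module.finrank_pos
  have hmul := Module.finrank_mul_finrank ℚ L N
  have hmul' := Module.finrank_mul_finrank ℚ ℚ⟮δ⟯ N
  rw [h3] at hmul
  refine ⟨fun h2 => ?_, fun hbot => ?_⟩
  · rw [h2] at hmul'
    refine ⟨by omega, fun K' hK' => ?_⟩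
    have hsup := IntermediateField.finrank_sup_le K' ℚ⟮δ⟯
    rw [hK', h2] at hsup
    have hmulS := Module.finrank_mul_finrank ℚ ↥(K' ⊔ ℚ⟮δ⟯) N
    have hdvd : 2 ∣ Module.finrank ℚ ↥(K' ⊔ ℚ⟮δ⟯) := by
      rw [← h2]
      exact IntermediateField.finrank_dvd_of_le_right le_sup_right
    have hposS : 0 < Module.finrank ℚ ↥(K' ⊔ ℚ⟮δ⟯) := Module.finrank_pos
    have hS : Module.finrank ℚ ↥(K' ⊔ ℚ⟮δ⟯) = 2 := by
      obtain ⟨k, hk⟩ := hdvd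
      -- Two distinct quadratic subfields would have a compositum of degree 4, but [N : ℚ] = 6.
      have hk2 : k = 1 ∨ k = 2 := by omega
      rcases hk2 with rfl | rfl
      · omega
      · rw [hk] at hmulS
        omega
    have e1 := IntermediateField.eq_of_le_of_finrank_eq (le_sup_left : K' ≤ K' ⊔ ℚ⟮δ⟯)
      (hK'.trans hS.symm)
    have e2 := IntermediateField.eq_of_le_of_finrank_eq (le_sup_right : ℚ⟮δ⟯ ≤ K' ⊔ ℚ⟮δ⟯)
      (h2.trans hS.symm)
    exact e1.trans e2.symm
  · obtain ⟨q, hq⟩ := IntermediateField.mem_bot.1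
      (hbot ▸ IntermediateField.mem_adjoin_simple_self ℚ δ)
    have hbotL : IntermediateField.adjoin L {δ} = ⊥ := by
      rw [IntermediateField.adjoin_simple_eq_bot_iff, IntermediateField.mem_bot]
      exact ⟨algebraMap ℚ L q, by rw [← hq]; simp⟩
    have h1 : Module.finrank L N = 1 := by
      rw [← IntermediateField.finrank_top', ← htop, hbotL, IntermediateField.finrank_bot]
    have h1' : Module.finrank ℚ ℚ⟮δ⟯ = 1 := by rw [hbot, IntermediateField.finrank_bot]
    rw [h1'] at hmul'
    omega

end NormalClosure

/-! ### Changes of generator and values of the norm form. -/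

section NormForm

theorem cubicNorm_mul {R : Type*} [CommRing R] (e₁ e₂ e₃ A B C t : R) :
    cubicNorm e₁ e₂ e₃ (t * A) (t * B) (t * C) = t ^ 3 * cubicNorm e₁ e₂ e₃ A B C := by
  simp only [cubicNorm]
  ring

theorem cubicNorm_scalar {R : Type*} [CommRing R] (e₁ e₂ e₃ A : R) :
    cubicNorm e₁ e₂ e₃ A 0 0 = A ^ 3 := by
  simp only [cubicNorm]
  ring

/-- Passing from a generator `t` to `t - β` does not change the values of the norm form. -/
theorem exists_cubicNorm_shift_iff {F : Type*} [CommRing F] (p q β u : F) :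
    (∃ A B C, cubicNorm 0 p q A B C = u) ↔
      ∃ A B C, cubicNorm (-3 * β) (3 * β ^ 2 + p) (q - β ^ 3 - p * β) A B C = u := by
  have key : ∀ A B C : F, cubicNorm 0 p q (A - β * B + β ^ 2 * C) (B - 2 * β * C) C
      = cubicNorm (-3 * β) (3 * β ^ 2 + p) (q - β ^ 3 - p * β) A B C := by
    intro A B C
    simp only [cubicNorm]
    ring
  constructor
  · rintro ⟨A, B, C, rfl⟩
    refine ⟨A + β * B + β ^ 2 * C, B + 2 * β * C, C, ?_⟩
    rw [← key]
    congr 1 <;> ring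
  · rintro ⟨A, B, C, rfl⟩
    exact ⟨_, _, _, key A B C⟩

/-- Passing from a generator `t` to `t ^ 2 / ϖ` keeps the values of the norm form. -/
theorem exists_cubicNorm_of_sq_div {F : Type*} [Field F] {e₁ e₂ e₃ ϖ u : F} (hϖ : ϖ ≠ 0)
    (hne : e₃ - e₁ * e₂ ≠ 0) (h : ∃ A B C, cubicNorm e₁ e₂ e₃ A B C = u) :
    ∃ A B C, cubicNorm ((e₁ ^ 2 - 2 * e₂) / ϖ) ((e₂ ^ 2 - 2 * e₁ * e₃) / ϖ ^ 2) (e₃ ^ 2 / ϖ ^ 3)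
      A B C = u := by
  -- This rewrites A + B·t²/ϖ + C·t⁴/ϖ² in the basis 1, t, t². The t-coefficient of t⁴ is e₃ − e₁e₂,
  -- so the change of basis is invertible when this is nonzero.
  have key : ∀ A B C : F, cubicNorm e₁ e₂ e₃ (A + C * (e₁ * e₃) / ϖ ^ 2)
      (C * (e₃ - e₁ * e₂) / ϖ ^ 2) (B / ϖ + C * (e₁ ^ 2 - e₂) / ϖ ^ 2)
      = cubicNorm ((e₁ ^ 2 - 2 * e₂) / ϖ) ((e₂ ^ 2 - 2 * e₁ * e₃) / ϖ ^ 2) (e₃ ^ 2 / ϖ ^ 3)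
        A B C := by
    intro A B C
    simp only [cubicNorm]
    field_simp
    ring
  obtain ⟨A, B, C, rfl⟩ := h
  refine ⟨A - B / (e₃ - e₁ * e₂) * (e₁ * e₃), ϖ * (C - B / (e₃ - e₁ * e₂) * (e₁ ^ 2 - e₂)),
    B * ϖ ^ 2 / (e₃ - e₁ * e₂), ?_⟩
  rw [← key]
  congr 1 <;> field_simp <;> ring

/-- If the defining cubic has a simple root, then every element is a value of the norm form. -/
theorem exists_cubicNorm_of_root {F : Type*} [Field F] {e₁ e₂ e₃ α : F}
    (hα : e₃ = α ^ 3 - e₁ * α ^ 2 + e₂ * α) (hder : 3 * α ^ 2 - 2 * e₁ * α + e₂ ≠ 0) (u : F) :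
    ∃ A B C, cubicNorm e₁ e₂ e₃ A B C = u := by
  -- The coordinates are those of 1 + t·g, where g is the cubic divided by X − α. As g vanishes at
  -- the other two roots and equals the derivative at α, the norm is 1 + t·g(α).
  have key : ∀ t : F, cubicNorm e₁ e₂ e₃ (1 + t * (α ^ 2 - e₁ * α + e₂)) (t * (α - e₁)) t
      = 1 + t * (3 * α ^ 2 - 2 * e₁ * α + e₂) := by
    intro t
    rw [hα]
    simp only [cubicNorm]
    ring
  refine ⟨_, _, _, (key ((u - 1) / (3 * α ^ 2 - 2 * e₁ * α + e₂))).trans ?_⟩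
  rw [div_mul_cancel₀ _ hder]
  ring

/-- Over a finite field, every element is a norm from a cubic extension. -/
theorem exists_cubicNorm_of_no_root {k : Type*} [Field k] [Finite k] {e₁ e₂ e₃ : k}
    (h : ∀ α : k, α ^ 3 - e₁ * α ^ 2 + e₂ * α - e₃ ≠ 0) (u : k) :
    ∃ A B C, cubicNorm e₁ e₂ e₃ A B C = u := by
  set f : k[X] := X ^ 3 - C e₁ * X ^ 2 + C e₂ * X - C e₃ with hf
  have hfm : f.Monic := by rw [hf]; monicity!
  have hfd : f.natDegree = 3 := by rw [hf]; compute_degree!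
  have hirr : Irreducible f := by
    rw [hfm.irreducible_iff_roots_eq_zero_of_degree_le_three (by omega) (by omega),
      Multiset.eq_zero_iff_forall_notMem]
    intro α hα
    rw [Polynomial.mem_roots hfm.ne_zero, Polynomial.IsRoot.def, hf] at hα
    simp only [Polynomial.eval_sub, Polynomial.eval_add, Polynomial.eval_mul, Polynomial.eval_pow,
      Polynomial.eval_X, Polynomial.eval_C] at hα
    exact h α hα
  have : Fact (Irreducible f) := ⟨hirr⟩
  let pb := AdjoinRoot.powerBasis hfm.ne_zero
  have hdim : pb.dim = 3 := by rw [AdjoinRoot.powerBasis_dim, hfd]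
  have : Module.Finite k (AdjoinRoot f) := pb.finite
  have : Finite (AdjoinRoot f) := Module.finite_of_finite k
  have hgen : pb.gen = AdjoinRoot.root f := AdjoinRoot.powerBasis_gen _
  have hroot : (AdjoinRoot.root f) ^ 3 = e₁ • (AdjoinRoot.root f) ^ 2 - e₂ • (AdjoinRoot.root f)
      + algebraMap k (AdjoinRoot f) e₃ := by
    have := AdjoinRoot.eval₂_root f
    simp only [hf, Polynomial.eval₂_sub, Polynomial.eval₂_add, Polynomial.eval₂_mul,
      Polynomial.eval₂_pow, Polynomial.eval₂_X, Polynomial.eval₂_C] at this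
    simp only [Algebra.smul_def, AdjoinRoot.algebraMap_eq]
    linear_combination this
  refine (exists_norm_eq_iff_exists_cubicNorm (pb.basis.reindex (finCongr hdim))
    (t := AdjoinRoot.root f) (fun i => ?_) hroot u).1 (FiniteField.norm_surjective k _ u)
  rw [Module.Basis.reindex_apply, PowerBasis.basis_eq_pow, hgen]
  simp

end NormForm

/-! ### Integrality of coordinates for Eisenstein cubics. -/

section Descent

variable {O : Type*} [CommRing O] [IsDomain O] {ϖ : O}

/-- For an Eisenstein cubic, the norm form only takes highly divisible values at divisible
arguments. -/
theorem dvd_of_pow_three_dvd_cubicNorm (hϖ : Prime ϖ) {a₁ a₂ a₃ : O} (h3 : ¬ ϖ ∣ a₃) {A B C : O}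
    (h : ϖ ^ 3 ∣ cubicNorm (ϖ * a₁) (ϖ * a₂) (ϖ * a₃) A B C) : ϖ ∣ A ∧ ϖ ∣ B ∧ ϖ ∣ C := by
  obtain ⟨n, hn⟩ := h
  simp only [cubicNorm] at hn
  -- The terms A³, ϖa₃B³ and ϖ²a₃²C³ dominate in turn: A, B, C are settled by reduction modulo ϖ,
  -- ϖ², ϖ³.
  have hA : ϖ ∣ A := by
    refine hϖ.dvd_of_dvd_pow (n := 3)
      ⟨ϖ ^ 2 * n - (A ^ 2 * B * a₁ + A ^ 2 * C * (ϖ * a₁ ^ 2 - 2 * a₂)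
      + A * B ^ 2 * a₂ + A * B * C * (ϖ * a₁ * a₂ - 3 * a₃) + A * C ^ 2 * ϖ * (a₂ ^ 2 - 2 * a₁ * a₃)
      + B ^ 3 * a₃ + B ^ 2 * C * ϖ * a₁ * a₃ + B * C ^ 2 * ϖ * a₂ * a₃ + C ^ 3 * ϖ * a₃ ^ 2), ?_⟩
    linear_combination hn
  obtain ⟨A, rfl⟩ := hA
  have hB : ϖ ∣ B := by
    have : ϖ ∣ a₃ * B ^ 3 := by
      refine ⟨ϖ * n - (ϖ * A ^ 3 + ϖ * A ^ 2 * B * a₁ + ϖ * A ^ 2 * C * (ϖ * a₁ ^ 2 - 2 * a₂)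
        + A * B ^ 2 * a₂ + A * B * C * (ϖ * a₁ * a₂ - 3 * a₃)
        + ϖ * A * C ^ 2 * (a₂ ^ 2 - 2 * a₁ * a₃) + B ^ 2 * C * a₁ * a₃ + B * C ^ 2 * a₂ * a₃
        + C ^ 3 * a₃ ^ 2), mul_left_cancel₀ hϖ.ne_zero ?_⟩
      linear_combination hn
    exact hϖ.dvd_of_dvd_pow ((hϖ.dvd_or_dvd this).resolve_left h3)
  obtain ⟨B, rfl⟩ := hB
  have hC : ϖ ∣ C := by
    have : ϖ ∣ a₃ ^ 2 * C ^ 3 := by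
      refine ⟨n - (A ^ 3 + ϖ * A ^ 2 * B * a₁ + A ^ 2 * C * (ϖ * a₁ ^ 2 - 2 * a₂)
        + ϖ * A * B ^ 2 * a₂ + A * B * C * (ϖ * a₁ * a₂ - 3 * a₃)
        + A * C ^ 2 * (a₂ ^ 2 - 2 * a₁ * a₃) + ϖ * B ^ 3 * a₃ + ϖ * B ^ 2 * C * a₁ * a₃
        + B * C ^ 2 * a₂ * a₃), mul_left_cancel₀ (pow_ne_zero 2 hϖ.ne_zero) ?_⟩
      linear_combination hn
    rcases hϖ.dvd_or_dvd this with h | h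
    · exact absurd (hϖ.dvd_of_dvd_pow h) h3
    · exact hϖ.dvd_of_dvd_pow h
  exact ⟨dvd_mul_right _ _, dvd_mul_right _ _, hC⟩

variable [IsDiscreteValuationRing O] {F : Type*} [Field F] [Algebra O F] [IsFractionRing O F]

theorem exists_pow_mul_eq_algebraMap (hϖ : Irreducible ϖ) (x : F) :
    ∃ n : ℕ, ∀ m, n ≤ m → ∃ y : O, algebraMap O F y = algebraMap O F ϖ ^ m * x := by
  obtain ⟨a, s, hs, rfl⟩ := IsFractionRing.div_surjective O x
  have hs0 : s ≠ 0 := nonZeroDivisors.ne_zero hs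
  obtain ⟨n, hn⟩ := IsDiscreteValuationRing.associated_pow_irreducible hs0 hϖ
  obtain ⟨c, hc⟩ := hn.dvd
  refine ⟨n, fun m hm => ⟨ϖ ^ (m - n) * c * a, ?_⟩⟩
  have hs' : algebraMap O F s ≠ 0 := by
    rwa [Ne, FaithfulSMul.algebraMap_eq_zero_iff]
  rw [mul_div_assoc', eq_div_iff hs', ← map_pow, ← map_mul, ← map_mul]
  congr 1
  rw [← Nat.sub_add_cancel hm, pow_add, hc, Nat.add_sub_cancel]
  ring

/-- For an Eisenstein cubic, elements of integral norm have integral coordinates. -/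
theorem exists_integral_of_cubicNorm_eq (hϖ : Irreducible ϖ) {a₁ a₂ a₃ : O} (h3 : ¬ ϖ ∣ a₃)
    {A B C : F} {n : O}
    (h : cubicNorm (algebraMap O F (ϖ * a₁)) (algebraMap O F (ϖ * a₂)) (algebraMap O F (ϖ * a₃))
      A B C = algebraMap O F n) :
    ∃ A' B' C' : O, cubicNorm (ϖ * a₁) (ϖ * a₂) (ϖ * a₃) A' B' C' = n := by
  have hinj : Function.Injective (algebraMap O F) := FaithfulSMul.algebraMap_injective O F
  -- Scaling the coordinates by ϖ^m multiplies the norm by ϖ^(3m); the divisibility lemma removes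
  -- one factor ϖ from all coordinates at a time.
  have key : ∀ m : ℕ, ∀ A' B' C' : O, cubicNorm (ϖ * a₁) (ϖ * a₂) (ϖ * a₃) A' B' C'
      = ϖ ^ (3 * m) * n → ∃ A' B' C' : O, cubicNorm (ϖ * a₁) (ϖ * a₂) (ϖ * a₃) A' B' C' = n := by
    intro m
    induction m with
    | zero =>
      intro A' B' C' h
      exact ⟨A', B', C', by simpa using h⟩
    | succ m ih =>
      intro A' B' C' h
      obtain ⟨⟨A, rfl⟩, ⟨B, rfl⟩, ⟨C, rfl⟩⟩ := dvd_of_pow_three_dvd_cubicNorm hϖ.prime h3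
        (show ϖ ^ 3 ∣ cubicNorm (ϖ * a₁) (ϖ * a₂) (ϖ * a₃) A' B' C' from
          ⟨ϖ ^ (3 * m) * n, by rw [h]; ring⟩)
      refine ih A B C (mul_left_cancel₀ (pow_ne_zero 3 hϖ.ne_zero) ?_)
      rw [← cubicNorm_mul, h]
      ring
  obtain ⟨nA, hA⟩ := exists_pow_mul_eq_algebraMap hϖ A
  obtain ⟨nB, hB⟩ := exists_pow_mul_eq_algebraMap hϖ B
  obtain ⟨nC, hC⟩ := exists_pow_mul_eq_algebraMap hϖ C
  obtain ⟨A', hA'⟩ := hA (nA + nB + nC) (by omega)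
  obtain ⟨B', hB'⟩ := hB (nA + nB + nC) (by omega)
  obtain ⟨C', hC'⟩ := hC (nA + nB + nC) (by omega)
  refine key (nA + nB + nC) A' B' C' (hinj ?_)
  rw [map_cubicNorm, hA', hB', hC', cubicNorm_mul, h, map_mul, map_pow]
  ring

end Descent

/-! ### Discrete valuation rings with finite residue field. -/

section LocalRing

open IsLocalRing

variable {O : Type*} [CommRing O] [IsDomain O] [IsDiscreteValuationRing O] {ϖ : O}

theorem residue_eq_zero_iff_dvd (hϖ : Irreducible ϖ) {x : O} : residue O x = 0 ↔ ϖ ∣ x := by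
  rw [residue_eq_zero_iff, hϖ.maximalIdeal_eq, Ideal.mem_span_singleton]

theorem isUnit_iff_not_uniformizer_dvd (hϖ : Irreducible ϖ) {x : O} : IsUnit x ↔ ¬ ϖ ∣ x := by
  rw [← residue_eq_zero_iff_dvd hϖ, ← Ne, residue_ne_zero_iff_isUnit]

/-- A polynomial map on a finite residue field that is not injective misses a value. -/
theorem exists_forall_not_dvd_eval_sub [Finite (ResidueField O)] (hϖ : Irreducible ϖ) (f : O[X])
    {x₀ x₁ : O} (hx : ¬ ϖ ∣ x₀ - x₁) (hf : ϖ ∣ f.eval x₀ - f.eval x₁) :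
    ∃ y, ∀ x, ¬ ϖ ∣ f.eval x - y := by
  have hres (x : O) : (f.map (residue O)).eval (residue O x) = residue O (f.eval x) := by
    rw [Polynomial.eval_map, Polynomial.eval₂_at_apply]
  have hinj : ¬ Function.Injective fun x : ResidueField O => (f.map (residue O)).eval x := by
    intro h
    apply hx
    rw [← residue_eq_zero_iff_dvd hϖ, map_sub, sub_eq_zero] at hf ⊢
    exact h (by simp only [hres, hf])
  rw [Finite.injective_iff_surjective] at hinj
  simp only [Function.Surjective, not_forall, not_exists] at hinj
  obtain ⟨y, hy⟩ := hinj
  obtain ⟨y, rfl⟩ := residue_surjective y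
  refine ⟨y, fun x h => hy (residue O x) ?_⟩
  rwa [← residue_eq_zero_iff_dvd hϖ, map_sub, sub_eq_zero, ← hres] at h

/-- If the residue field has a nontrivial cube root of unity, then there is a unit that is not
congruent to a cube. -/
theorem exists_unit_forall_not_dvd_cube_sub [Finite (ResidueField O)] (hϖ : Irreducible ϖ)
    (h3 : ¬ ϖ ∣ 3) {y : O} (hy : ϖ ∣ y ^ 2 - y + 1) :
    ∃ u, IsUnit u ∧ ∀ A, ¬ ϖ ∣ A ^ 3 - u := by
  -- Modulo ϖ, −y is a root of X² + X + 1, so it has the same cube as 1; it differs from 1 because 3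
  -- is not divisible by ϖ.
  obtain ⟨u, hu⟩ := exists_forall_not_dvd_eval_sub hϖ (X ^ 3) (x₀ := -y) (x₁ := 1)
    (by
      rintro ⟨c, hc⟩
      obtain ⟨d, hd⟩ := hy
      exact h3 ⟨d + c * (y - 2), by linear_combination hd + (y - 2) * hc⟩)
    (by
      obtain ⟨d, hd⟩ := hy
      simp only [Polynomial.eval_pow, Polynomial.eval_X]
      exact ⟨d * (-y - 1), by linear_combination (-y - 1) * hd⟩)
  simp only [Polynomial.eval_pow, Polynomial.eval_X] at hu
  refine ⟨u, (isUnit_iff_not_uniformizer_dvd hϖ).2 fun h => hu 0 ?_, hu⟩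
  rw [zero_pow (by norm_num), zero_sub]
  exact (dvd_neg).2 h

/-- In residue characteristic `3`, an element whose cube is `1` modulo `ϖ` is `1` modulo `ϖ`. -/
theorem exists_eq_one_add_of_dvd_cube_sub_one (hϖ : Irreducible ϖ) (h3 : ϖ ∣ 3) {A : O}
    (h : ϖ ∣ A ^ 3 - 1) : ∃ a, A = 1 + ϖ * a := by
  obtain ⟨c, hc⟩ := h3
  obtain ⟨d, hd⟩ := h
  have : ϖ ∣ (A - 1) ^ 3 := ⟨d - c * (A ^ 2 - A), by linear_combination hd - (A ^ 2 - A) * hc⟩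
  obtain ⟨a, ha⟩ := hϖ.prime.dvd_of_dvd_pow this
  exact ⟨a, by linear_combination ha⟩

/-! ### Units that are not norms. -/

section LowerBound

variable [Finite (ResidueField O)] {F : Type*} [Field F] [Algebra O F] [IsFractionRing O F]

/-- For a tamely ramified Eisenstein cubic whose residue field has a nontrivial cube root of unity,
some unit is not a norm. -/
theorem exists_unit_not_cubicNorm_of_tame (hϖ : Irreducible ϖ) (h3 : ¬ ϖ ∣ 3) {y : O}
    (hy : ϖ ∣ y ^ 2 - y + 1) {a₁ a₂ a₃ : O} (ha₃ : ¬ ϖ ∣ a₃) :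
    ∃ u : O, IsUnit u ∧ ¬ ∃ A B C : F, cubicNorm (algebraMap O F (ϖ * a₁))
      (algebraMap O F (ϖ * a₂)) (algebraMap O F (ϖ * a₃)) A B C = algebraMap O F u := by
  obtain ⟨u, hu, hcube⟩ := exists_unit_forall_not_dvd_cube_sub hϖ h3 hy
  refine ⟨u, hu, ?_⟩
  rintro ⟨A, B, C, h⟩
  obtain ⟨A, B, C, h⟩ := exists_integral_of_cubicNorm_eq hϖ ha₃ h
  simp only [cubicNorm] at h
  -- With integral coordinates the norm form is A³ modulo ϖ.
  refine hcube A ⟨-(A ^ 2 * B * a₁ + A ^ 2 * C * (ϖ * a₁ ^ 2 - 2 * a₂)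
    + A * B ^ 2 * a₂ + A * B * C * (ϖ * a₁ * a₂ - 3 * a₃) + A * C ^ 2 * ϖ * (a₂ ^ 2 - 2 * a₁ * a₃)
    + B ^ 3 * a₃ + B ^ 2 * C * ϖ * a₁ * a₃ + B * C ^ 2 * ϖ * a₂ * a₃ + C ^ 3 * ϖ * a₃ ^ 2), ?_⟩
  linear_combination h

/-- A wildly ramified Eisenstein cubic for which some unit in `1 + (ϖ)` is not a norm. -/
theorem exists_unit_not_cubicNorm_of_wild (hϖ : Irreducible ϖ) (h3 : ϖ ∣ 3) {a₁ a₂ a₃ : O}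
    (ha₃ : ¬ ϖ ∣ a₃) (ha₂ : ϖ ∣ a₂) {B₀ : O} (hB₀ : ¬ ϖ ∣ B₀)
    (hker : ϖ ∣ a₁ * B₀ + a₃ * B₀ ^ 3) :
    ∃ y : O, ¬ ∃ A B C : F, cubicNorm (algebraMap O F (ϖ * a₁))
      (algebraMap O F (ϖ * a₂)) (algebraMap O F (ϖ * a₃)) A B C
        = algebraMap O F (1 + ϖ * y) := by
  -- A norm that is 1 modulo ϖ has A = 1 + ϖa and equals 1 + ϖ(a₁B + a₃B³) modulo ϖ². The additive
  -- map B ↦ a₁B + a₃B³ of the residue field kills B₀, hence is not onto.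
  obtain ⟨y, hy⟩ := exists_forall_not_dvd_eval_sub hϖ (C a₁ * X + C a₃ * X ^ 3) (x₀ := B₀) (x₁ := 0)
    (by simpa using hB₀) (by simpa using hker)
  simp only [Polynomial.eval_add, Polynomial.eval_mul, Polynomial.eval_pow, Polynomial.eval_X,
    Polynomial.eval_C] at hy
  refine ⟨y, ?_⟩
  rintro ⟨A, B, C, h⟩
  obtain ⟨A, B, C, h⟩ := exists_integral_of_cubicNorm_eq hϖ ha₃ h
  simp only [cubicNorm] at h
  obtain ⟨a, rfl⟩ := exists_eq_one_add_of_dvd_cube_sub_one hϖ h3 (A := A)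
    ⟨y - (A ^ 2 * B * a₁ + A ^ 2 * C * (ϖ * a₁ ^ 2 - 2 * a₂)
    + A * B ^ 2 * a₂ + A * B * C * (ϖ * a₁ * a₂ - 3 * a₃) + A * C ^ 2 * ϖ * (a₂ ^ 2 - 2 * a₁ * a₃)
    + B ^ 3 * a₃ + B ^ 2 * C * ϖ * a₁ * a₃ + B * C ^ 2 * ϖ * a₂ * a₃ + C ^ 3 * ϖ * a₃ ^ 2), by
      linear_combination h⟩
  obtain ⟨t, ht⟩ := h3
  obtain ⟨a₂, rfl⟩ := ha₂
  refine hy B ⟨-(t * a + 3 * a ^ 2 + ϖ * a ^ 3 + (2 * a + ϖ * a ^ 2) * B * a₁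
    + (1 + ϖ * a) ^ 2 * C * (a₁ ^ 2 - 2 * a₂) + (1 + ϖ * a) * B ^ 2 * a₂
    + (1 + ϖ * a) * B * C * (ϖ * a₁ * a₂ - t * a₃)
    + (1 + ϖ * a) * C ^ 2 * (ϖ ^ 2 * a₂ ^ 2 - 2 * a₁ * a₃)
    + B ^ 2 * C * a₁ * a₃ + B * C ^ 2 * ϖ * a₂ * a₃ + C ^ 3 * a₃ ^ 2),
    mul_left_cancel₀ hϖ.ne_zero ?_⟩
  linear_combination h - (ϖ * a - (1 + ϖ * a) * B * C * ϖ * a₃) * ht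

/-- A wildly ramified Eisenstein cubic for which some unit in `1 + (ϖ ^ 3)` is not a norm. -/
theorem exists_unit_not_cubicNorm_of_very_wild (hϖ : Irreducible ϖ) {ε : O} (h3 : 3 = ϖ ^ 2 * ε)
    (hε : ϖ ∣ ε + 1) {a₁ a₂ a₃ : O} (ha₃ : ¬ ϖ ∣ a₃) :
    ∃ y : O, ¬ ∃ A B C : F, cubicNorm (algebraMap O F (ϖ * (ϖ ^ 2 * a₁)))
      (algebraMap O F (ϖ * (ϖ ^ 2 * a₂))) (algebraMap O F (ϖ * a₃)) A B C
        = algebraMap O F (1 + ϖ ^ 3 * y) := by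
  -- A norm that is 1 modulo ϖ³ has A = 1 + ϖa, and B and C divisible by ϖ. It is then (1 + ϖa)³ ≡ 1
  -- + ϖ³(εa + a³) modulo ϖ⁴. Since ε ≡ −1, the map a ↦ εa + a³ sends both 0 and 1 to 0.
  obtain ⟨y, hy⟩ := exists_forall_not_dvd_eval_sub hϖ (C ε * X + X ^ 3) (x₀ := 1) (x₁ := 0)
    (by simpa using hϖ.not_dvd_one) (by simpa using hε)
  simp only [Polynomial.eval_add, Polynomial.eval_mul, Polynomial.eval_pow, Polynomial.eval_X,
    Polynomial.eval_C] at hy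
  refine ⟨y, ?_⟩
  rintro ⟨A, B, C, h⟩
  obtain ⟨A, B, C, h⟩ := exists_integral_of_cubicNorm_eq hϖ ha₃ h
  have h0 := hϖ.ne_zero
  simp only [cubicNorm] at h
  obtain ⟨a, rfl⟩ := exists_eq_one_add_of_dvd_cube_sub_one hϖ ⟨ϖ * ε, by rw [h3]; ring⟩ (A := A)
    ⟨ϖ ^ 2 * y - (A ^ 2 * B * ϖ ^ 2 * a₁ + A ^ 2 * C * (ϖ ^ 5 * a₁ ^ 2 - 2 * ϖ ^ 2 * a₂)
    + A * B ^ 2 * ϖ ^ 2 * a₂ + A * B * C * (ϖ ^ 5 * a₁ * a₂ - 3 * a₃)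
    + A * C ^ 2 * ϖ * (ϖ ^ 4 * a₂ ^ 2 - 2 * ϖ ^ 2 * a₁ * a₃)
    + B ^ 3 * a₃ + B ^ 2 * C * ϖ ^ 3 * a₁ * a₃ + B * C ^ 2 * ϖ ^ 3 * a₂ * a₃
    + C ^ 3 * ϖ * a₃ ^ 2), by linear_combination h⟩
  have hB : ϖ ∣ B := by
    have : ϖ ∣ a₃ * B ^ 3 := by
      refine ⟨ϖ * y - (ϖ * ε * a + ϖ ^ 2 * ε * a ^ 2 + ϖ * a ^ 3
        + (1 + ϖ * a) ^ 2 * B * ϖ * a₁ + (1 + ϖ * a) ^ 2 * C * (ϖ ^ 4 * a₁ ^ 2 - 2 * ϖ * a₂)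
        + (1 + ϖ * a) * B ^ 2 * ϖ * a₂ + (1 + ϖ * a) * B * C * (ϖ ^ 4 * a₁ * a₂ - ϖ * ε * a₃)
        + (1 + ϖ * a) * C ^ 2 * (ϖ ^ 4 * a₂ ^ 2 - 2 * ϖ ^ 2 * a₁ * a₃)
        + B ^ 2 * C * ϖ ^ 2 * a₁ * a₃ + B * C ^ 2 * ϖ ^ 2 * a₂ * a₃ + C ^ 3 * a₃ ^ 2),
        mul_left_cancel₀ h0 ?_⟩
      linear_combination h
        - (ϖ * a + ϖ ^ 2 * a ^ 2 - (1 + ϖ * a) * B * C * ϖ * a₃) * h3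
    exact hϖ.prime.dvd_of_dvd_pow ((hϖ.prime.dvd_or_dvd this).resolve_left ha₃)
  obtain ⟨B, rfl⟩ := hB
  have hC : ϖ ∣ C := by
    have : ϖ ∣ a₃ ^ 2 * C ^ 3 := by
      refine ⟨y - (ε * a + ϖ * ε * a ^ 2 + a ^ 3
        + (1 + ϖ * a) ^ 2 * B * ϖ * a₁ + (1 + ϖ * a) ^ 2 * C * (ϖ ^ 3 * a₁ ^ 2 - 2 * a₂)
        + (1 + ϖ * a) * ϖ ^ 2 * B ^ 2 * a₂ + (1 + ϖ * a) * B * C * (ϖ ^ 4 * a₁ * a₂ - ϖ * ε * a₃)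
        + (1 + ϖ * a) * C ^ 2 * (ϖ ^ 3 * a₂ ^ 2 - 2 * ϖ * a₁ * a₃) + ϖ * B ^ 3 * a₃
        + B ^ 2 * C * ϖ ^ 3 * a₁ * a₃ + B * C ^ 2 * ϖ ^ 2 * a₂ * a₃),
        mul_left_cancel₀ (pow_ne_zero 2 h0) ?_⟩
      linear_combination h
        - (ϖ * a + ϖ ^ 2 * a ^ 2 - (1 + ϖ * a) * B * C * ϖ ^ 2 * a₃) * h3
    rcases hϖ.prime.dvd_or_dvd this with h | h
    · exact absurd (hϖ.prime.dvd_of_dvd_pow h) ha₃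
    · exact hϖ.prime.dvd_of_dvd_pow h
  obtain ⟨C, rfl⟩ := hC
  refine hy a ⟨-(ε * a ^ 2
    + (1 + ϖ * a) ^ 2 * B * a₁ + (1 + ϖ * a) ^ 2 * C * (ϖ ^ 3 * a₁ ^ 2 - 2 * a₂)
    + (1 + ϖ * a) * ϖ * B ^ 2 * a₂ + (1 + ϖ * a) * B * C * (ϖ ^ 4 * a₁ * a₂ - ϖ * ε * a₃)
    + (1 + ϖ * a) * C ^ 2 * (ϖ ^ 4 * a₂ ^ 2 - 2 * ϖ ^ 2 * a₁ * a₃) + B ^ 3 * a₃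
    + B ^ 2 * C * ϖ ^ 3 * a₁ * a₃ + B * C ^ 2 * ϖ ^ 3 * a₂ * a₃ + C ^ 3 * ϖ * a₃ ^ 2),
    mul_left_cancel₀ (pow_ne_zero 3 h0) ?_⟩
  linear_combination h
    - (ϖ * a + ϖ ^ 2 * a ^ 2 - (1 + ϖ * a) * B * C * ϖ ^ 3 * a₃) * h3

end LowerBound

/-! ### Units that are norms, by Hensel's lemma. -/

section UpperBound

theorem henselianLocalRing_exists_root [HenselianLocalRing O] (hϖ : Irreducible ϖ) {f : O[X]}
    (hf : f.Monic) {a₀ : O} (h0 : ϖ ∣ f.eval a₀) (h1 : ¬ ϖ ∣ f.derivative.eval a₀) :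
    ∃ a, f.eval a = 0 ∧ ϖ ∣ a - a₀ := by
  have hmem (x : O) : x ∈ maximalIdeal O ↔ ϖ ∣ x := by
    rw [hϖ.maximalIdeal_eq, Ideal.mem_span_singleton]
  obtain ⟨a, ha, ha'⟩ := HenselianLocalRing.is_henselian f hf a₀ ((hmem _).2 h0)
    ((isUnit_iff_not_uniformizer_dvd hϖ).2 h1)
  exact ⟨a, ha, (hmem _).1 ha'⟩

variable [HenselianLocalRing O]

/-- Away from `3`, units that are `1` modulo `ϖ` are cubes. -/
theorem exists_cube_eq_of_not_dvd_three (hϖ : Irreducible ϖ) (h3 : ¬ ϖ ∣ 3) {u : O}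
    (hu : ϖ ∣ u - 1) : ∃ x, x ^ 3 = u := by
  obtain ⟨x, hx, -⟩ := henselianLocalRing_exists_root hϖ (f := X ^ 3 - C u) (by monicity!) (a₀ := 1)
    (by simpa using (dvd_sub_comm).1 hu) (by simpa [two_add_one_eq_three] using h3)
  exact ⟨x, by simpa [sub_eq_zero] using hx⟩

/-- A cubic equation with dominant linear term is solvable. -/
theorem exists_add_sq_add_cube_eq (hϖ : Irreducible ϖ) {c₂ c₃ : O} (h2 : ϖ ∣ c₂) (h3 : ϖ ∣ c₃)
    (y : O) : ∃ x, x + c₂ * x ^ 2 + c₃ * x ^ 3 = y := by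
  obtain ⟨d₂, rfl⟩ := h2
  obtain ⟨d₃, rfl⟩ := h3
  have hnot (c : O) : ¬ ϖ ∣ 1 - ϖ * c := by
    rintro ⟨e, he⟩
    exact hϖ.not_dvd_one ⟨c + e, by linear_combination he⟩
  -- The substitution x = y/Z makes the equation monic, as Hensel's lemma requires: Z³ − Z² − c₂yZ −
  -- c₃y² = 0 has the simple root 1 modulo ϖ.
  obtain ⟨Z, hZ, e, he⟩ := henselianLocalRing_exists_root hϖ
    (f := X ^ 3 - X ^ 2 - C (ϖ * d₂ * y) * X - C (ϖ * d₃ * y ^ 2)) (by monicity!) (a₀ := 1)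
    ⟨-(d₂ * y + d₃ * y ^ 2), by simp; ring⟩
    (by
      have := hnot (d₂ * y)
      simp only [Polynomial.derivative_sub, Polynomial.derivative_X_pow,
        Polynomial.derivative_C_mul, Polynomial.derivative_X, Polynomial.derivative_C]
      simp only [Polynomial.eval_sub, Polynomial.eval_mul, Polynomial.eval_pow, Polynomial.eval_X,
        Polynomial.eval_C, Polynomial.eval_one, Polynomial.eval_zero]
      convert this using 1
      push_cast
      ring_nf)
  have hZu : IsUnit Z := by
    rw [isUnit_iff_not_uniformizer_dvd hϖ]
    rw [show Z = 1 - ϖ * -e by linear_combination he]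
    exact hnot (-e)
  obtain ⟨Z, rfl⟩ := hZu
  simp only [Polynomial.eval_sub, Polynomial.eval_mul, Polynomial.eval_pow, Polynomial.eval_X,
    Polynomial.eval_C] at hZ
  refine ⟨y * ↑Z⁻¹, ?_⟩
  have hinv : (Z : O) * ↑Z⁻¹ = 1 := Z.mul_inv
  set W : O := ↑Z⁻¹
  have e1 : (Z : O) ^ 3 * W ^ 3 = 1 := by rw [← mul_pow, hinv, one_pow]
  have e2 : (Z : O) ^ 2 * W ^ 3 = W := by linear_combination (Z * W + 1) * W * hinv
  have e3 : (Z : O) * W ^ 3 = W ^ 2 := by linear_combination W ^ 2 * hinv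
  linear_combination -y * W ^ 3 * hZ + y * e1 - y * e2 - ϖ * d₂ * y ^ 2 * e3

/-- Above `3`, elements that are `1` modulo `9` are cubes. -/
theorem exists_cube_eq_one_add_nine_mul (hϖ : Irreducible ϖ) (h3 : ϖ ∣ 3) (y : O) :
    ∃ x, x ^ 3 = 1 + 9 * y := by
  obtain ⟨x, hx⟩ := exists_add_sq_add_cube_eq hϖ h3 h3 y
  exact ⟨1 + 3 * x, by linear_combination 9 * hx⟩

/-- A cubic whose norm form represents all elements that are `1` modulo `3`. -/
theorem exists_cubicNorm_eq_one_add_three_mul (hϖ : Irreducible ϖ) (h3 : ϖ ∣ 3) {b d m : O}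
    (hd : ¬ ϖ ∣ d) (y : O) :
    ∃ C, cubicNorm (-3 * b) (3 * d) (-3 * m) 1 0 C = 1 + 3 * y := by
  have hw : IsUnit (3 * b ^ 2 - 2 * d) := by
    rw [isUnit_iff_not_uniformizer_dvd hϖ]
    rintro ⟨e, he⟩
    obtain ⟨t, ht⟩ := h3
    exact hd ⟨e - t * b ^ 2 + t * d, by linear_combination he + (d - b ^ 2) * ht⟩
  obtain ⟨w, hw⟩ := hw
  have hinv : (w : O) * ↑w⁻¹ = 1 := w.mul_inv
  -- The norm of 1 + C·t² is 1 + 3wC + 9(d² − 2bm)C² + 9m²C³; dividing by 3w leaves an equation with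
  -- dominant linear term.
  obtain ⟨x, hx⟩ := exists_add_sq_add_cube_eq hϖ (c₂ := 3 * (d ^ 2 - 2 * b * m) * ↑w⁻¹)
    (c₃ := 3 * m ^ 2 * ↑w⁻¹) ((h3.mul_right _).mul_right _) ((h3.mul_right _).mul_right _)
    (y * ↑w⁻¹)
  refine ⟨x, ?_⟩
  simp only [cubicNorm]
  linear_combination 3 * w * hx - 3 * x * hw
    + (3 * y - 9 * (d ^ 2 - 2 * b * m) * x ^ 2 - 9 * m ^ 2 * x ^ 3) * hinv

/-- Away from `3`, if the cubic has no root in the finite residue field, then every unit is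
represented by the norm form. -/
theorem exists_cubicNorm_eq_of_no_root [Finite (ResidueField O)] (hϖ : Irreducible ϖ)
    (h3 : ¬ ϖ ∣ 3) {e₁ e₂ e₃ : O} (h : ∀ α : O, ¬ ϖ ∣ α ^ 3 - e₁ * α ^ 2 + e₂ * α - e₃) {u : O}
    (hu : IsUnit u) : ∃ A B C, cubicNorm e₁ e₂ e₃ A B C = u := by
  obtain ⟨A, B, C, hABC⟩ := exists_cubicNorm_of_no_root (e₁ := residue O e₁) (e₂ := residue O e₂)
    (e₃ := residue O e₃) (fun α hα => by
      obtain ⟨α, rfl⟩ := residue_surjective α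
      refine h α ?_
      rw [← residue_eq_zero_iff_dvd hϖ, ← hα]
      simp) (residue O u)
  obtain ⟨A, rfl⟩ := residue_surjective A
  obtain ⟨B, rfl⟩ := residue_surjective B
  obtain ⟨C, rfl⟩ := residue_surjective C
  rw [← map_cubicNorm, ← sub_eq_zero, ← map_sub, residue_eq_zero_iff_dvd hϖ] at hABC
  set n := cubicNorm e₁ e₂ e₃ A B C with hn
  have hnu : IsUnit n := by
    rw [isUnit_iff_not_uniformizer_dvd hϖ]
    intro h
    exact (isUnit_iff_not_uniformizer_dvd hϖ).1 hu ((dvd_sub_right h).1 hABC)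
  obtain ⟨n', hn'⟩ := hnu
  have hinv : (n' : O) * ↑n'⁻¹ = 1 := n'.mul_inv
  -- The value n agrees with u only modulo ϖ; the quotient u/n is 1 modulo ϖ, hence a cube, and is
  -- absorbed by scaling the coordinates.
  obtain ⟨t, ht⟩ := exists_cube_eq_of_not_dvd_three hϖ h3 (u := u * ↑n'⁻¹) (by
    obtain ⟨c, hc⟩ := hABC
    exact ⟨-c * ↑n'⁻¹, by linear_combination -↑n'⁻¹ * hc + hinv - ↑n'⁻¹ * hn'⟩)
  refine ⟨t * A, t * B, t * C, ?_⟩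
  rw [cubicNorm_mul, ← hn, ht, ← hn']
  linear_combination u * hinv

/-- If the cubic has a simple root modulo `ϖ`, then every element is represented by the norm
form. -/
theorem exists_cubicNorm_eq_of_simple_root {F : Type*} [Field F] [Algebra O F] [IsFractionRing O F]
    (hϖ : Irreducible ϖ) {e₁ e₂ e₃ α : O} (h0 : ϖ ∣ α ^ 3 - e₁ * α ^ 2 + e₂ * α - e₃)
    (h1 : ¬ ϖ ∣ 3 * α ^ 2 - 2 * e₁ * α + e₂) (u : F) :
    ∃ A B C : F, cubicNorm (algebraMap O F e₁) (algebraMap O F e₂) (algebraMap O F e₃) A B C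
      = u := by
  obtain ⟨a, ha, e, he⟩ := henselianLocalRing_exists_root hϖ
    (f := X ^ 3 - C e₁ * X ^ 2 + C e₂ * X - C e₃) (by monicity!) (a₀ := α)
    (by simpa using h0)
    (by
      simp only [Polynomial.derivative_sub, Polynomial.derivative_add, Polynomial.derivative_X_pow,
        Polynomial.derivative_C_mul, Polynomial.derivative_X, Polynomial.derivative_C]
      simp only [Polynomial.eval_sub, Polynomial.eval_add, Polynomial.eval_mul,
        Polynomial.eval_pow, Polynomial.eval_X, Polynomial.eval_C, Polynomial.eval_one,
        Polynomial.eval_zero]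
      convert h1 using 1
      push_cast
      ring_nf)
  simp only [Polynomial.eval_sub, Polynomial.eval_add, Polynomial.eval_mul,
    Polynomial.eval_pow, Polynomial.eval_X, Polynomial.eval_C] at ha
  refine exists_cubicNorm_of_root (α := algebraMap O F a) ?_ ?_ u
  · have := congrArg (algebraMap O F) ha
    simp only [map_sub, map_add, map_mul, map_pow, map_zero] at this
    linear_combination -this
  · have hne : 3 * a ^ 2 - 2 * e₁ * a + e₂ ≠ 0 := by
      intro h
      refine h1 ⟨-e * (3 * (a + α) - 2 * e₁), ?_⟩
      linear_combination h - (3 * (a + α) - 2 * e₁) * he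
    have := (FaithfulSMul.algebraMap_eq_zero_iff O F).not.2 hne
    simpa [map_ofNat (algebraMap O F) 2, map_ofNat (algebraMap O F) 3] using this

end UpperBound

end LocalRing

/-! ### Completions of number fields: Hensel property and finite residue field. -/

section Completion

open HeightOneSpectrum WithZero

variable {K : Type*} [Field K] [NumberField K] (v : HeightOneSpectrum (𝓞 K))

theorem exists_adicCompletionIntegers_uniformizer :
    ∃ π : v.adicCompletionIntegers K, Valued.v (π : v.adicCompletion K) = exp (-1 : ℤ) := by
  obtain ⟨π, hπ⟩ := v.valuation_exists_uniformizer K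
  have h : Valued.v (π : v.adicCompletion K) = exp (-1 : ℤ) := by
    rw [valuedAdicCompletion_eq_valuation', hπ]
  refine ⟨⟨π, ?_⟩, h⟩
  rw [mem_adicCompletionIntegers, h, ← exp_zero, exp_le_exp]
  norm_num

variable {v}

theorem dvd_iff_valued_le {x y : v.adicCompletionIntegers K} :
    x ∣ y ↔ Valued.v (y : v.adicCompletion K) ≤ Valued.v (x : v.adicCompletion K) :=
  Valuation.Integers.dvd_iff_le (adicCompletionIntegers.integers K v)

theorem pow_dvd_iff_valued_le {π : v.adicCompletionIntegers K}
    (hπ : Valued.v (π : v.adicCompletion K) = exp (-1 : ℤ)) {x : v.adicCompletionIntegers K}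
    {n : ℕ} : π ^ n ∣ x ↔ Valued.v (x : v.adicCompletion K) ≤ exp (-(n : ℤ)) := by
  rw [dvd_iff_valued_le]
  push_cast
  rw [map_pow, hπ, ← exp_nsmul]
  simp

theorem valued_lt_one_iff {x : v.adicCompletion K} :
    Valued.v x < 1 ↔ Valued.v x ≤ exp (-1 : ℤ) := by
  by_cases h : Valued.v x = 0
  · simp [h]
  · rw [← exp_zero, ← log_lt_iff_lt_exp h, ← log_le_iff_le_exp h]
    omega

theorem irreducible_of_valued_eq {π : v.adicCompletionIntegers K}
    (hπ : Valued.v (π : v.adicCompletion K) = exp (-1 : ℤ)) : Irreducible π := by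
  rw [IsDiscreteValuationRing.irreducible_iff_uniformizer]
  ext x
  rw [IsLocalRing.mem_maximalIdeal, mem_nonunits_iff,
    adicCompletionIntegers.isUnit_iff_valued_eq_one, Ideal.mem_span_singleton, dvd_iff_valued_le,
    hπ, ← valued_lt_one_iff]
  exact (lt_iff_le_and_ne.trans (and_iff_right x.2)).symm

theorem smodEq_iff_valued_le {π : v.adicCompletionIntegers K}
    (hπ : Valued.v (π : v.adicCompletion K) = exp (-1 : ℤ)) {x y : v.adicCompletionIntegers K}
    {n : ℕ} :
    x ≡ y [SMOD (IsLocalRing.maximalIdeal (v.adicCompletionIntegers K) ^ n • ⊤ :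
      Submodule (v.adicCompletionIntegers K) (v.adicCompletionIntegers K))] ↔
    Valued.v ((x : v.adicCompletion K) - y) ≤ exp (-(n : ℤ)) := by
  rw [SModEq.sub_mem, smul_eq_mul, Ideal.mul_top, (irreducible_of_valued_eq hπ).maximalIdeal_eq,
    Ideal.span_singleton_pow, Ideal.mem_span_singleton, pow_dvd_iff_valued_le hπ]
  push_cast
  rfl

variable (v)

/-- Adic Cauchy sequences converge in the complete field K_v, and closed balls preserve the
congruences in the limit. Completeness yields the Hensel property. -/
instance isAdicComplete_adicCompletionIntegers :
    IsAdicComplete (IsLocalRing.maximalIdeal (v.adicCompletionIntegers K))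
      (v.adicCompletionIntegers K) where
  prec' := by
    intro f hf
    obtain ⟨π, hπ⟩ := exists_adicCompletionIntegers_uniformizer v
    simp only [smodEq_iff_valued_le hπ] at hf ⊢
    have hcauchy : CauchySeq fun n => (f n : v.adicCompletion K) := by
      refine Valued.cauchy_iff.2 ⟨inferInstance, fun γ => ?_⟩
      simp only [Valuation.restrict_lt_iff_lt_embedding]
      set g := MonoidWithZeroHom.ValueGroup₀.embedding γ.1
      have hg : g ≠ 0 := by simp [g]
      obtain ⟨n, hn⟩ : ∃ n : ℕ, exp (-(n : ℤ)) < g := by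
        refine ⟨(log g).natAbs + 1, ?_⟩
        rw [← lt_log_iff_exp_lt hg]
        omega
      refine ⟨(fun n => (f n : v.adicCompletion K)) '' Set.Ici n,
        Filter.image_mem_map (Filter.Ici_mem_atTop n), ?_⟩
      rintro _ ⟨i, hi, rfl⟩ _ ⟨j, hj, rfl⟩
      refine lt_of_le_of_lt ?_ hn
      have h1 := hf hi
      have h2 := hf hj
      have : ((f j : v.adicCompletion K) - f i) = (f n - f i) - (f n - f j) := by ring
      rw [this]
      exact (Valuation.map_sub _ _ _).trans (max_le h1 h2)
    obtain ⟨L, hL⟩ := cauchySeq_tendsto_of_complete hcauchy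
    have hclose (n : ℕ) : Valued.v ((f n : v.adicCompletion K) - L) ≤ exp (-(n : ℤ)) := by
      have hclosed := Valued.isClosed_closedBall (R := v.adicCompletion K)
        (Valued.v.restrict ((π : v.adicCompletion K) ^ n))
      have hmem := hclosed.mem_of_tendsto (hL.const_sub (f n : v.adicCompletion K))
        (Filter.eventually_atTop.2 ⟨n, fun m hm => by
          rw [Set.mem_ofPred_eq, Valuation.restrict_le_iff, map_pow, hπ, ← exp_nsmul]
          simpa using hf hm⟩)
      rw [Set.mem_ofPred_eq, Valuation.restrict_le_iff, map_pow, hπ, ← exp_nsmul] at hmem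
      simpa using hmem
    have hL1 : L ∈ v.adicCompletionIntegers K := by
      rw [mem_adicCompletionIntegers]
      have h0 := hclose 0
      have : L = f 0 - (f 0 - L) := by ring
      rw [this]
      exact (Valuation.map_sub _ _ _).trans (max_le (f 0).2 (by simpa using h0))
    exact ⟨⟨L, hL1⟩, hclose⟩

instance henselianLocalRing_adicCompletionIntegers :
    HenselianLocalRing (v.adicCompletionIntegers K) where
  is_henselian f hf a₀ h0 h1 :=
    HenselianRing.is_henselian (I := IsLocalRing.maximalIdeal _) f hf a₀ h0 (h1.map _)

/-- The finite ring 𝓞 K / v maps onto the residue field: K is dense in K_v, and v-integral elements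
of K are approximated by elements of 𝓞 K. -/
instance finite_residueField_adicCompletionIntegers :
    Finite (IsLocalRing.ResidueField (v.adicCompletionIntegers K)) := by
  let φ : 𝓞 K →+* IsLocalRing.ResidueField (v.adicCompletionIntegers K) :=
    (IsLocalRing.residue _).comp (algebraMap (𝓞 K) (v.adicCompletionIntegers K))
  obtain ⟨π, hπ⟩ := exists_adicCompletionIntegers_uniformizer v
  have hirr := irreducible_of_valued_eq hπ
  have hφ : ∀ x ∈ v.asIdeal, φ x = 0 := by
    intro x hx
    rw [RingHom.comp_apply, residue_eq_zero_iff_dvd hirr, dvd_iff_valued_le, hπ,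
      ← valued_lt_one_iff]
    have : Valued.v ((algebraMap (𝓞 K) (v.adicCompletionIntegers K) x : v.adicCompletion K))
        = v.valuation K (algebraMap (𝓞 K) K x) := valuedAdicCompletion_eq_valuation' v _
    rw [this]
    exact (v.valuation_lt_one_iff_mem x).2 hx
  have hsurj : Function.Surjective (Ideal.Quotient.lift v.asIdeal φ hφ) := by
    intro y
    obtain ⟨y, rfl⟩ := IsLocalRing.residue_surjective y
    have hclosed : IsOpen {z : v.adicCompletion K | Valued.v (z - y) < 1} := by
      have h := (Valued.isOpen_ball (R := v.adicCompletion K) 1).preimage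
        (continuous_id.sub (continuous_const (y := (y : v.adicCompletion K))))
      convert h using 1
      ext z
      simp only [Set.mem_ofPred_eq, Set.mem_preimage, Valuation.restrict_lt_one_iff]
      rfl
    obtain ⟨a, ha⟩ := (denseRange_algebraMap K v).exists_mem_open hclosed
      ⟨y, by simp⟩
    have ha : Valued.v ((a : v.adicCompletion K) - y) < 1 := ha
    have ha1 : v.valuation K a ≤ 1 := by
      rw [← valuedAdicCompletion_eq_valuation']
      have : (a : v.adicCompletion K) = (a - y) + y := by ring
      rw [this]
      exact (Valuation.map_add _ _ _).trans (max_le ha.le y.2)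
    obtain ⟨x, hx⟩ := v.exists_valuation_sub_lt_of_integer ha1 1
    refine ⟨Ideal.Quotient.mk _ x, ?_⟩
    rw [Ideal.Quotient.lift_mk, RingHom.comp_apply, ← sub_eq_zero, ← map_sub,
      residue_eq_zero_iff_dvd hirr, dvd_iff_valued_le, hπ, ← valued_lt_one_iff]
    have hx' : Valued.v (algebraMap K (v.adicCompletion K) (algebraMap (𝓞 K) K x - a)) < 1 := by
      have := valuedAdicCompletion_eq_valuation' v (algebraMap (𝓞 K) K x - a)
      exact this.trans_lt hx
    have hsplit : ((algebraMap (𝓞 K) (v.adicCompletionIntegers K) x - y :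
        v.adicCompletionIntegers K) : v.adicCompletion K)
        = algebraMap K (v.adicCompletion K) (algebraMap (𝓞 K) K x - a)
          + (algebraMap K (v.adicCompletion K) a - y) := by
      rw [map_sub]
      push_cast
      rw [algebraMap_adicCompletionIntegers_apply]
      change algebraMap K (v.adicCompletion K) (algebraMap (𝓞 K) K x) - _ = _
      ring
    rw [hsplit]
    exact lt_of_le_of_lt (Valuation.map_add _ _ _) (max_lt hx' ha)
  have : Finite (𝓞 K ⧸ v.asIdeal) := Ideal.finiteQuotientOfFreeOfNeBot v.asIdeal v.ne_bot
  exact Finite.of_surjective _ hsurj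

end Completion

/-! ### Conductor exponents over a local ring, case by case. -/

section LocalCases

open IsLocalRing

theorem intCast_dvd_intCast_of_dvd {O : Type*} [CommRing O] {a b : ℤ} (h : a ∣ b) :
    (a : O) ∣ b := by
  obtain ⟨c, rfl⟩ := h
  exact ⟨c, by push_cast; ring⟩

theorem not_dvd_intCast_of_isCoprime {O : Type*} [CommRing O] {ϖ : O} (hϖ : Irreducible ϖ) {a n : ℤ}
    (hn : ϖ ∣ (n : O)) (h : IsCoprime a n) : ¬ ϖ ∣ (a : O) := by
  intro ha
  obtain ⟨x, y, hxy⟩ := h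
  have : (x : O) * a + y * n = 1 := by exact_mod_cast congrArg (Int.cast (R := O)) hxy
  exact hϖ.not_dvd_one (this ▸ dvd_add (ha.mul_left _) (hn.mul_left _))

theorem not_dvd_intCast_of_not_three_dvd {O : Type*} [CommRing O] {ϖ : O} (hϖ : Irreducible ϖ)
    (h3 : ϖ ∣ 3) {n : ℤ} (hn : ¬ 3 ∣ n) : ¬ ϖ ∣ (n : O) :=
  not_dvd_intCast_of_isCoprime hϖ (n := 3) (by push_cast; exact h3)
    ((Int.prime_three.coprime_iff_not_dvd).2 hn).symm

theorem exists_cubicNorm_algebraMap {O F : Type*} [CommRing O] [Field F] [Algebra O F]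
    {e₁ e₂ e₃ u : O} (h : ∃ A B C, cubicNorm e₁ e₂ e₃ A B C = u) :
    ∃ A B C : F, cubicNorm (algebraMap O F e₁) (algebraMap O F e₂) (algebraMap O F e₃) A B C
      = algebraMap O F u := by
  obtain ⟨A, B, C, rfl⟩ := h
  exact ⟨_, _, _, (map_cubicNorm (algebraMap O F) _ _ _ _ _ _).symm⟩

theorem exists_cubicNorm_of_cube {O F : Type*} [CommRing O] [Field F] [Algebra O F]
    {e₁ e₂ e₃ u : O} (h : ∃ x, x ^ 3 = u) :
    ∃ A B C : F, cubicNorm (algebraMap O F e₁) (algebraMap O F e₂) (algebraMap O F e₃) A B C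
      = algebraMap O F u := by
  obtain ⟨x, hx⟩ := h
  exact exists_cubicNorm_algebraMap ⟨x, 0, 0, by rw [cubicNorm_scalar, hx]⟩

variable {O : Type*} [CommRing O] [IsDomain O] [IsDiscreteValuationRing O] [HenselianLocalRing O]
  [Finite (ResidueField O)] {F : Type*} [Field F] [Algebra O F] [IsFractionRing O F] {ϖ : O}

/-- At primes not dividing `3 * b`, every unit is a norm. -/
theorem exists_cubicNorm_eq_of_unramified (hϖ : Irreducible ϖ) {σ r b : ℤ} (hσ : σ ^ 2 = 1)
    (h3 : ¬ ϖ ∣ 3) (hb : ¬ ϖ ∣ (b : O)) {u : O} (hu : IsUnit u) :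
    ∃ A B C : F, cubicNorm (algebraMap O F 0) (algebraMap O F (3 * σ * r * b)) (algebraMap O F b)
      A B C = algebraMap O F u := by
  have hσO : (σ : O) ^ 2 = 1 := by exact_mod_cast congrArg (Int.cast (R := O)) hσ
  by_cases hD : ϖ ∣ 4 * σ * r ^ 3 * b + 1
  · have hr : IsUnit (r : O) := by
      rw [isUnit_iff_not_uniformizer_dvd hϖ]
      rintro ⟨c, hc⟩
      obtain ⟨d, hd⟩ := hD
      exact hϖ.not_dvd_one ⟨d - 4 * σ * r ^ 2 * b * c, by
        linear_combination hd - 4 * σ * r ^ 2 * b * hc⟩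
    obtain ⟨R, hR⟩ := hr
    have hinv : (R : O) * ↑R⁻¹ = 1 := R.mul_inv
    set W : O := ↑R⁻¹
    have e1 : (R : O) ^ 3 * W ^ 3 = 1 := by rw [← mul_pow, hinv, one_pow]
    have e2 : (R : O) ^ 2 * W ^ 2 = 1 := by rw [← mul_pow, hinv, one_pow]
    rw [← hR] at hD ⊢
    obtain ⟨c, hc⟩ := hD
    -- When ϖ ∣ ∂, the simple root modulo ϖ is −σ/r: there 4r²·P' equals 9 + 3∂, and 3 is a unit.
    refine exists_cubicNorm_eq_of_simple_root hϖ (α := -(σ * W)) ?_ ?_ _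
    · refine ⟨-σ * W ^ 3 * c, ?_⟩
      linear_combination -σ * W ^ 3 * hc + 4 * σ ^ 2 * b * e1 - 3 * σ ^ 2 * b * hinv
        - σ * W ^ 3 * hσO + b * hσO
    · rintro ⟨d, hd⟩
      have h9 : ϖ ∣ 3 * 3 := by
        refine ⟨4 * R ^ 2 * d - 3 * c, ?_⟩
        linear_combination 4 * R ^ 2 * hd - 3 * hc - 12 * R ^ 2 * W ^ 2 * hσO - 12 * e2
      rcases hϖ.prime.dvd_or_dvd h9 with h | h <;> exact h3 h
  · by_cases hroot : ∃ α : O, ϖ ∣ α ^ 3 - 0 * α ^ 2 + 3 * σ * r * b * α - b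
    · obtain ⟨α, hα⟩ := hroot
      refine exists_cubicNorm_eq_of_simple_root hϖ hα ?_ _
      rintro ⟨d, hd⟩
      obtain ⟨c, hc⟩ := hα
      have h27 : ϖ ∣ 3 * 3 * 3 * (b * b) * (4 * σ * r ^ 3 * b + 1) := by
        set p : O := 3 * σ * r * b with hp
        -- Bézout cofactors expressing 4p³ + 27b² by X³ + pX − b and its derivative; so a multiple
        -- root modulo ϖ would make ϖ divide 27b²∂.
        refine ⟨(-18 * p * α - 27 * b) * c + (6 * p * α ^ 2 + 9 * b * α + 4 * p ^ 2) * d, ?_⟩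
        have : (27 : O) * b ^ 2 * (4 * σ * r ^ 3 * b + 1) = 4 * p ^ 3 + 27 * b ^ 2 := by
          rw [hp]
          linear_combination -108 * b ^ 3 * σ * r ^ 3 * hσO
        linear_combination this + (-18 * p * α - 27 * b) * hc
          + (6 * p * α ^ 2 + 9 * b * α + 4 * p ^ 2) * hd
      rcases hϖ.prime.dvd_or_dvd h27 with h | h
      · rcases hϖ.prime.dvd_or_dvd h with h | h
        · rcases hϖ.prime.dvd_or_dvd h with h | h
          · rcases hϖ.prime.dvd_or_dvd h with h | h <;> exact h3 h
          · exact h3 h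
        · rcases hϖ.prime.dvd_or_dvd h with h | h <;> exact hb h
      · exact hD h
    · simp only [not_exists] at hroot
      exact exists_cubicNorm_algebraMap (exists_cubicNorm_eq_of_no_root hϖ h3 hroot hu)

/-- At tamely ramified primes, the units that are `1` modulo `ϖ` are norms, but not all units. -/
theorem conductor_exponent_of_tame (hϖ : Irreducible ϖ) {σ r b : ℤ} (h3 : ¬ ϖ ∣ 3) {b₁ : O}
    (hb : (b : O) = ϖ * b₁) (hb₁ : ¬ ϖ ∣ b₁) {y : O} (hy : y ^ 2 - y + 1 + 3 * σ * r ^ 3 * b = 0) :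
    (∀ u : O, ϖ ∣ u - 1 → ∃ A B C : F, cubicNorm (algebraMap O F 0)
      (algebraMap O F (3 * σ * r * b)) (algebraMap O F b) A B C = algebraMap O F u) ∧
    ∃ u : O, IsUnit u ∧ ¬ ∃ A B C : F, cubicNorm (algebraMap O F 0)
      (algebraMap O F (3 * σ * r * b)) (algebraMap O F b) A B C = algebraMap O F u := by
  refine ⟨fun u hu => exists_cubicNorm_of_cube (exists_cube_eq_of_not_dvd_three hϖ h3 hu), ?_⟩
  -- The trinomial itself is Eisenstein here, since b is a uniformizer.
  have := exists_unit_not_cubicNorm_of_tame (F := F) hϖ h3 (y := y)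
    ⟨-(3 * σ * r ^ 3 * b₁), by rw [hb] at hy; linear_combination hy⟩
    (a₁ := 0) (a₂ := 3 * σ * r * b₁) (a₃ := b₁) hb₁
  rw [mul_zero, ← hb, show ϖ * (3 * σ * r * b₁) = 3 * σ * r * (b : O) by rw [hb]; ring] at this
  exact this

/-- The conductor exponent at primes above `3` that are unramified in the quadratic field. -/
theorem conductor_exponent_of_three_unramified (hϖ : Irreducible (3 : O)) {σ r b c m D : ℤ}
    (hc : 3 * c = b ^ 2 + σ * r * b) (hm : 3 * m = b ^ 3 + 3 * σ * r * b * b - b)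
    (hm3 : ¬ 3 ∣ m) (hD3 : ¬ 3 ∣ D) (hker : 3 ∣ b + m * D) {s : O} (hs : s ^ 2 = D) :
    (∀ u : O, 3 ^ 2 ∣ u - 1 → ∃ A B C : F, cubicNorm (algebraMap O F 0)
      (algebraMap O F (3 * σ * r * b)) (algebraMap O F b) A B C = algebraMap O F u) ∧
    ∃ y : O, ¬ ∃ A B C : F, cubicNorm (algebraMap O F 0)
      (algebraMap O F (3 * σ * r * b)) (algebraMap O F b) A B C = algebraMap O F (1 + 3 * y) := by
  have hcop {n : ℤ} (hn : ¬ 3 ∣ n) := not_dvd_intCast_of_not_three_dvd hϖ dvd_rfl hn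
  have hcO : (3 : O) * c = b ^ 2 + σ * r * b := by exact_mod_cast congrArg (Int.cast (R := O)) hc
  have hmO : (3 : O) * m = b ^ 3 + 3 * σ * r * b * b - b := by
    exact_mod_cast congrArg (Int.cast (R := O)) hm
  constructor
  · rintro u ⟨y, hy⟩
    obtain ⟨x, hx⟩ := exists_cube_eq_one_add_nine_mul hϖ dvd_rfl y
    exact exists_cubicNorm_of_cube ⟨x, by rw [hx]; linear_combination -hy⟩
  -- The polynomial of t − b has invariants −3b, 9c, −3m, hence is Eisenstein at 3. The kernel
  -- element is s = √D, as −bs − ms³ = −s(b + mD).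
  · obtain ⟨y, hy⟩ := exists_unit_not_cubicNorm_of_wild (F := F) hϖ dvd_rfl (a₁ := -b)
      (a₂ := 3 * c) (a₃ := -m) (by rw [dvd_neg]; exact hcop hm3) (dvd_mul_right _ _) (B₀ := s)
      (fun h => hcop hD3 (by rw [← hs]; exact dvd_pow h two_ne_zero))
      (by
        have := (intCast_dvd_intCast_of_dvd (O := O) hker).mul_left (-s)
        push_cast at this
        convert this using 1
        rw [← hs]
        ring)
    refine ⟨y, fun h => hy ?_⟩
    rw [map_zero, exists_cubicNorm_shift_iff _ _ (algebraMap O F b)] at h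
    convert h using 8
    · simp [map_ofNat (algebraMap O F) 3]
    · have := congrArg (algebraMap O F) hcO
      simp only [map_mul, map_add, map_pow, map_ofNat (algebraMap O F) 3] at this ⊢
      linear_combination 3 * this
    · have := congrArg (algebraMap O F) hmO
      simp only [map_mul, map_add, map_pow, map_sub, map_neg,
        map_ofNat (algebraMap O F) 3] at this ⊢
      linear_combination -this

/-- The conductor exponent at primes above `3` that ramify in the quadratic field, when `b` is
prime to `3`. -/
theorem conductor_exponent_of_three_ramified (hϖ : Irreducible ϖ) (h3 : ϖ ∣ 3) {σ r b d m D : ℤ}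
    (hd : d = b ^ 2 + σ * r * b) (hm : 3 * m = b ^ 3 + 3 * σ * r * b * b - b)
    (hm3 : ¬ 3 ∣ m) (hd3 : ¬ 3 ∣ d) (hD3 : ¬ 3 ∣ D) (hker : 3 ∣ D * d - m ^ 4)
    (hs : ϖ ^ 2 = -3 * D) :
    (∀ u : O, ϖ ^ 2 ∣ u - 1 → ∃ A B C : F, cubicNorm (algebraMap O F 0)
      (algebraMap O F (3 * σ * r * b)) (algebraMap O F b) A B C = algebraMap O F u) ∧
    ∃ y : O, ¬ ∃ A B C : F, cubicNorm (algebraMap O F 0)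
      (algebraMap O F (3 * σ * r * b)) (algebraMap O F b) A B C = algebraMap O F (1 + ϖ * y) := by
  obtain ⟨Du, hDu⟩ := (isUnit_iff_not_uniformizer_dvd hϖ).2
    (not_dvd_intCast_of_not_three_dvd hϖ h3 hD3)
  have hinv : (D : O) * ↑Du⁻¹ = 1 := by rw [← hDu]; exact Du.mul_inv
  set E : O := ↑Du⁻¹
  have h3E : (3 : O) = ϖ ^ 2 * -E := by linear_combination E * hs - 3 * hinv
  have hϖF : algebraMap O F ϖ ≠ 0 := (FaithfulSMul.algebraMap_eq_zero_iff O F).not.2 hϖ.ne_zero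
  have hEu : ¬ ϖ ∣ E := (isUnit_iff_not_uniformizer_dvd hϖ).1 Du⁻¹.isUnit
  have hmO : (3 : O) * m = b ^ 3 + 3 * σ * r * b * b - b := by
    exact_mod_cast congrArg (Int.cast (R := O)) hm
  have hdO : (d : O) = b ^ 2 + σ * r * b := by exact_mod_cast congrArg (Int.cast (R := O)) hd
  have hshift (u : F) := exists_cubicNorm_shift_iff (algebraMap O F (3 * σ * r * b))
    (algebraMap O F b) (algebraMap O F b) u
  have c₁ : -3 * algebraMap O F b = algebraMap O F (-3 * b) := by
    simp [map_ofNat (algebraMap O F) 3]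
  have c₂ : 3 * (algebraMap O F b) ^ 2 + algebraMap O F (3 * σ * r * b)
      = algebraMap O F (3 * d) := by
    rw [hdO]
    simp only [map_mul, map_add, map_pow, map_ofNat (algebraMap O F) 3]
    ring
  have c₃ : algebraMap O F b - (algebraMap O F b) ^ 3 - algebraMap O F (3 * σ * r * b)
      * algebraMap O F b = algebraMap O F (-3 * m) := by
    rw [show (-3 : O) * m = b - b ^ 3 - 3 * σ * r * b * b by linear_combination -hmO]
    simp only [map_mul, map_sub, map_pow]
  simp only [c₁, c₂, c₃] at hshift
  constructor
  · rintro u ⟨y, hy⟩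
    rw [map_zero, hshift]
    obtain ⟨C, hC⟩ := exists_cubicNorm_eq_one_add_three_mul hϖ h3 (b := (b : O)) (m := (m : O))
      (not_dvd_intCast_of_not_three_dvd hϖ h3 hd3) (-D * y)
    exact exists_cubicNorm_algebraMap ⟨1, 0, C, by rw [hC]; linear_combination -hy - y * hs⟩
  -- The polynomial of t − b has invariants −3b, 3d, −3m with 3 = −ϖ²E, so t − b behaves like an
  -- element of valuation 2/3. Then (t − b)²/ϖ has valuation 1/3 and an Eisenstein polynomial, with
  -- the stated aᵢ. The kernel element m comes from Dd ≡ m⁴ mod 3.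
  · obtain ⟨y, hy⟩ := exists_unit_not_cubicNorm_of_wild (F := F) hϖ h3
      (a₁ := -E * (3 * b ^ 2 - 2 * d)) (a₂ := ϖ * (E ^ 2 * (d ^ 2 - 2 * b * m)))
      (a₃ := E ^ 2 * m ^ 2)
      (by
        intro h
        rcases hϖ.prime.dvd_or_dvd h with h | h
        · exact hEu (hϖ.prime.dvd_of_dvd_pow h)
        · exact not_dvd_intCast_of_not_three_dvd hϖ h3 hm3 (hϖ.prime.dvd_of_dvd_pow h))
      (dvd_mul_right _ _) (B₀ := m) (not_dvd_intCast_of_not_three_dvd hϖ h3 hm3)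
      (by
        obtain ⟨k, hk⟩ := hker
        have hkO : (D : O) * d - m ^ 4 = 3 * k := by exact_mod_cast congrArg (Int.cast (R := O)) hk
        refine (h3.mul_right (-E * m * (b ^ 2 - d + E * k))).trans (dvd_of_eq ?_)
        linear_combination E ^ 2 * m * hkO + E * m * d * (1 : O) * (-hinv))
    refine ⟨y, fun h => hy ?_⟩
    rw [map_zero, hshift] at h
    have hne : algebraMap O F (-3 * m) - algebraMap O F (-3 * b) * algebraMap O F (3 * d) ≠ 0 := by
      rw [← map_mul, ← map_sub, Ne, FaithfulSMul.algebraMap_eq_zero_iff O F]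
      intro h0
      have h0' : (3 : O) * ((3 * b * d - m : ℤ) : O) = 0 := by
        push_cast
        linear_combination h0
      rcases mul_eq_zero.1 h0' with h0 | h0
      · have : ϖ ^ 2 * -E = 0 := by rw [← h3E, h0]
        rcases mul_eq_zero.1 this with h | h
        · exact hϖ.ne_zero (pow_eq_zero_iff two_ne_zero |>.1 h)
        · exact hEu (by rw [neg_eq_zero.1 h]; exact dvd_zero _)
      · refine not_dvd_intCast_of_not_three_dvd hϖ h3 (n := 3 * b * d - m) ?_
          (by rw [h0]; exact dvd_zero _)
        intro h
        exact hm3 (by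
          have := dvd_sub (Dvd.intro (b * d) (by ring) : (3 : ℤ) ∣ 3 * b * d) h
          simpa using this)
    have h' := exists_cubicNorm_of_sq_div hϖF hne h
    convert h' using 8
    · rw [eq_div_iff hϖF, ← map_mul, ← map_pow, ← map_ofNat (algebraMap O F) 2, ← map_mul,
        ← map_sub]
      congr 1
      linear_combination -(3 * b ^ 2 - 2 * d) * h3E
    · rw [eq_div_iff (pow_ne_zero 2 hϖF), ← map_pow, ← map_mul, ← map_pow,
        ← map_ofNat (algebraMap O F) 2, ← map_mul, ← map_mul, ← map_sub]
      congr 1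
      linear_combination -(d ^ 2 - 2 * b * m) * (3 + ϖ ^ 2 * -E) * h3E
    · rw [eq_div_iff (pow_ne_zero 3 hϖF), ← map_pow, ← map_mul, ← map_pow]
      congr 1
      linear_combination -m ^ 2 * (3 + ϖ ^ 2 * -E) * h3E

/-- The conductor exponent at primes above `3` that ramify in the quadratic field, when `b` is
divisible by `3`. -/
theorem conductor_exponent_of_three_dvd (hϖ : Irreducible ϖ) (h3 : ϖ ∣ 3) {σ r b m D : ℤ}
    (hm : b = 3 * m) (hm3 : ¬ 3 ∣ m) (hD3 : ¬ 3 ∣ D) (hD : 3 ∣ D - 1)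
    (hs : ϖ ^ 2 = -3 * D) :
    (∀ u : O, ϖ ^ 4 ∣ u - 1 → ∃ A B C : F, cubicNorm (algebraMap O F 0)
      (algebraMap O F (3 * σ * r * b)) (algebraMap O F b) A B C = algebraMap O F u) ∧
    ∃ y : O, ¬ ∃ A B C : F, cubicNorm (algebraMap O F 0)
      (algebraMap O F (3 * σ * r * b)) (algebraMap O F b) A B C
        = algebraMap O F (1 + ϖ ^ 3 * y) := by
  obtain ⟨Du, hDu⟩ := (isUnit_iff_not_uniformizer_dvd hϖ).2
    (not_dvd_intCast_of_not_three_dvd hϖ h3 hD3)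
  have hinv : (D : O) * ↑Du⁻¹ = 1 := by rw [← hDu]; exact Du.mul_inv
  set E : O := ↑Du⁻¹
  have h3E : (3 : O) = ϖ ^ 2 * -E := by linear_combination E * hs - 3 * hinv
  have hϖF : algebraMap O F ϖ ≠ 0 := (FaithfulSMul.algebraMap_eq_zero_iff O F).not.2 hϖ.ne_zero
  have hEu : ¬ ϖ ∣ E := (isUnit_iff_not_uniformizer_dvd hϖ).1 Du⁻¹.isUnit
  have hbO : (b : O) = 3 * m := by exact_mod_cast congrArg (Int.cast (R := O)) hm
  constructor
  · rintro u ⟨y, hy⟩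
    obtain ⟨x, hx⟩ := exists_cube_eq_one_add_nine_mul hϖ h3 (D ^ 2 * y)
    exact exists_cubicNorm_of_cube ⟨x, by
      rw [hx]; linear_combination -hy - y * (ϖ ^ 2 - 3 * D) * hs⟩
  -- The invariants of t are 0, 9σrm, 3m, so t²/ϖ has an Eisenstein polynomial with the stated aᵢ; ε
  -- = −E is −1 modulo ϖ because D ≡ 1 mod 3.
  · obtain ⟨y, hy⟩ := exists_unit_not_cubicNorm_of_very_wild (F := F) hϖ h3E
      (by
        have := (h3.trans (by exact_mod_cast intCast_dvd_intCast_of_dvd (O := O) hD)).mul_left E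
        refine this.trans (dvd_of_eq ?_)
        push_cast
        linear_combination hinv)
      (a₁ := -2 * σ * r * m * E ^ 2) (a₂ := ϖ ^ 3 * (E ^ 4 * (σ * r * m) ^ 2))
      (a₃ := E ^ 2 * m ^ 2)
      (by
        intro h
        rcases hϖ.prime.dvd_or_dvd h with h | h
        · exact hEu (hϖ.prime.dvd_of_dvd_pow h)
        · exact not_dvd_intCast_of_not_three_dvd hϖ h3 hm3 (hϖ.prime.dvd_of_dvd_pow h))
    refine ⟨y, fun h => hy ?_⟩
    have hne : algebraMap O F b - algebraMap O F 0 * algebraMap O F (3 * σ * r * b) ≠ 0 := by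
      rw [map_zero, zero_mul, sub_zero, Ne, FaithfulSMul.algebraMap_eq_zero_iff O F, hbO]
      intro h0
      rcases mul_eq_zero.1 h0 with h0 | h0
      · have : ϖ ^ 2 * -E = 0 := by rw [← h3E, h0]
        rcases mul_eq_zero.1 this with h | h
        · exact hϖ.ne_zero (pow_eq_zero_iff two_ne_zero |>.1 h)
        · exact hEu (by rw [neg_eq_zero.1 h]; exact dvd_zero _)
      · exact not_dvd_intCast_of_not_three_dvd hϖ h3 hm3 (by rw [h0]; exact dvd_zero _)
    have h' := exists_cubicNorm_of_sq_div hϖF hne h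
    convert h' using 8
    · rw [eq_div_iff hϖF, ← map_mul, ← map_pow, ← map_ofNat (algebraMap O F) 2, ← map_mul,
        ← map_sub]
      congr 1
      rw [hbO]
      linear_combination 2 * σ * r * m * (3 + ϖ ^ 2 * -E) * h3E
    · rw [eq_div_iff (pow_ne_zero 2 hϖF), ← map_pow, ← map_mul, ← map_pow,
        ← map_ofNat (algebraMap O F) 2, ← map_mul, ← map_mul, ← map_sub]
      congr 1
      rw [hbO]
      linear_combination -(σ * r * m) ^ 2 * (3 + ϖ ^ 2 * -E) * (3 ^ 2 + (ϖ ^ 2 * -E) ^ 2) * h3E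
    · rw [eq_div_iff (pow_ne_zero 3 hϖF), ← map_pow, ← map_mul, ← map_pow]
      congr 1
      rw [hbO]
      linear_combination -m ^ 2 * (3 + ϖ ^ 2 * -E) * h3E

end LocalCases

/-! ### Valuations of rational primes and of √(−3∂) in K. -/

section PrimeValuations

open HeightOneSpectrum WithZero

variable {K : Type*} [Field K] [NumberField K] {v : HeightOneSpectrum (𝓞 K)}

theorem intValuation_eq_exp_iff {x : 𝓞 K} {n : ℕ} :
    v.intValuation x = exp (-(n : ℤ)) ↔ x ∈ v.asIdeal ^ n ∧ x ∉ v.asIdeal ^ (n + 1) := by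
  rw [← intValuation_le_pow_iff_mem, ← intValuation_le_pow_iff_mem]
  by_cases h : v.intValuation x = 0
  · simpa [h] using exp_ne_zero.symm
  · rw [← log_le_iff_le_exp h, ← log_le_iff_le_exp h]
    constructor
    · intro hx
      rw [hx, log_exp]
      push_cast
      omega
    · intro hx
      rw [← exp_log h]
      congr 1
      push_cast at hx
      omega

theorem valued_algebraMap_eq (x : 𝓞 K) :
    Valued.v (algebraMap (𝓞 K) (v.adicCompletionIntegers K) x : v.adicCompletion K)
      = v.intValuation x := by
  change Valued.v ((algebraMap (𝓞 K) K x : K) : v.adicCompletion K) = _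
  rw [valuedAdicCompletion_eq_valuation', valuation_of_algebraMap]

theorem intCast_notMem_of_isCoprime {a n : ℤ} (hn : (n : 𝓞 K) ∈ v.asIdeal) (h : IsCoprime a n) :
    (a : 𝓞 K) ∉ v.asIdeal := by
  intro ha
  obtain ⟨x, y, hxy⟩ := h
  have h1 : (x : 𝓞 K) * a + y * n = 1 := by exact_mod_cast congrArg (Int.cast (R := 𝓞 K)) hxy
  exact v.isPrime.ne_top ((Ideal.eq_top_iff_one _).2
    (h1 ▸ add_mem (Ideal.mul_mem_left _ _ ha) (Ideal.mul_mem_left _ _ hn)))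

/-- A rational prime not dividing the discriminant is unramified. -/
theorem intValuation_prime_eq {p : ℕ} (hp : p.Prime) (hpv : (p : 𝓞 K) ∈ v.asIdeal)
    (hd : ¬ (p : ℤ) ∣ discr K) : v.intValuation (p : 𝓞 K) = exp (-1 : ℤ) := by
  refine intValuation_eq_exp_iff (n := 1).2 ⟨by simpa using hpv, fun h2 => ?_⟩
  have hspan : Ideal.span {(p : ℤ)} ≠ ⊥ := by
    simpa using hp.ne_zero
  -- If v² divides p, then v divides the different, which contains the discriminant.
  have : v.asIdeal ^ (2 - 1) ∣ differentIdeal ℤ (𝓞 K) := by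
    have : v.asIdeal ^ 2 ∣ Ideal.map (algebraMap ℤ (𝓞 K)) (Ideal.span {(p : ℤ)}) := by
      rw [Ideal.map_span, Set.image_singleton, Ideal.dvd_span_singleton]
      simpa using h2
    have hmax : (Ideal.span {(p : ℤ)}).IsMaximal :=
      PrincipalIdealRing.isMaximal_of_irreducible (Nat.prime_iff_prime_int.1 hp).irreducible
    exact pow_sub_one_dvd_differentIdeal ℤ v.asIdeal 2 hspan this
  have hmem : ((discr K : ℤ) : 𝓞 K) ∈ v.asIdeal :=
    Ideal.dvd_iff_le.1 (by simpa using this) (discr_mem_differentIdeal K (𝓞 K))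
  exact intCast_notMem_of_isCoprime (n := (p : ℤ)) (by simpa using hpv)
    ((Nat.prime_iff_prime_int.1 hp).coprime_iff_not_dvd.2 hd).symm hmem

/-- In a quadratic field containing a square root of `-3 * D` with `D` prime to `3`, the prime `3`
is ramified and this square root is a uniformizer. -/
theorem intValuation_sqrt_eq (h2 : Module.finrank ℚ K = 2) (h3 : (3 : 𝓞 K) ∈ v.asIdeal) {D : ℤ}
    (hD : ¬ 3 ∣ D) {s : 𝓞 K} (hs : s ^ 2 = -3 * (D : 𝓞 K)) :
    v.intValuation s = exp (-1 : ℤ) ∧ v.intValuation 3 = exp (-2 : ℤ) := by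
  have hDv : v.intValuation (D : 𝓞 K) = 1 := by
    have := intCast_notMem_of_isCoprime (v := v) (a := D) (n := 3) (by simpa using h3)
      ((Int.prime_three.coprime_iff_not_dvd).2 hD).symm
    exact intValuation_eq_one_iff_mem_primeCompl v _ |>.2 this
  have hval : v.intValuation s ^ 2 = v.intValuation 3 := by
    rw [← map_pow, hs, map_mul, hDv, mul_one, Valuation.map_neg]
  have hs1 : v.intValuation s = exp (-1 : ℤ) := by
    refine intValuation_eq_exp_iff (n := 1).2 ⟨?_, fun h => ?_⟩
    · rw [pow_one]
      refine v.isPrime.mem_of_pow_mem 2 ?_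
      rw [hs]
      exact Ideal.mul_mem_right _ _ (neg_mem h3)
    -- If s ∈ v², then v⁴ divides 3, so N(v)⁴ divides N(3) = 9, which is impossible as N(v) ≥ 2.
    · rw [← intValuation_le_pow_iff_mem] at h
      have h4 : v.intValuation (3 : 𝓞 K) ≤ exp (-((4 : ℕ) : ℤ)) := by
        rw [← hval]
        refine (pow_le_pow_left₀ zero_le h 2).trans_eq ?_
        rw [← exp_nsmul]
        norm_num
      rw [intValuation_le_pow_iff_dvd] at h4
      have h5 := map_dvd Ideal.absNorm h4
      rw [map_pow, Ideal.absNorm_span_singleton] at h5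
      have h6 : (Algebra.norm ℤ (3 : 𝓞 K)).natAbs = 9 := by
        have : Algebra.norm ℤ (algebraMap ℤ (𝓞 K) 3) = 3 ^ 2 := by
          rw [Algebra.norm_algebraMap, RingOfIntegers.rank, h2]
        rw [map_ofNat] at this
        rw [this]; norm_num
      rw [h6] at h5
      have h7 := Nat.le_of_dvd (by norm_num) h5
      have h8 : Ideal.absNorm v.asIdeal ≠ 1 := by
        rw [Ne, Ideal.absNorm_eq_one_iff]; exact v.isPrime.ne_top
      have h9 : Ideal.absNorm v.asIdeal ≠ 0 := by
        rw [Ne, Ideal.absNorm_eq_zero_iff]; exact v.ne_bot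
      have : 2 ≤ Ideal.absNorm v.asIdeal := by omega
      have := Nat.pow_le_pow_left this 4
      omega
  refine ⟨hs1, ?_⟩
  rw [← hval, hs1, ← exp_nsmul]
  norm_num

/-- The exponent of a prime in a principal ideal is the least `n` with a given property of the
units of level `n`, if this property holds from that level on and fails one level below. -/
theorem emultiplicity_le_iff_forall_mem_unitFiltration {π : v.adicCompletionIntegers K}
    (hπ : Valued.v (π : v.adicCompletion K) = exp (-1 : ℤ)) {P : v.adicCompletion K → Prop}
    {f : 𝓞 K} {e : ℕ} (hf : v.intValuation f = exp (-(e : ℤ)))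
    (hub : ∀ u : v.adicCompletionIntegers K, IsUnit u → π ^ e ∣ u - 1 → P u)
    (hlb : e ≠ 0 → ∃ u : v.adicCompletionIntegers K, IsUnit u ∧ π ^ (e - 1) ∣ u - 1 ∧ ¬ P u)
    (n : ℕ) : emultiplicity v.asIdeal (Ideal.span {f}) ≤ n ↔ ∀ u ∈ unitFiltration K v n, P u := by
  rw [← exp_le_intValuation_iff_emultiplicity_le, hf, exp_le_exp, neg_le_neg_iff, Nat.cast_le]
  have key : ∀ (u : v.adicCompletionIntegers K) (k : ℕ), IsUnit u ∧ π ^ k ∣ u - 1 ↔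
      (u : v.adicCompletion K) ∈ unitFiltration K v k := by
    intro u k
    rw [unitFiltration, Set.mem_ofPred_eq, adicCompletionIntegers.isUnit_iff_valued_eq_one,
      pow_dvd_iff_valued_le hπ]
    push_cast
    rfl
  constructor
  · intro hen u hu
    have hu1 : Valued.v u ≤ 1 := by
      rw [unitFiltration, Set.mem_ofPred_eq] at hu
      exact hu.1.le
    have := (key ⟨u, hu1⟩ n).2 hu
    exact hub ⟨u, hu1⟩ this.1 ((pow_dvd_pow _ hen).trans this.2)
  · intro h
    by_contra! hlt
    obtain ⟨u, hu, hd, hP⟩ := hlb (by omega)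
    exact hP (h u ((key u n).1 ⟨hu, (pow_dvd_pow _ (by omega)).trans hd⟩))

end PrimeValuations

/-! ### Congruences modulo 3 and 9. -/

section Congruences

theorem intCast_zmod_three_ne_zero {n : ℤ} : (n : ZMod 3) ≠ 0 ↔ ¬ 3 ∣ n :=
  (ZMod.intCast_zmod_eq_zero_iff_dvd n 3).not

theorem three_dvd_cube_sub (b : ℤ) : 3 ∣ b ^ 3 - b := by
  rw [← Nat.cast_ofNat, ← ZMod.intCast_zmod_eq_zero_iff_dvd]
  push_cast
  generalize (b : ZMod 3) = b
  revert b
  decide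

theorem three_dvd_dualDisc_iff {σ r b : ℤ} : 3 ∣ 4 * σ * r ^ 3 * b + 1 ↔ 3 ∣ σ * r * b + 1 := by
  have h : 3 ∣ (4 * σ * r ^ 3 * b + 1) - (σ * r * b + 1) := by
    rw [← Nat.cast_ofNat, ← ZMod.intCast_zmod_eq_zero_iff_dvd]
    push_cast
    generalize (σ : ZMod 3) = σ, (r : ZMod 3) = r, (b : ZMod 3) = b
    revert σ r b
    decide
  exact (dvd_iff_dvd_of_dvd_sub h)

/-- Arithmetic input for an unramified 3. The condition 9 ∤ P(b) says that m is prime to 3, so that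
its square is 1 modulo 3. -/
theorem congruences_of_three_dvd_add_one {σ r b : ℤ} (hσ : σ ^ 2 = 1) (hb : ¬ 3 ∣ b)
    (h : 3 ∣ σ * r * b + 1) (h9 : ¬ 9 ∣ b ^ 3 + σ * 3 * r * b * b - b) :
    ∃ c m D, 3 * c = b ^ 2 + σ * r * b ∧ 3 * m = b ^ 3 + 3 * σ * r * b * b - b ∧
      3 * D = -(4 * σ * r ^ 3 * b + 1) ∧ ¬ 3 ∣ m ∧ 3 ∣ b + m * D := by
  obtain ⟨j, hj⟩ := h
  have hb2 : 3 ∣ b ^ 2 - 1 := by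
    rw [← Nat.cast_ofNat, ← ZMod.intCast_zmod_eq_zero_iff_dvd]
    have := intCast_zmod_three_ne_zero.2 hb
    push_cast
    generalize (b : ZMod 3) = b at *
    revert b
    decide
  obtain ⟨k, hk⟩ := hb2
  obtain ⟨D, hD⟩ := three_dvd_dualDisc_iff.2 ⟨j, hj⟩
  have hm3 : ¬ 3 ∣ b * (k - 1 + 3 * j) := by
    rintro ⟨l, hl⟩
    exact h9 ⟨l, by linear_combination b * hk + 3 * b * hj + 3 * hl⟩
  refine ⟨k + j, b * (k - 1 + 3 * j), -D, by linear_combination -hk - hj,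
    by linear_combination -b * hk - 3 * b * hj, by linear_combination hD, hm3, ?_⟩
  -- Here D = ∂/3. Working modulo 9 with σr³b·b² = (σrb)³ = (3j−1)³ ≡ −1 gives D ≡ k − 1 mod 3; also
  -- m ≡ b(k − 1), so b − mD ≡ b(1 − (k−1)²) ≡ 0.
  have hw : 3 ∣ D + 1 - k := by
    refine ⟨4 * (3 * j ^ 3 - 3 * j ^ 2 + j) - D * k, ?_⟩
    have hcube : σ * r ^ 3 * b * b ^ 2 = (3 * j - 1) ^ 3 := by
      rw [show 3 * j - 1 = σ * r * b by linear_combination -hj]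
      linear_combination (-σ * r ^ 3 * b ^ 3) * hσ
    have : 3 * (D + 1 - k) = 3 * (3 * (4 * (3 * j ^ 3 - 3 * j ^ 2 + j) - D * k)) := by
      linear_combination (1 - 3 * D) * hk - b ^ 2 * hD + 4 * hcube
    omega
  have hk1 : 3 ∣ (k - 1) ^ 2 - 1 := by
    have h1 : ¬ 3 ∣ k - 1 := fun h => hm3 (((dvd_add_right h).2 (dvd_mul_right 3 j)).mul_left _)
    rw [← Nat.cast_ofNat, ← ZMod.intCast_zmod_eq_zero_iff_dvd]
    have := intCast_zmod_three_ne_zero.2 h1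
    push_cast at this ⊢
    generalize (k : ZMod 3) = b at *
    revert b
    decide
  obtain ⟨x, hx⟩ := hw
  obtain ⟨y, hy⟩ := hk1
  refine ⟨-b * y - b * (k - 1) * x - b * j * D, ?_⟩
  linear_combination -b * hy - b * (k - 1) * hx

/-- Modulo 3 both ∂ and d are 1 + σrb, a unit, so ∂d ≡ 1; and m⁴ ≡ 1 because 9 ∤ P(b). -/
theorem congruences_of_not_three_dvd_add_one {σ r b : ℤ} (hσ : σ ^ 2 = 1) (hb : ¬ 3 ∣ b)
    (h : ¬ 3 ∣ σ * r * b + 1) (h9 : ¬ 9 ∣ b ^ 3 + σ * 3 * r * b * b - b) :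
    ∃ d m, d = b ^ 2 + σ * r * b ∧ 3 * m = b ^ 3 + 3 * σ * r * b * b - b ∧ ¬ 3 ∣ m ∧ ¬ 3 ∣ d ∧
      3 ∣ (4 * σ * r ^ 3 * b + 1) * d - m ^ 4 := by
  obtain ⟨k, hk⟩ := three_dvd_cube_sub b
  have hm3 : ¬ 3 ∣ k + σ * r * b * b := by
    rintro ⟨l, hl⟩
    exact h9 ⟨l, by linear_combination hk + 3 * hl⟩
  refine ⟨_, k + σ * r * b * b, rfl, by linear_combination -hk, hm3, ?_, ?_⟩
  · rw [← intCast_zmod_three_ne_zero] at *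
    push_cast at *
    generalize (σ : ZMod 3) = σ, (r : ZMod 3) = r, (b : ZMod 3) = b at *
    clear * - hb h
    revert σ r b
    decide
  · generalize k + σ * r * b * b = m at *
    rw [← intCast_zmod_three_ne_zero] at *
    rw [← Nat.cast_ofNat, ← ZMod.intCast_zmod_eq_zero_iff_dvd]
    have hσ' : (σ : ZMod 3) ^ 2 = 1 := by exact_mod_cast congrArg (Int.cast (R := ZMod 3)) hσ
    push_cast at *
    generalize (σ : ZMod 3) = σ, (r : ZMod 3) = r, (b : ZMod 3) = b, (m : ZMod 3) = m at *
    clear * - hb h hm3 hσ'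
    revert σ r b m
    decide

end Congruences

/-! ### Conductor exponents at the primes of K. -/

section ConductorOfTrinomial

open HeightOneSpectrum WithZero

variable {K : Type*} [Field K] [NumberField K] {N : Type*} [Field N] [NumberField N] [Algebra K N]

/-- The local norms of the cubic extension generated by a root of
`X ^ 3 + 3 * σ * r * b * X - b`. -/
theorem isLocalNorm_coe_iff (h3 : Module.finrank K N = 3) {t : N} (htop : K⟮t⟯ = ⊤) {σ r b : ℤ}
    (ht : t ^ 3 + ((σ * 3 * r * b : ℤ) : N) * t - (b : N) = 0) (v : HeightOneSpectrum (𝓞 K))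
    (u : v.adicCompletionIntegers K) :
    IsLocalNorm K N v u ↔ ∃ A B C : v.adicCompletion K,
      cubicNorm (algebraMap (v.adicCompletionIntegers K) _ 0)
        (algebraMap (v.adicCompletionIntegers K) _ (3 * σ * r * b))
        (algebraMap (v.adicCompletionIntegers K) _ b) A B C
        = algebraMap (v.adicCompletionIntegers K) (v.adicCompletion K) u := by
  rw [isLocalNorm_iff_exists_cubicNorm h3 htop (e₁ := 0) (e₂ := ((3 * σ * r * b : ℤ) : K))
    (e₃ := (b : K)) _ v u]
  · have : algebraMap (v.adicCompletionIntegers K) (v.adicCompletion K) (3 * σ * r * b)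
        = ((3 * σ * r * b : ℤ) : v.adicCompletion K) := by
      rw [← map_intCast (algebraMap (v.adicCompletionIntegers K) (v.adicCompletion K))]
      push_cast
      rfl
    rw [this, map_intCast, map_intCast, map_intCast, map_zero, map_zero]
    rfl
  · rw [map_intCast, zero_smul, Algebra.smul_def, map_intCast]
    push_cast at ht ⊢
    linear_combination ht

/-- The conductor exponents at the primes not dividing `3`. -/
theorem emultiplicity_le_iff_of_three_notMem (h3 : Module.finrank K N = 3) {t : N}
    (htop : K⟮t⟯ = ⊤) {σ r : ℤ} {b k : ℕ} (hσ : σ ^ 2 = 1)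
    (ht : t ^ 3 + ((σ * 3 * r * b : ℤ) : N) * t - ((b : ℤ) : N) = 0) (hb : Squarefree b)
    (hdisc : ∀ p : ℕ, p.Prime → p ∣ b → p ≠ 3 → ¬ (p : ℤ) ∣ discr K) {y : 𝓞 K}
    (hy : y ^ 2 - y + 1 + ((3 * σ * r ^ 3 * b : ℤ) : 𝓞 K) = 0) {v : HeightOneSpectrum (𝓞 K)}
    (hv : (3 : 𝓞 K) ∉ v.asIdeal) (n : ℕ) :
    emultiplicity v.asIdeal (Ideal.span {((3 ^ k * b : ℕ) : 𝓞 K)}) ≤ n ↔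
      ∀ u ∈ unitFiltration K v n, IsLocalNorm K N v u := by
  obtain ⟨π, hπ⟩ := exists_adicCompletionIntegers_uniformizer v
  have hirr := irreducible_of_valued_eq hπ
  have hdvd : ∀ x : 𝓞 K, π ∣ algebraMap (𝓞 K) (v.adicCompletionIntegers K) x ↔ x ∈ v.asIdeal := by
    intro x
    rw [← pow_one π, pow_dvd_iff_valued_le hπ, valued_algebraMap_eq, intValuation_le_pow_iff_mem,
      pow_one]
  have h3' : ¬ π ∣ 3 := by
    rw [← map_ofNat (algebraMap (𝓞 K) (v.adicCompletionIntegers K)) 3, hdvd]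
    exact hv
  have hval : v.intValuation ((3 ^ k * b : ℕ) : 𝓞 K) = v.intValuation (b : 𝓞 K) := by
    push_cast
    rw [map_mul, map_pow, (intValuation_eq_one_iff_mem_primeCompl v _).2 hv, one_pow, one_mul]
  by_cases hbv : (b : 𝓞 K) ∈ v.asIdeal
  · have hbval : v.intValuation (b : 𝓞 K) = exp (-1 : ℤ) := by
      have hbv' := hbv
      rw [← Nat.prod_primeFactors_of_squarefree hb, Nat.cast_prod,
        v.isPrime.prod_mem_iff] at hbv'
      obtain ⟨p, hp, hpv⟩ := hbv'
      have hpp := Nat.prime_of_mem_primeFactors hp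
      have hpb := Nat.dvd_of_mem_primeFactors hp
      obtain ⟨b', rfl⟩ := hpb
      have hp3 : p ≠ 3 := by
        rintro rfl
        exact hv (by simpa using hpv)
      have hb' : ¬ p ∣ b' := fun hd =>
        hpp.not_isUnit (hb p (mul_dvd_mul_left p hd))
      have hb'v : (b' : 𝓞 K) ∉ v.asIdeal := by
        have := intCast_notMem_of_isCoprime (v := v) (a := b') (n := p) (by simpa using hpv)
          (Nat.isCoprime_iff_coprime.2 (hpp.coprime_iff_not_dvd.2 hb').symm)
        simpa using this
      rw [Nat.cast_mul, map_mul, (intValuation_eq_one_iff_mem_primeCompl v _).2 hb'v, mul_one]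
      exact intValuation_prime_eq hpp hpv (hdisc p hpp (dvd_mul_right _ _) hp3)
    have hbO : Valued.v (((b : ℤ) : v.adicCompletionIntegers K) : v.adicCompletion K)
        = exp (-1 : ℤ) := by
      rw [← hbval, ← valued_algebraMap_eq]
      simp
    obtain ⟨b₁, hb₁⟩ : π ∣ ((b : ℤ) : v.adicCompletionIntegers K) := by
      rw [dvd_iff_valued_le, hbO, hπ]
    have hb₁' : ¬ π ∣ b₁ := by
      intro hd
      have : π ^ 2 ∣ ((b : ℤ) : v.adicCompletionIntegers K) := by
        rw [hb₁, pow_two]; exact mul_dvd_mul_left _ hd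
      rw [pow_dvd_iff_valued_le hπ, hbO, exp_le_exp] at this
      norm_num at this
    obtain ⟨hub, u, hu, hlb⟩ := conductor_exponent_of_tame (F := v.adicCompletion K) hirr h3' hb₁
      hb₁' (σ := σ) (r := r) (y := algebraMap (𝓞 K) _ y) (by
        have := congrArg (algebraMap (𝓞 K) (v.adicCompletionIntegers K)) hy
        simp only [map_add, map_sub, map_pow, map_one, map_intCast, map_zero] at this
        rw [← this]
        push_cast
        ring)
    refine emultiplicity_le_iff_forall_mem_unitFiltration hπ (e := 1) (hval.trans hbval) ?_ ?_ n
    · intro u _ hd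
      rw [isLocalNorm_coe_iff h3 htop ht]
      exact hub u (by simpa using hd)
    · intro _
      refine ⟨u, hu, by simp, ?_⟩
      rw [isLocalNorm_coe_iff h3 htop ht]
      exact hlb
  · have hbO : ¬ π ∣ ((b : ℤ) : v.adicCompletionIntegers K) := by
      rw [← map_intCast (algebraMap (𝓞 K) (v.adicCompletionIntegers K)), hdvd]
      simpa using hbv
    refine emultiplicity_le_iff_forall_mem_unitFiltration hπ (e := 0) (hval.trans ?_) ?_
      (fun h => absurd rfl h) n
    · rw [(intValuation_eq_one_iff_mem_primeCompl v _).2 hbv]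
      simp
    · intro u hu _
      rw [isLocalNorm_coe_iff h3 htop ht]
      exact exists_cubicNorm_eq_of_unramified hirr hσ h3' hbO hu

theorem isUnit_one_add_mul {O : Type*} [CommRing O] [IsLocalRing O] {ϖ : O} (hϖ : ¬ IsUnit ϖ)
    (y : O) : IsUnit (1 + ϖ * y) := by
  by_contra h
  have h1 : ¬ IsUnit (-(ϖ * y)) := fun h => hϖ (isUnit_of_mul_isUnit_left ((IsUnit.neg_iff _).1 h))
  exact IsLocalRing.nonunits_add h h1 (by simp)

theorem intValuation_natCast_eq_one {v : HeightOneSpectrum (𝓞 K)} (hv : (3 : 𝓞 K) ∈ v.asIdeal)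
    {b : ℕ} (hb : ¬ 3 ∣ b) : v.intValuation (b : 𝓞 K) = 1 := by
  have := intCast_notMem_of_isCoprime (v := v) (a := b) (n := 3) (by simpa using hv)
    ((Int.prime_three.coprime_iff_not_dvd).2 (by omega)).symm
  exact (intValuation_eq_one_iff_mem_primeCompl v _).2 (by simpa using this)

/-- The uniformizer is 3 itself, so 9b has valuation 2. -/
theorem emultiplicity_le_iff_of_three_unramified (h3 : Module.finrank K N = 3) {t : N}
    (htop : K⟮t⟯ = ⊤) {σ r : ℤ} {b : ℕ} (hσ : σ ^ 2 = 1)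
    (ht : t ^ 3 + ((σ * 3 * r * b : ℤ) : N) * t - ((b : ℤ) : N) = 0) (hb : ¬ 3 ∣ b)
    (h1 : 3 ∣ σ * r * b + 1) (h9 : ¬ 9 ∣ (b : ℤ) ^ 3 + σ * 3 * r * b * b - b) {D : ℤ}
    (hD : 3 * D = -(4 * σ * r ^ 3 * b + 1)) (hD3 : ¬ 3 ∣ D) {s : 𝓞 K} (hs : s ^ 2 = (D : 𝓞 K))
    (hdisc : ¬ 3 ∣ discr K) {v : HeightOneSpectrum (𝓞 K)}
    (hv : (3 : 𝓞 K) ∈ v.asIdeal) (n : ℕ) :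
    emultiplicity v.asIdeal (Ideal.span {((3 ^ 2 * b : ℕ) : 𝓞 K)}) ≤ n ↔
      ∀ u ∈ unitFiltration K v n, IsLocalNorm K N v u := by
  have h3v : v.intValuation (3 : 𝓞 K) = exp (-1 : ℤ) := by
    have := intValuation_prime_eq (K := K) (v := v) Nat.prime_three (by simpa using hv)
      (by simpa using hdisc)
    simpa using this
  have hπ : Valued.v ((3 : v.adicCompletionIntegers K) : v.adicCompletion K) = exp (-1 : ℤ) := by
    rw [← h3v, ← valued_algebraMap_eq]
    rw [map_ofNat]
  have hirr := irreducible_of_valued_eq hπ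
  obtain ⟨c, m, D', hc, hm, hD', hm3, hker⟩ := congruences_of_three_dvd_add_one (b := b) hσ
    (by omega) h1 h9
  obtain rfl : D' = D := by omega
  obtain ⟨hub, y, hlb⟩ := conductor_exponent_of_three_unramified (F := v.adicCompletion K) hirr hc
    hm hm3 hD3 hker (s := algebraMap (𝓞 K) _ s) (by rw [← map_pow, hs, map_intCast])
  refine emultiplicity_le_iff_forall_mem_unitFiltration hπ (e := 2) ?_ ?_ ?_ n
  · rw [Nat.cast_mul, Nat.cast_pow, Nat.cast_ofNat, map_mul, map_pow, h3v,
      intValuation_natCast_eq_one hv hb, mul_one, ← exp_nsmul]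
    norm_num
  · intro u _ hd
    rw [isLocalNorm_coe_iff h3 htop ht]
    exact hub u hd
  · intro _
    refine ⟨1 + 3 * y, isUnit_one_add_mul hirr.not_isUnit y, by simp, ?_⟩
    rw [isLocalNorm_coe_iff h3 htop ht]
    exact hlb

/-- The uniformizer is √(−3∂) and 3 has valuation 2, so 3b has valuation 2. -/
theorem emultiplicity_le_iff_of_three_ramified (h2 : Module.finrank ℚ K = 2)
    (h3 : Module.finrank K N = 3) {t : N}
    (htop : K⟮t⟯ = ⊤) {σ r : ℤ} {b : ℕ} (hσ : σ ^ 2 = 1)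
    (ht : t ^ 3 + ((σ * 3 * r * b : ℤ) : N) * t - ((b : ℤ) : N) = 0) (hb : ¬ 3 ∣ b)
    (h1 : ¬ 3 ∣ σ * r * b + 1) (h9 : ¬ 9 ∣ (b : ℤ) ^ 3 + σ * 3 * r * b * b - b) {s : 𝓞 K}
    (hs : s ^ 2 = -3 * ((4 * σ * r ^ 3 * b + 1 : ℤ) : 𝓞 K)) {v : HeightOneSpectrum (𝓞 K)}
    (hv : (3 : 𝓞 K) ∈ v.asIdeal) (n : ℕ) :
    emultiplicity v.asIdeal (Ideal.span {((3 ^ 1 * b : ℕ) : 𝓞 K)}) ≤ n ↔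
      ∀ u ∈ unitFiltration K v n, IsLocalNorm K N v u := by
  have hD3 : ¬ 3 ∣ 4 * σ * r ^ 3 * b + 1 := three_dvd_dualDisc_iff.not.2 h1
  obtain ⟨hsv, h3v⟩ := intValuation_sqrt_eq h2 hv hD3 hs
  have hπ := hsv
  rw [← valued_algebraMap_eq] at hπ
  have hirr := irreducible_of_valued_eq hπ
  obtain ⟨d, m, hd, hm, hm3, hd3, hker⟩ := congruences_of_not_three_dvd_add_one (b := b) hσ
    (by omega) h1 h9
  have h3O : algebraMap (𝓞 K) (v.adicCompletionIntegers K) s ∣ 3 := by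
    rw [dvd_iff_valued_le, hπ, ← map_ofNat (algebraMap (𝓞 K) (v.adicCompletionIntegers K)) 3,
      valued_algebraMap_eq, h3v, exp_le_exp]
    norm_num
  obtain ⟨hub, y, hlb⟩ := conductor_exponent_of_three_ramified (F := v.adicCompletion K) hirr h3O
    hd hm hm3 hd3 hD3 hker (by
      rw [← map_pow, hs, map_mul, map_intCast, map_neg, map_ofNat (algebraMap (𝓞 K) _) 3])
  refine emultiplicity_le_iff_forall_mem_unitFiltration hπ (e := 2) ?_ ?_ ?_ n
  · push_cast
    rw [map_mul, h3v, intValuation_natCast_eq_one hv hb, mul_one]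
  · intro u _ hd
    rw [isLocalNorm_coe_iff h3 htop ht]
    exact hub u hd
  · intro _
    refine ⟨_, isUnit_one_add_mul hirr.not_isUnit y, by simp, ?_⟩
    rw [isLocalNorm_coe_iff h3 htop ht]
    exact hlb

/-- The uniformizer is √(−3∂), and 3b = 9m has valuation 4. -/
theorem emultiplicity_le_iff_of_three_dvd (h2 : Module.finrank ℚ K = 2)
    (h3 : Module.finrank K N = 3) {t : N}
    (htop : K⟮t⟯ = ⊤) {σ r : ℤ} {b m : ℕ}
    (ht : t ^ 3 + ((σ * 3 * r * b : ℤ) : N) * t - ((b : ℤ) : N) = 0) (hb : b = 3 * m)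
    (hm : ¬ 3 ∣ m) {s : 𝓞 K}
    (hs : s ^ 2 = -3 * ((4 * σ * r ^ 3 * b + 1 : ℤ) : 𝓞 K)) {v : HeightOneSpectrum (𝓞 K)}
    (hv : (3 : 𝓞 K) ∈ v.asIdeal) (n : ℕ) :
    emultiplicity v.asIdeal (Ideal.span {((3 ^ 1 * b : ℕ) : 𝓞 K)}) ≤ n ↔
      ∀ u ∈ unitFiltration K v n, IsLocalNorm K N v u := by
  have hD1 : 3 ∣ (4 * σ * r ^ 3 * b + 1) - 1 := ⟨4 * σ * r ^ 3 * m, by rw [hb]; push_cast; ring⟩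
  have hD3 : ¬ 3 ∣ 4 * σ * r ^ 3 * b + 1 := by omega
  obtain ⟨hsv, h3v⟩ := intValuation_sqrt_eq h2 hv hD3 hs
  have hπ := hsv
  rw [← valued_algebraMap_eq] at hπ
  have hirr := irreducible_of_valued_eq hπ
  have h3O : algebraMap (𝓞 K) (v.adicCompletionIntegers K) s ∣ 3 := by
    rw [dvd_iff_valued_le, hπ, ← map_ofNat (algebraMap (𝓞 K) (v.adicCompletionIntegers K)) 3,
      valued_algebraMap_eq, h3v, exp_le_exp]
    norm_num
  obtain ⟨hub, y, hlb⟩ := conductor_exponent_of_three_dvd (F := v.adicCompletion K) (σ := σ)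
    (r := r) (b := b) (m := m) hirr h3O
    (by exact_mod_cast hb) (by omega) hD3 hD1 (by
      rw [← map_pow, hs, map_mul, map_intCast, map_neg, map_ofNat (algebraMap (𝓞 K) _) 3])
  refine emultiplicity_le_iff_forall_mem_unitFiltration hπ (e := 4) ?_ ?_ ?_ n
  · rw [hb]
    push_cast
    rw [map_mul, map_mul, h3v, intValuation_natCast_eq_one hv hm, mul_one, ← exp_add]
    norm_num
  · intro u _ hd
    rw [isLocalNorm_coe_iff h3 htop ht]
    exact hub u hd
  · intro _
    refine ⟨1 + algebraMap (𝓞 K) (v.adicCompletionIntegers K) s ^ 3 * y,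
      isUnit_one_add_mul (fun h => hirr.not_isUnit (isUnit_pow_iff (by norm_num) |>.1 h)) y,
      by simp, ?_⟩
    rw [isLocalNorm_coe_iff h3 htop ht]
    exact hlb

end ConductorOfTrinomial

/-! ### The conductor as an ideal. -/

section ConductorIdeal

theorem exists_ringOfIntegers_sq_eq {K : Type*} [Field K] {D : ℤ} {s : K} (hs : s ^ 2 = D) :
    ∃ s' : 𝓞 K, s' ^ 2 = (D : 𝓞 K) := by
  have hint : IsIntegral ℤ s := IsIntegral.of_pow (n := 2) (by norm_num)
    (by rw [hs]; exact isIntegral_algebraMap (R := ℤ) (A := K) (x := D))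
  obtain ⟨s', rfl⟩ : ∃ s' : 𝓞 K, algebraMap (𝓞 K) K s' = s := ⟨⟨s, hint⟩, rfl⟩
  refine ⟨s', FaithfulSMul.algebraMap_injective (𝓞 K) K ?_⟩
  rw [map_pow, hs, map_intCast]

variable {K : Type*} [Field K] [NumberField K] {N : Type*} [Field N] [NumberField N] [Algebra K N]

/-- With w = σr³b this is y = (1 + √(−3∂))/2; modulo a prime dividing b, −y is a root of X² + X + 1.
-/
theorem exists_integral_half_one_add {S : K} {w : ℤ} (hS : S ^ 2 = ((-3 * (4 * w + 1) : ℤ) : K)) :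
    ∃ y : 𝓞 K, y ^ 2 - y + 1 + ((3 * w : ℤ) : 𝓞 K) = 0 := by
  have hy : ((1 + S) / 2) ^ 2 - (1 + S) / 2 + 1 + ((3 * w : ℤ) : K) = 0 := by
    push_cast at hS ⊢
    linear_combination hS / 4
  have hint : IsIntegral ℤ ((1 + S) / 2) := by
    refine ⟨X ^ 2 - X + 1 + C (3 * w), by monicity!, ?_⟩
    rw [← Polynomial.aeval_def]
    simpa [map_ofNat (aeval (R := ℤ) ((1 + S) / 2)) 3] using hy
  obtain ⟨y, hy'⟩ : ∃ y : 𝓞 K, algebraMap (𝓞 K) K y = (1 + S) / 2 := ⟨⟨_, hint⟩, rfl⟩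
  refine ⟨y, FaithfulSMul.algebraMap_injective (𝓞 K) K ?_⟩
  rw [map_add, map_add, map_sub, map_pow, map_one, map_zero, map_intCast, hy', hy]

/-- Since ∂ ≡ 1 mod b, primes p ≠ 3 dividing b do not divide the discriminant of K, and so do not
ramify there. -/
theorem not_dvd_of_three_mul_or {σ r : ℤ} {b p : ℕ} (hp : p.Prime) (hpb : p ∣ b) (hp3 : p ≠ 3)
    {d : ℤ} (hd : 3 * d = -(4 * σ * r ^ 3 * b + 1) ∨ d = -3 * (4 * σ * r ^ 3 * b + 1)) :
    ¬ (p : ℤ) ∣ d := by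
  have hpi := Nat.prime_iff_prime_int.1 hp
  have hpb' : (p : ℤ) ∣ 4 * σ * r ^ 3 * b := (Int.natCast_dvd_natCast.2 hpb).mul_left _
  have h1 : ¬ (p : ℤ) ∣ 4 * σ * r ^ 3 * b + 1 := fun h =>
    hpi.not_dvd_one ((dvd_add_right hpb').1 h)
  intro h
  rcases hd with hd | hd
  · have := h.mul_left 3
    rw [hd, dvd_neg] at this
    exact h1 this
  · rw [hd] at h
    rcases hpi.dvd_or_dvd h with h | h
    · rw [dvd_neg] at h
      exact hp3 ((Nat.prime_dvd_prime_iff_eq hp Nat.prime_three).1 (by exact_mod_cast h))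
    · exact h1 h

theorem span_natCast_ne_bot {f : ℕ} (hf : f ≠ 0) : Ideal.span {(f : 𝓞 K)} ≠ ⊥ := by
  simpa using hf

/-- The conductor if `3` is unramified in the quadratic subfield. -/
theorem isConductor_of_three_dvd_add_one (h3 : Module.finrank K N = 3) {t : N}
    (htop : K⟮t⟯ = ⊤) {σ r : ℤ} {b : ℕ} (hσ : σ ^ 2 = 1)
    (ht : t ^ 3 + ((σ * 3 * r * b : ℤ) : N) * t - ((b : ℤ) : N) = 0) (hsq : Squarefree b)
    (hb : ¬ 3 ∣ b) (h1 : 3 ∣ σ * r * b + 1) (h9 : ¬ 9 ∣ (b : ℤ) ^ 3 + σ * 3 * r * b * b - b)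
    {D : ℤ} (hD : 3 * D = -(4 * σ * r ^ 3 * b + 1)) (hD3 : ¬ 3 ∣ D) {s : K}
    (hs : s ^ 2 = (D : K)) (hdisc : discr K = D) :
    IsConductor K N (Ideal.span {((3 ^ 2 * b : ℕ) : 𝓞 K)}) := by
  refine ⟨span_natCast_ne_bot (mul_ne_zero (by norm_num) hsq.ne_zero), fun v n => ?_⟩
  by_cases hv : (3 : 𝓞 K) ∈ v.asIdeal
  · obtain ⟨s', hs'⟩ := exists_ringOfIntegers_sq_eq hs
    exact emultiplicity_le_iff_of_three_unramified h3 htop hσ ht hb h1 h9 hD hD3 hs'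
      (hdisc ▸ hD3) hv n
  -- As D = −∂/3, the square of 3s is −3∂.
  · obtain ⟨y, hy⟩ := exists_integral_half_one_add (S := 3 * s) (w := σ * r ^ 3 * b) (by
      rw [mul_pow, hs, show -3 * (4 * (σ * r ^ 3 * b) + 1) = 9 * D by linear_combination -3 * hD]
      push_cast
      ring)
    exact emultiplicity_le_iff_of_three_notMem h3 htop hσ ht hsq
      (fun p hp hpb hp3 => not_dvd_of_three_mul_or hp hpb hp3 (Or.inl (hdisc ▸ hD)))
      (y := y) (by rw [← hy]; push_cast; ring) hv n

/-- The conductor if `3` is ramified in the quadratic subfield. -/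
theorem isConductor_of_three_ramified (h2 : Module.finrank ℚ K = 2) (h3 : Module.finrank K N = 3)
    {t : N} (htop : K⟮t⟯ = ⊤) {σ r : ℤ} {b : ℕ} (hσ : σ ^ 2 = 1)
    (ht : t ^ 3 + ((σ * 3 * r * b : ℤ) : N) * t - ((b : ℤ) : N) = 0) (hsq : Squarefree b)
    (h1 : 3 ∣ b ∨ ¬ 3 ∣ σ * r * b + 1) (h9 : ¬ 9 ∣ (b : ℤ) ^ 3 + σ * 3 * r * b * b - b) {s : K}
    (hs : s ^ 2 = ((-3 * (4 * σ * r ^ 3 * b + 1) : ℤ) : K))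
    (hdisc : discr K = -3 * (4 * σ * r ^ 3 * b + 1)) :
    IsConductor K N (Ideal.span {((3 ^ 1 * b : ℕ) : 𝓞 K)}) := by
  refine ⟨span_natCast_ne_bot (mul_ne_zero (by norm_num) hsq.ne_zero), fun v n => ?_⟩
  by_cases hv : (3 : 𝓞 K) ∈ v.asIdeal
  · obtain ⟨s', hs'⟩ := exists_ringOfIntegers_sq_eq hs
    rw [Int.cast_mul, Int.cast_neg, Int.cast_ofNat] at hs'
    by_cases hb : 3 ∣ b
    · obtain ⟨m, hm⟩ := hb
      refine emultiplicity_le_iff_of_three_dvd h2 h3 htop ht hm ?_ hs' hv n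
      rintro ⟨k, rfl⟩
      have := hsq 3 ⟨k, by rw [hm]; ring⟩
      simp at this
    · exact emultiplicity_le_iff_of_three_ramified h2 h3 htop hσ ht hb (h1.resolve_left hb) h9 hs'
        hv n
  · obtain ⟨y, hy⟩ := exists_integral_half_one_add (S := s) (w := σ * r ^ 3 * b) (by
      rw [hs]; push_cast; ring)
    exact emultiplicity_le_iff_of_three_notMem h3 htop hσ ht hsq
      (fun p hp hpb hp3 => not_dvd_of_three_mul_or hp hpb hp3 (Or.inr hdisc))
      (y := y) (by rw [← hy]; push_cast; ring) hv n

end ConductorIdeal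

/-! ### Generators of K over ℚ and of N over K. -/

section QuadraticSubfield

theorem adjoin_eq_top_of_eq_smul {E : Type*} [Field E] [Algebra ℚ E] {x y : E} (q : ℚ)
    (h : x = q • y) (hx : ℚ⟮x⟯ = ⊤) : ℚ⟮y⟯ = ⊤ := by
  rw [eq_top_iff, ← hx, IntermediateField.adjoin_simple_le_iff, h]
  exact IntermediateField.smul_mem _ (IntermediateField.mem_adjoin_simple_self ℚ y)

theorem adjoin_gen_eq_top {E : Type*} [Field E] [CharZero E] (x : E) :
    ℚ⟮AdjoinSimple.gen ℚ x⟯ = ⊤ := by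
  have h : @IntermediateField.adjoin ℚ _ ℚ⟮x⟯ _ (IntermediateField.algebra' ℚ⟮x⟯)
      {AdjoinSimple.gen ℚ x} = ⊤ := by
    apply IntermediateField.lift_injective ℚ⟮x⟯
    rw [IntermediateField.lift_adjoin_simple, IntermediateField.lift_top, AdjoinSimple.coe_gen]
  convert h <;> exact Subsingleton.elim _ _

theorem adjoin_eq_bot_of_sq_eq {E : Type*} [Field E] [Algebra ℚ E] {x : E} {q : ℚ}
    (hx : x ^ 2 = algebraMap ℚ E (q ^ 2)) : ℚ⟮x⟯ = ⊥ := by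
  rw [IntermediateField.adjoin_simple_eq_bot_iff, IntermediateField.mem_bot]
  rw [map_pow, sq_eq_sq_iff_eq_or_eq_neg] at hx
  rcases hx with h | h
  · exact ⟨q, h.symm⟩
  · exact ⟨-q, by rw [h, map_neg]⟩

/-- The discriminant of `ℚ(√D)` for squarefree `D ≡ 1` modulo `4`. -/
theorem discr_eq_of_sq_eq {K : Type*} [Field K] [NumberField K] {s : K} {D : ℤ}
    (hs : s ^ 2 = D) (htop : ℚ⟮s⟯ = ⊤) (hD : Squarefree D) (h4 : D % 4 = 1) : discr K = D := by
  by_cases hD1 : D = 1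
  · subst hD1
    have hbot : ℚ⟮s⟯ = ⊥ := adjoin_eq_bot_of_sq_eq (q := 1) (by simpa using hs)
    rw [htop] at hbot
    let e : K ≃ₐ[ℚ] ℚ := (IntermediateField.topEquiv.symm.trans
      (IntermediateField.equivOfEq hbot)).trans (IntermediateField.botEquiv ℚ K)
    rw [discr_eq_discr_of_algEquiv K e, Rat.numberField_discr]
  · exact (discr_of_sq_eq hs htop hD hD1 h4).2

/-- This makes θ a generator of N over K, so that the trinomial describes the local norms. -/
theorem adjoin_algebraMap_eq_top {L N : Type*} [Field L] [Field N] [NumberField L] [NumberField N]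
    [Algebra L N] {θ : L} (hL : ℚ⟮θ⟯ = ⊤) {δ : N} (htop : IntermediateField.adjoin L {δ} = ⊤) :
    ℚ⟮δ⟯⟮algebraMap L N θ⟯ = ⊤ := by
  set E := ℚ⟮δ⟯⟮algebraMap L N θ⟯ with hE
  have hmem : ∀ x : L, algebraMap L N x ∈ E := by
    intro x
    have hx : x ∈ ℚ⟮θ⟯ := hL ▸ IntermediateField.mem_top
    induction hx using IntermediateField.adjoin_induction with
    | mem y hy =>
      rw [Set.mem_singleton_iff.1 hy]
      exact IntermediateField.mem_adjoin_simple_self _ _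
    | algebraMap q =>
      rw [eq_ratCast, map_ratCast]
      exact SubfieldClass.ratCast_mem E q
    | add y z _ _ h1 h2 => rw [map_add]; exact add_mem h1 h2
    | inv y _ h => rw [map_inv₀]; exact inv_mem h
    | mul y z _ _ h1 h2 => rw [map_mul]; exact mul_mem h1 h2
  refine eq_top_iff.2 fun x hx => ?_
  replace hx : x ∈ IntermediateField.adjoin L {δ} := htop ▸ IntermediateField.mem_top
  induction hx using IntermediateField.adjoin_induction with
  | mem y hy =>
    rw [Set.mem_singleton_iff.1 hy]
    exact E.algebraMap_mem (AdjoinSimple.gen ℚ δ)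
  | algebraMap y => exact hmem y
  | add y z _ _ h1 h2 => exact add_mem h1 h2
  | inv y _ h => exact inv_mem h
  | mul y z _ _ h1 h2 => exact mul_mem h1 h2

theorem isGalois_and_isCyclic_of_isNormalClosure {L N : Type*} [Field L] [NumberField L] [Field N]
    [NumberField N] [Algebra L N] [IsNormalClosure ℚ L N] (K : IntermediateField ℚ N)
    (h3 : Module.finrank K N = 3) : IsGalois K N ∧ IsCyclic (N ≃ₐ[K] N) := by
  have : Normal ℚ N := IsNormalClosure.normal (F := ℚ) (K := L)
  have : IsGalois ℚ N := ⟨⟩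
  have hgal : IsGalois K N := inferInstance
  have : Fact (Nat.Prime 3) := ⟨Nat.prime_three⟩
  exact ⟨hgal, isCyclic_of_prime_card (p := 3) ((IsGalois.card_aut_eq_finrank K N).trans h3)⟩

end QuadraticSubfield

/-! ### Explicit square roots in K and in the dual field. -/

section SquareRoots

variable {σ : ℤ} {r b : ℕ}

theorem dualDisc_emod_four : dualDisc σ r b % 4 = 1 := by
  have : dualDisc σ r b = 4 * (σ * r ^ 3 * b) + 1 := by rw [dualDisc]; ring
  omega

theorem dualDisc_ne_one (hσ : σ = 1 ∨ σ = -1) (hr : 0 < r) (hb : 0 < b) : dualDisc σ r b ≠ 1 := by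
  have hσ0 : σ ≠ 0 := by rcases hσ with rfl | rfl <;> norm_num
  have : σ * 4 * (r : ℤ) ^ 3 * b ≠ 0 := by positivity
  rw [dualDisc]
  omega

theorem dualDisc_eq_neg_three_iff (hσ : σ = 1 ∨ σ = -1) :
    dualDisc σ r b = -3 ↔ σ = -1 ∧ r = 1 ∧ b = 1 := by
  constructor
  · intro h
    rw [dualDisc] at h
    have h0 : (0 : ℤ) ≤ (r : ℤ) ^ 3 * b := by positivity
    rcases hσ with rfl | rfl
    · nlinarith
    · have h1 : (r : ℤ) ^ 3 * b = 1 := by linarith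
      have h2 : r ^ 3 * b = 1 := by exact_mod_cast h1
      rw [mul_eq_one] at h2
      exact ⟨rfl, by simpa using h2.1, h2.2⟩
  · rintro ⟨rfl, rfl, rfl⟩
    norm_num [dualDisc]

theorem three_dvd_dualDisc : 3 ∣ dualDisc σ r b ↔ 3 ∣ σ * r * b + 1 := by
  rw [← three_dvd_dualDisc_iff, dualDisc, mul_comm σ 4]

theorem not_nine_dvd_of_squarefree {n : ℤ} (h : Squarefree n) : ¬ 9 ∣ n := fun h9 => by
  have := h 3 (by norm_num; exact h9)
  rw [Int.isUnit_iff] at this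
  omega

/-- The square root of the discriminant yields a generator of the quadratic subfield whose square
is the discriminant of that subfield. -/
theorem exists_sq_eq_and_adjoin_sqrt_eq_top (hσ : σ = 1 ∨ σ = -1) (hb : 0 < b)
    (hsq : Squarefree (dualDisc σ r b)) {N : Type*} [Field N] [CharZero N] {δ : N}
    (hδ : δ ^ 2 = ((-27 * (b : ℤ) ^ 2 * dualDisc σ r b : ℤ) : N)) :
    ∃ D : ℤ, ∃ s : ℚ⟮δ⟯, s ^ 2 = (D : ℚ⟮δ⟯) ∧ ℚ⟮s⟯ = ⊤ ∧ Squarefree D ∧ D % 4 = 1 ∧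
      (D = 1 ↔ σ = -1 ∧ r = 1 ∧ b = 1) ∧
      (3 ∣ dualDisc σ r b → 3 * D = -dualDisc σ r b) ∧
      (¬ 3 ∣ dualDisc σ r b → D = -3 * dualDisc σ r b) := by
  have h4 := dualDisc_emod_four (σ := σ) (r := r) (b := b)
  have hgen : AdjoinSimple.gen ℚ δ ^ 2 = ((-27 * (b : ℤ) ^ 2 * dualDisc σ r b : ℤ) : ℚ⟮δ⟯) := by
    apply (algebraMap ℚ⟮δ⟯ N).injective
    rw [map_pow, map_intCast, AdjoinSimple.algebraMap_gen, hδ]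
  have htop := adjoin_gen_eq_top δ
  have hb0 : (b : ℚ⟮δ⟯) ≠ 0 := by exact_mod_cast hb.ne'
  have hbq : (b : ℚ) ≠ 0 := by exact_mod_cast hb.ne'
  by_cases h3 : 3 ∣ dualDisc σ r b
  · obtain ⟨D, hD⟩ := h3
    -- For ∂ = 3D one has δ² = −81b²D.
    refine ⟨-D, AdjoinSimple.gen ℚ δ / (9 * b), ?_, ?_, ?_, by omega, ?_, fun _ => by omega,
      fun h => absurd ⟨D, hD⟩ h⟩
    · rw [div_pow, hgen, hD]
      field_simp
      push_cast
      ring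
    · refine adjoin_eq_top_of_eq_smul (9 * b) ?_ htop
      rw [Algebra.smul_def, map_mul, map_natCast, map_ofNat]
      field_simp
    · exact hsq.squarefree_of_dvd ⟨-3, by rw [hD]; ring⟩
    · rw [← dualDisc_eq_neg_three_iff hσ]
      omega
  · refine ⟨-3 * dualDisc σ r b, AdjoinSimple.gen ℚ δ / (3 * b), ?_, ?_, ?_, by omega, ?_,
      fun h => absurd h h3, fun _ => rfl⟩
    · rw [div_pow, hgen]
      field_simp
      push_cast
      ring
    · refine adjoin_eq_top_of_eq_smul (3 * b) ?_ htop
      rw [Algebra.smul_def, map_mul, map_natCast, map_ofNat]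
      field_simp
    · exact squarefree_mul_iff.2 ⟨((Int.prime_three.coprime_iff_not_dvd).2 h3).neg_left.isRelPrime,
        Int.prime_three.neg.squarefree, hsq⟩
    · rw [← dualDisc_eq_neg_three_iff hσ]
      omega

/-- The dual field. -/
theorem discr_dual_eq (hσ : σ = 1 ∨ σ = -1) (hr : 0 < r) (hb : 0 < b)
    (hsq : Squarefree (dualDisc σ r b)) {d : ℤ}
    (hd : 3 * d = -dualDisc σ r b ∨ d = -3 * dualDisc σ r b) {M : Type*} [Field M] [NumberField M]
    {η : M} (hη : η ^ 2 = ((-3 * d : ℤ) : M)) (htop : ℚ⟮η⟯ = ⊤) :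
    Module.finrank ℚ M = 2 ∧ discr M = dualDisc σ r b ∧
      ∃ ε : M, ε ^ 2 = (dualDisc σ r b : M) ∧ ℚ⟮ε⟯ = ⊤ := by
  obtain ⟨ε, hε, hεtop⟩ : ∃ ε : M, ε ^ 2 = (dualDisc σ r b : M) ∧ ℚ⟮ε⟯ = ⊤ := by
    -- Either −3d = ∂ or −3d = 9∂; the latter explains the factor 1/3.
    rcases hd with hd | hd
    · exact ⟨η, by rw [hη]; congr 1; linear_combination -hd, htop⟩
    · refine ⟨η / 3, ?_, adjoin_eq_top_of_eq_smul 3 ?_ htop⟩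
      · rw [div_pow, hη, hd]
        push_cast
        ring
      · rw [Algebra.smul_def, map_ofNat]
        ring
  obtain ⟨h1, h2⟩ := discr_of_sq_eq hε hεtop hsq (dualDisc_ne_one hσ hr hb) dualDisc_emod_four
  exact ⟨h1, h2, ε, hε, hεtop⟩

end SquareRoots

/-! ### Assembly of the theorem. -/

theorem mainTheorem2 {σ : ℤ} (hσ : σ = 1 ∨ σ = -1) {r b : ℕ} (hr : 0 < r) (hb : 0 < b)
    {L : Type*} [Field L] [NumberField L] (θ : L)
    (hθ : aeval θ (cubicTrinomial σ r b) = 0) (hL : ℚ⟮θ⟯ = ⊤) :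
    -- discriminant and signature of the cubic field `L`
    (Module.finrank ℚ L = 3 ∧
      (cubicTrinomial σ r b).discr = -27 * (b : ℤ) ^ 2 * dualDisc σ r b ∧
      equationIndex θ ≠ 0 ∧
      (discr L : ℚ) = ((cubicTrinomial σ r b).discr : ℚ) / (equationIndex θ : ℚ) ^ 2 ∧
      (σ = 1 → InfinitePlace.nrRealPlaces L = 1 ∧ InfinitePlace.nrComplexPlaces L = 1) ∧
      (σ = -1 → IsTotallyReal L)) ∧
    -- the monogenic case
    (IsMonogenicGenerator θ → Squarefree b →
      equationIndex θ = 1 ∧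
      discr L = (cubicTrinomial σ r b).discr ∧
      -- `N` is the Galois closure of `L`, and `δ` is a square root of the discriminant
      ∀ (N : Type*) [Field N] [NumberField N] [Algebra L N] [IsNormalClosure ℚ L N],
        (∃ δ : N, δ ^ 2 = (discr L : N)) ∧
        ∀ δ : N, δ ^ 2 = (discr L : N) →
          IntermediateField.adjoin L {δ} = ⊤ ∧
          (¬ (σ = -1 ∧ r = 1 ∧ b = 1) →
            Module.finrank ℚ ℚ⟮δ⟯ = 2 ∧
            ∀ K' : IntermediateField ℚ N, Module.finrank ℚ K' = 2 → K' = ℚ⟮δ⟯) ∧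
          (σ = -1 ∧ r = 1 ∧ b = 1 → ℚ⟮δ⟯ = ⊥) ∧
          Module.finrank ℚ⟮δ⟯ N = 3 ∧ IsGalois ℚ⟮δ⟯ N ∧ IsCyclic (N ≃ₐ[ℚ⟮δ⟯] N) ∧
          (∃ f f₀ m : ℕ,
            IsConductor ℚ⟮δ⟯ N (Ideal.span {(f : 𝓞 ℚ⟮δ⟯)}) ∧
            discr L = (f : ℤ) ^ 2 * discr ℚ⟮δ⟯ ∧
            f = 3 ^ m * f₀ ∧ Squarefree f₀ ∧ Nat.Coprime f₀ 3 ∧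
            (3 ∣ b ∧ ¬ 9 ∣ b →
              f = 3 * b ∧ b = 3 * f₀ ∧ m = 2 ∧ ¬ 3 ∣ dualDisc σ r b ∧
              discr ℚ⟮δ⟯ = -3 * dualDisc σ r b) ∧
            (¬ 3 ∣ b → 3 ∣ σ * r * b + 1 →
              f = 9 * b ∧ b = f₀ ∧ m = 2 ∧ (3 ∣ dualDisc σ r b ∧ ¬ 9 ∣ dualDisc σ r b) ∧
              3 * discr ℚ⟮δ⟯ = -dualDisc σ r b) ∧
            (¬ 3 ∣ b → ¬ 3 ∣ σ * r * b + 1 →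
              f = 3 * b ∧ b = f₀ ∧ m = 1 ∧ ¬ 3 ∣ dualDisc σ r b ∧
              discr ℚ⟮δ⟯ = -3 * dualDisc σ r b)) ∧
          -- `M` is the dual field: generated by a square root of `-3` times the discriminant
          -- of the field generated by `δ`
          ∀ (M : Type*) [Field M] [NumberField M] (η : M),
            η ^ 2 = ((-3 * discr ℚ⟮δ⟯ : ℤ) : M) → ℚ⟮η⟯ = ⊤ →
              Module.finrank ℚ M = 2 ∧ discr M = dualDisc σ r b ∧
              ∃ ε : M, ε ^ 2 = (dualDisc σ r b : M) ∧ ℚ⟮ε⟯ = ⊤) := by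
  obtain ⟨hi0, hdP⟩ := discr_polynomial_eq hσ hr hb hθ hL
  have h3L := finrank_eq_three hσ hr hb hθ hL
  have hdisc := discr_cubicTrinomial hσ r b
  refine ⟨⟨h3L, hdisc, hi0, ?_, signature_of_sign hσ hr hb hθ hL⟩, ?_⟩
  · rw [hdP]
    field_simp
  intro hmon hbsq
  have hi1 := equationIndex_eq_one hmon
  have hdL : discr L = (cubicTrinomial σ r b).discr := by
    rw [hi1] at hdP
    have : ((cubicTrinomial σ r b).discr : ℚ) = discr L := by simpa using hdP
    exact_mod_cast this.symm
  have hsq := squarefree_dualDisc hσ hr hb hθ hL hmon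
  have h9 := not_nine_dvd_of_isMonogenicGenerator hσ hr hb hθ hL hmon
  have hσ2 : σ ^ 2 = 1 := by rcases hσ with rfl | rfl <;> norm_num
  have hdual : dualDisc σ r b = 4 * σ * r ^ 3 * b + 1 := by rw [dualDisc]; ring
  refine ⟨hi1, hdL, fun N _ _ _ _ => ?_⟩
  obtain ⟨hex, hadj⟩ := exists_sq_eq_and_adjoin_eq_top hσ hr hb hθ hL N
  rw [hdL]
  refine ⟨hex, fun δ hδ => ?_⟩
  have hLtop := hadj δ hδ
  have ht : algebraMap L N θ ^ 3 + ((σ * 3 * r * b : ℤ) : N) * algebraMap L N θ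
      - ((b : ℤ) : N) = 0 := by
    rw [aeval_cubicTrinomial] at hθ
    have := congrArg (algebraMap L N) hθ
    simpa [map_ofNat (algebraMap L N) 3] using this
  have hNtop := adjoin_algebraMap_eq_top hL hLtop
  obtain ⟨hquad, hbot⟩ := finrank_adjoin_of_sq_eq h3L hδ hLtop
  rw [hdisc] at hδ ⊢
  obtain ⟨D, s, hs, hs_top, hDsq, hD4, hD1, hD3, hDn3⟩ :=
    exists_sq_eq_and_adjoin_sqrt_eq_top hσ hb hsq hδ
  have hdK : discr ℚ⟮δ⟯ = D := discr_eq_of_sq_eq hs hs_top hDsq hD4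
  have h2K : ¬ (σ = -1 ∧ r = 1 ∧ b = 1) → Module.finrank ℚ ℚ⟮δ⟯ = 2 := fun h =>
    (discr_of_sq_eq hs hs_top hDsq (fun h1 => h (hD1.1 h1)) hD4).1
  have hKbot : σ = -1 ∧ r = 1 ∧ b = 1 → ℚ⟮δ⟯ = ⊥ := by
    rintro ⟨rfl, rfl, rfl⟩
    -- Here ∂ = −3 and d_L = 81.
    refine adjoin_eq_bot_of_sq_eq (q := 9) ?_
    rw [hδ]
    norm_num [dualDisc]
  have h3N : Module.finrank ℚ⟮δ⟯ N = 3 := by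
    by_cases h : σ = -1 ∧ r = 1 ∧ b = 1
    · exact hbot (hKbot h)
    · exact (hquad (h2K h)).1
  obtain ⟨hgal, hcyc⟩ := isGalois_and_isCyclic_of_isNormalClosure (L := L) ℚ⟮δ⟯ h3N
  refine ⟨hLtop, fun h => ⟨h2K h, (hquad (h2K h)).2⟩, hKbot, h3N, hgal, hcyc, ?_, ?_⟩
  · by_cases h3 : 3 ∣ dualDisc σ r b
    · have hDe := hD3 h3
      have h1 := three_dvd_dualDisc.1 h3
      have h9D := not_nine_dvd_of_squarefree hsq
      have hb3 : ¬ 3 ∣ b := by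
        rintro ⟨k, rfl⟩
        obtain ⟨l, hl⟩ := h1
        push_cast at hl
        have : 3 * (l - σ * r * k) = 1 := by linear_combination -hl
        omega
      refine ⟨3 ^ 2 * b, b, 2, ?_, ?_, rfl, hbsq, ?_, fun h => absurd h.1 hb3,
        fun _ _ => ⟨by norm_num, rfl, rfl, ⟨h3, h9D⟩, hdK ▸ hDe⟩, fun _ h => absurd h1 h⟩
      · exact isConductor_of_three_dvd_add_one h3N hNtop hσ2 ht hbsq hb3 h1 h9 (hdual ▸ hDe)
          (by omega) hs hdK
      · rw [hdK]
        push_cast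
        linear_combination -27 * (b : ℤ) ^ 2 * hDe
      · exact ((Nat.Prime.coprime_iff_not_dvd Nat.prime_three).2 hb3).symm
    · have hDe := hDn3 h3
      have h1 : ¬ 3 ∣ σ * r * b + 1 := three_dvd_dualDisc.not.1 h3
      -- The exceptional triple has D = 1, which −3∂ cannot be; so K is quadratic whenever 3 ∤ ∂.
      have hex : ¬ (σ = -1 ∧ r = 1 ∧ b = 1) := by
        rw [← hD1]; omega
      have hcond : IsConductor ℚ⟮δ⟯ N (Ideal.span {((3 ^ 1 * b : ℕ) : 𝓞 ℚ⟮δ⟯)}) :=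
        isConductor_of_three_ramified (h2K hex) h3N hNtop hσ2 ht hbsq (Or.inr h1) h9
          (by rw [hs, hDe, hdual]) (by rw [hdK, hDe, hdual])
      have hdd : -27 * (b : ℤ) ^ 2 * dualDisc σ r b
          = ((3 ^ 1 * b : ℕ) : ℤ) ^ 2 * discr ℚ⟮δ⟯ := by
        rw [hdK, hDe]
        push_cast
        ring
      by_cases hb3 : 3 ∣ b
      · obtain ⟨m, hm⟩ := hb3
        have hm3 : ¬ 3 ∣ m := by
          rintro ⟨k, rfl⟩
          have := hbsq 3 ⟨k, by rw [hm]; ring⟩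
          simp at this
        refine ⟨3 ^ 1 * b, m, 2, hcond, hdd, by rw [hm]; ring,
          hbsq.squarefree_of_dvd ⟨3, by rw [hm]; ring⟩, ?_,
          fun _ => ⟨by norm_num, hm, rfl, h3, by rw [hdK, hDe]⟩,
          fun h => absurd ⟨m, hm⟩ h, fun h => absurd ⟨m, hm⟩ h⟩
        exact ((Nat.Prime.coprime_iff_not_dvd Nat.prime_three).2 hm3).symm
      · exact ⟨3 ^ 1 * b, b, 1, hcond, hdd, rfl, hbsq,
          ((Nat.Prime.coprime_iff_not_dvd Nat.prime_three).2 hb3).symm,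
          fun h => absurd h.1 hb3, fun _ h => absurd h h1,
          fun _ _ => ⟨by norm_num, rfl, rfl, h3, by rw [hdK, hDe]⟩⟩
  · intro M _ _ η hη hηtop
    refine discr_dual_eq hσ hr hb hsq ?_ hη hηtop
    rw [hdK]
    by_cases h3 : 3 ∣ dualDisc σ r b
    · exact Or.inl (hD3 h3)
    · exact Or.inr (hDn3 h3)
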